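/- For coprime integers $p\ge 1$ and $q\geq 1$ let $\operatorname{inv}_p(q)$ denote the smallest positive integer $a$ with $aq\equiv 1 \pmod p$ (so $\operatorname{inv}_1(q)=1$). For real $U\ge 1$ consider the quadruples $(p,q,n,k)$ of integers satisfying \[ \gcd(p,q)=1,\qquad p,q\ge 1,\qquad \operatorname{inv}_p(q)\le p/2,\qquad 2\le nq+kp\le U^2,\qquad 1\le k<n . \] Let $R_1(U),\dots,R_5(U)$ be the numbers of such quadruples which satisfy, in addition, respectively, (1) $p\le q\le U$; (2) $p\le q$ and $U<q$; (3) $q<p\le U$; (4) $q<p$, $U<p$ and $n\le U$; (5) $q<p$, $U<p$ and $U<n$. Let $\gamma$ be the Euler--Mascheroni constant and $\zeta$ the Riemann zeta function. Then, for all real $U\ge 1$ and with absolute implied constants, \[ R_1(U)=\frac{\log 2}{4\zeta(2)}U^4\log U+O(U^4),\qquad R_2(U)=\frac{\log 2}{4\zeta(2)}U^4\log U+O(U^4), \] \[ R_3(U)=\frac{U^4(\log U)^2}{8\zeta(2)}+\frac{U^4\log U}{4\zeta(2)}\Bigl(\gamma-\frac{\zeta'(2)}{\zeta(2)}+\frac{3\zeta(2)}{4}-\log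 2\Bigr)+O(U^4), \] \[ R_4(U)=\frac{U^4(\log U)^2}{8\zeta(2)}+\frac{U^4\log U}{4\zeta(2)}(\gamma-\log 2)+O(U^4), \] \[ R_5(U)=\frac{U^4}{4\zeta(2)}(\log U)^2+\frac{U^4}{2\zeta(2)}\Bigl(\gamma-\frac{\zeta'(2)}{2\zeta(2)}-\frac32+\frac{3\zeta(2)}{8}\Bigr)\log U+O(U^4). \] -/

import Mathlib

noncomputable section

/-- `modInv p q` is the smallest positive integer `a` with `a * q ≡ 1 (mod p)`, for coprime
`p ≥ 1` and `q`.  In particular `modInv 1 q = 1`. -/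
def modInv (p q : ℕ) : ℕ :=
  sInf {a : ℕ | 1 ≤ a ∧ a * q ≡ 1 [MOD p]}

/-- The system of conditions on `(p, q, n, k)`, with real parameter `Q`. -/
structure IsSystemSolution (Q : ℝ) (p q n k : ℕ) : Prop where
  coprime : Nat.gcd p q = 1
  one_le_p : 1 ≤ p
  one_le_q : 1 ≤ q
  inv_le : (modInv p q : ℝ) ≤ (p : ℝ) / 2
  two_le : 2 ≤ n * q + k * p
  le_Q : (n : ℝ) * q + (k : ℝ) * p ≤ Q
  one_le_k : 1 ≤ k
  k_lt_n : k < n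

/-- Case 1: `p ≤ q ≤ U`. -/
def Case1 (U : ℝ) (p q _n _k : ℕ) : Prop := p ≤ q ∧ (q : ℝ) ≤ U

/-- Case 2: `p ≤ q`, `U < q`. -/
def Case2 (U : ℝ) (p q _n _k : ℕ) : Prop := p ≤ q ∧ U < (q : ℝ)

/-- Case 3: `q < p ≤ U`. -/
def Case3 (U : ℝ) (p q _n _k : ℕ) : Prop := q < p ∧ (p : ℝ) ≤ U

/-- Case 4: `q < p`, `U < p`, `n ≤ U`. -/
def Case4 (U : ℝ) (p q n _k : ℕ) : Prop := q < p ∧ U < (p : ℝ) ∧ (n : ℝ) ≤ U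

/-- Case 5: `q < p`, `U < p`, `U < n`. -/
def Case5 (U : ℝ) (p q n _k : ℕ) : Prop := q < p ∧ U < (p : ℝ) ∧ U < (n : ℝ)

/-- The solutions `(p, q, n, k)` of the system with `Q = U ^ 2` that obey a further constraint. -/
def solutionSet (U : ℝ) (P : ℕ → ℕ → ℕ → ℕ → Prop) : Set (ℕ × ℕ × ℕ × ℕ) :=
  {x | IsSystemSolution (U ^ 2) x.1 x.2.1 x.2.2.1 x.2.2.2 ∧ P x.1 x.2.1 x.2.2.1 x.2.2.2}

/-- The solution sets are finite, so that `Set.ncard` really counts their elements. -/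
theorem solutionSet_finite (U : ℝ) (P : ℕ → ℕ → ℕ → ℕ → Prop) : (solutionSet U P).Finite := by
  have hfin : (Set.Iic ⌊U ^ 2⌋₊).Finite := Set.finite_Iic _
  refine (hfin.prod (hfin.prod (hfin.prod hfin))).subset ?_
  rintro ⟨p, q, n, k⟩ ⟨h, -⟩
  have hp := h.one_le_p
  have hq := h.one_le_q
  have hk := h.one_le_k
  have hn := h.k_lt_n
  have hQ : n * q + k * p ≤ ⌊U ^ 2⌋₊ := by
    apply Nat.le_floor
    push_cast
    exact h.le_Q
  simp only at hp hq hk hn hQ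
  have h1 : n ≤ n * q := Nat.le_mul_of_pos_right n hq
  have h2 : q ≤ n * q := Nat.le_mul_of_pos_left q (by omega)
  have h3 : p ≤ k * p := Nat.le_mul_of_pos_left p hk
  have h4 : k ≤ k * p := Nat.le_mul_of_pos_right k hp
  simp only [Set.mem_prod, Set.mem_Iic]
  omega

/-- The number of solutions in each of the five cases. -/
def R₁ (U : ℝ) : ℕ := (solutionSet U (Case1 U)).ncard
def R₂ (U : ℝ) : ℕ := (solutionSet U (Case2 U)).ncard
def R₃ (U : ℝ) : ℕ := (solutionSet U (Case3 U)).ncard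
def R₄ (U : ℝ) : ℕ := (solutionSet U (Case4 U)).ncard
def R₅ (U : ℝ) : ℕ := (solutionSet U (Case5 U)).ncard

/-- The real number `ζ(2)`. -/
def zetaTwo : ℝ := (riemannZeta 2).re

/-- The real number `ζ'(2)`. -/
def zetaDerivTwo : ℝ := (deriv riemannZeta 2).re

end

/-!
Write `N = U ^ 2` and let `LowerInv p q` say that `p`, `q` are coprime and the inverse of `q`
modulo `p` lies in the lower half. The counts are sums over lattice points with
`n q + k p ≤ N` of the indicator of `LowerInv p q`. Two facts make the sums computable.

*Equidistribution.* For a fixed `c`, the indicator of `LowerInv c x` as a function of `x` is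
`c`-periodic with mean `lowerDensity c`, which is `φ(c) / (2 c)` unless `c ≤ 2`, and over intervals
its sum follows the mean up to `O(c^(7/8))`. By Fourier analysis this reduces to a power saving in
Kloosterman sums. Weil's bound is not needed: the fourth moment of the Kloosterman sums modulo `c`
counts the solutions of `u₁ + u₂ = u₃ + u₄`, `u₁⁻¹ + u₂⁻¹ = u₃⁻¹ + u₄⁻¹`, which factor
(`hyperbola_energy_le`), and each sum occurs at least `φ(c) / gcd(m, c)` times in the moment
(`norm_kloostermanSum_pow_four_le`). The reciprocity `a q + b p = 1 + p q` for the inverses `a` of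
`q` modulo `p` and `b` of `p` modulo `q` (`lowerInv_comm_iff`) gives the same for `LowerInv x c`,
so that the density and the discrepancy are known in either variable
(`exists_abs_card_lowerInv_sub_le`).

*Interval fibres.* Fix the smaller one, `s`, of `p` and `q`, and the pair `(n, k)`. The larger one
then runs over an interval, and there are at most `(N / s)²` relevant pairs `(n, k)`. Since
`∑ s^(7/8) / s²` converges, replacing the indicator by its density costs `O(N²)`
(`exists_abs_sum_card_sub_le`). The total length of the intervals over `s` is approximately
`N² / s` times an elementary factor: for one coefficient a sum of positive parts is replaced by a
quadratic integral (`abs_sum_posPart_sub_le`), and the sum over the other one is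
`quadKernel Y = ∑ (Y - k)² / k = Y² (log Y + γ - 3 / 2) + O(Y)`.

It remains to sum `density q / q` against `1`, `log (x / q)` and `(1 - q / x)²`. Möbius inversion of
`φ(q) / q²` reduces this to harmonic sums and to `∑ μ(d) / d² = 1 / ζ(2)` and
`∑ μ(d) log d / d² = ζ'(2) / ζ(2)²`; the densities at `q = 1, 2` account for the terms with `3 / 8`.

For `R₁` and `R₂` the outer variable is `p`; up to `O(U⁴)` solutions with `p ≤ U < q` the condition
on `q` may be replaced by the same condition on `p`. For `R₃`, `R₅` and the number of all solutions
with `q < p` the outer variable is `q`, and `R₄` is the difference.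
-/

noncomputable section

open Finset

/-! ### Annihilators and the energy of the hyperbola -/

/-- The number of elements of a finite ring annihilated by `y`. -/
def annCard {R : Type*} [CommRing R] [Fintype R] [DecidableEq R] (y : R) : ℕ :=
  #{x : R | y * x = 0}

section AnnCard

variable {R : Type*} [CommRing R] [Fintype R] [DecidableEq R]

/-- A nonempty solution set of `y x = z` is a translate of the annihilator of `y`. -/
lemma card_mul_eq_le_annCard (y z : R) : #{x : R | y * x = z} ≤ annCard y := by
  classical
  rcases Finset.eq_empty_or_nonempty ({x : R | y * x = z} : Finset R) with h | ⟨x₀, hx₀⟩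
  · simp [h]
  · refine Finset.card_le_card_of_injOn (fun x => x - x₀) ?_ (fun a _ b _ h => by simpa using h)
    intro x hx
    simp only [Finset.coe_filter, Finset.mem_univ, true_and, Set.mem_ofPred_eq,
      Finset.mem_filter] at hx hx₀ ⊢
    rw [mul_sub, hx, hx₀, sub_self]

lemma annCard_mul_le (a b : R) : annCard (a * b) ≤ annCard a * annCard b := by
  classical
  rw [mul_comm (annCard a)]
  refine Finset.card_le_mul_card_image_of_maps_to (f := fun x => b * x) ?_ _ ?_
  · intro x hx
    simp only [Finset.mem_filter, Finset.mem_univ, true_and] at hx ⊢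
    rw [← mul_assoc, hx]
  · intro y _
    refine le_trans (Finset.card_le_card ?_) (card_mul_eq_le_annCard b y)
    intro x hx
    simp only [Finset.mem_filter, Finset.mem_univ, true_and] at hx ⊢
    exact hx.2

/-- Energy of the hyperbola `x y = 1`: the pairs of equations `u₁ + u₂ = u₃ + u₄` and
`u₁⁻¹ + u₂⁻¹ = u₃⁻¹ + u₄⁻¹` force `(u₁ - u₃) (u₁ - u₄) (u₃ + u₄) = 0`, so that the solutions are
counted by annihilators. -/
lemma hyperbola_energy_le :
    #{x : (Rˣ × Rˣ) × (Rˣ × Rˣ) |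
        (x.1.1 : R) + x.1.2 = x.2.1 + x.2.2 ∧
        ((x.1.1⁻¹ : Rˣ) : R) + (x.1.2⁻¹ : Rˣ) = (x.2.1⁻¹ : Rˣ) + (x.2.2⁻¹ : Rˣ)} ≤
      annCard (2 : R) * (∑ u : R, annCard u) ^ 2 := by
  classical
  calc _ ≤ #{y : (R × R) × R | (y.1.1 * y.1.2 * 2) * y.2 = y.1.1 * y.1.2 * (y.1.1 + y.1.2)} := by
        refine Finset.card_le_card_of_injOn
          (fun x => (((x.1.1 : R) - x.2.1, (x.1.1 : R) - x.2.2), (x.1.1 : R))) ?_ ?_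
        · rintro ⟨⟨a, b⟩, ⟨d, e⟩⟩ hx
          simp only [Finset.coe_filter, Finset.mem_univ, true_and, Set.mem_ofPred_eq] at hx ⊢
          obtain ⟨h1, h2⟩ := hx
          have e1 : (a : R) * b * (((a⁻¹ : Rˣ) : R) + (b⁻¹ : Rˣ)) = a + b := by
            linear_combination (b : R) * a.mul_inv + (a : R) * b.mul_inv
          have e2 : (d : R) * e * (((d⁻¹ : Rˣ) : R) + (e⁻¹ : Rˣ)) = d + e := by
            linear_combination (e : R) * d.mul_inv + (d : R) * e.mul_inv
          have e3 : ((d : R) + e) * (a * b - d * e) = 0 := by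
            rw [← h2] at e2
            linear_combination (d * e : R) * e1 - (a * b : R) * e2 + (d * e : R) * h1
          have hb : (b : R) = d + e - a := by linear_combination h1
          rw [hb] at e3
          linear_combination -e3
        · rintro ⟨⟨a, b⟩, ⟨d, e⟩⟩ hx ⟨⟨a', b'⟩, ⟨d', e'⟩⟩ hx' h
          simp only [Finset.coe_filter, Finset.mem_univ, true_and, Set.mem_ofPred_eq] at hx hx'
          simp only [Prod.mk.injEq] at h
          obtain ⟨⟨h1, h2⟩, h3⟩ := h
          have ha : a = a' := Units.ext h3
          have hd : d = d' := Units.ext (by rw [h3] at h1; exact sub_right_injective h1)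
          have he : e = e' := Units.ext (by rw [h3] at h2; exact sub_right_injective h2)
          subst ha hd he
          have hb : b = b' := Units.ext (by linear_combination hx.1 - hx'.1)
          rw [hb]
    _ ≤ ∑ w : R × R, annCard (w.1 * w.2 * 2) := by
        rw [Finset.card_filter, Fintype.sum_prod_type]
        refine Finset.sum_le_sum fun w _ => ?_
        rw [← Finset.card_filter]
        exact card_mul_eq_le_annCard (w.1 * w.2 * 2) (w.1 * w.2 * (w.1 + w.2))
    _ ≤ ∑ w : R × R, annCard w.1 * annCard w.2 * annCard (2 : R) :=
        Finset.sum_le_sum fun w _ => (annCard_mul_le _ _).trans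
          (Nat.mul_le_mul_right _ (annCard_mul_le _ _))
    _ = _ := by
        rw [Fintype.sum_prod_type, sq, Finset.sum_mul_sum, mul_comm, Finset.sum_mul]
        exact Finset.sum_congr rfl fun i _ => by rw [Finset.sum_mul]

end AnnCard

/-! ### Annihilators in `ZMod c` -/

section ZModAnn

variable {c : ℕ} [NeZero c]

lemma annCard_le_of_pos {d : ℕ} (hd : 0 < d) : annCard (d : ZMod c) ≤ d := by
  have h := IsAddCyclic.card_nsmul_eq_zero_le (α := ZMod c) hd
  unfold annCard
  simpa [nsmul_eq_mul] using h

lemma annCard_le_gcd (m : ZMod c) : annCard m ≤ Nat.gcd m.val c := by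
  have hpos : 0 < Nat.gcd m.val c := Nat.gcd_pos_of_pos_right _ (NeZero.pos c)
  refine le_trans (Finset.card_le_card ?_) (annCard_le_of_pos (c := c) hpos)
  intro x hx
  simp only [Finset.mem_filter, Finset.mem_univ, true_and] at hx ⊢
  have hb := Nat.gcd_eq_gcd_ab m.val c
  have : ((Nat.gcd m.val c : ℕ) : ZMod c) = m * (Nat.gcdA m.val c : ℤ) := by
    have := congrArg (Int.cast : ℤ → ZMod c) hb
    push_cast at this
    rw [ZMod.natCast_zmod_val, ZMod.natCast_self] at this
    rw [this]; ring
  rw [this]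
  linear_combination ((Nat.gcdA m.val c : ℤ) : ZMod c) * hx

lemma sum_zmod_eq_sum_range {M : Type*} [AddCommMonoid M] (f : ℕ → M) :
    ∑ m : ZMod c, f m.val = ∑ j ∈ range c, f j := by
  refine Finset.sum_bij (fun m _ => m.val) (fun m _ => mem_range.2 (ZMod.val_lt m))
    (fun a _ b _ h => ZMod.val_injective c h) (fun j hj => ⟨(j : ZMod c), mem_univ _, ?_⟩)
    (fun _ _ => rfl)
  exact ZMod.val_cast_of_lt (mem_range.1 hj)

lemma gcd_le_sum_divisors (j : ℕ) {n : ℕ} (hn : n ≠ 0) :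
    (Nat.gcd j n) ≤ ∑ d ∈ n.divisors, if d ∣ j then d else 0 := by
  have hmem : Nat.gcd j n ∈ n.divisors := Nat.mem_divisors.2 ⟨Nat.gcd_dvd_right _ _, hn⟩
  refine le_trans ?_ (Finset.single_le_sum (fun _ _ => Nat.zero_le _) hmem)
  rw [if_pos (Nat.gcd_dvd_left _ _)]

lemma sum_annCard_le : ∑ u : ZMod c, annCard u ≤ c * c.divisors.card := by
  have hc := NeZero.ne c
  calc ∑ u : ZMod c, annCard u ≤ ∑ u : ZMod c, Nat.gcd u.val c :=
        Finset.sum_le_sum fun u _ => annCard_le_gcd u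
    _ = ∑ j ∈ range c, Nat.gcd j c := sum_zmod_eq_sum_range (fun j => Nat.gcd j c)
    _ ≤ ∑ j ∈ range c, ∑ d ∈ c.divisors, if d ∣ j then d else 0 :=
        Finset.sum_le_sum fun j _ => gcd_le_sum_divisors j hc
    _ = ∑ d ∈ c.divisors, ∑ j ∈ range c, if d ∣ j then d else 0 := Finset.sum_comm
    _ ≤ ∑ d ∈ c.divisors, c := by
        refine Finset.sum_le_sum fun d hd => ?_
        obtain ⟨e, he⟩ := Nat.dvd_of_mem_divisors hd
        have hd0 : 0 < d := Nat.pos_of_mem_divisors hd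
        rw [← Finset.sum_filter, Finset.sum_const, smul_eq_mul]
        have : #{j ∈ range c | d ∣ j} ≤ e := by
          rw [← Finset.card_range e]
          refine Finset.card_le_card_of_injOn (fun j => j / d) ?_ ?_
          · intro j hj
            simp only [Finset.coe_filter, mem_range, Set.mem_ofPred_eq, coe_range,
              Set.mem_Iio] at hj ⊢
            rw [Nat.div_lt_iff_lt_mul hd0, mul_comm]; omega
          · intro j hj j' hj' h
            simp only [Finset.coe_filter, mem_range, Set.mem_ofPred_eq] at hj hj'
            exact (Nat.div_left_inj hj.2 hj'.2).1 h
        calc _ ≤ e * d := Nat.mul_le_mul_right _ this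
          _ = c := by rw [he, mul_comm]
    _ = _ := by rw [Finset.sum_const, smul_eq_mul, mul_comm]

end ZModAnn

/-! ### Kloosterman sums -/

section Kloosterman

variable {c : ℕ} [NeZero c]

/-- Parseval's identity on `(ZMod c)²` for a sum of characters. -/
lemma sum_sq_norm_sum_stdAddChar {ι : Type*} [Fintype ι] [DecidableEq ι] (f g : ι → ZMod c) :
    ∑ m : ZMod c, ∑ n : ZMod c, ‖∑ i, ZMod.stdAddChar (m * f i + n * g i)‖ ^ 2 =
      (c : ℝ) ^ 2 * #{x : ι × ι | f x.1 = f x.2 ∧ g x.1 = g x.2} := by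
  have hprim := ZMod.isPrimitive_stdAddChar c
  have key : ∀ m n : ZMod c, ((‖∑ i, ZMod.stdAddChar (m * f i + n * g i)‖ ^ 2 : ℝ) : ℂ) =
      ∑ i, ∑ j, ZMod.stdAddChar (m * (f i - f j)) * ZMod.stdAddChar (n * (g i - g j)) := by
    intro m n
    rw [Complex.ofReal_pow, ← Complex.mul_conj', map_sum, Finset.sum_mul_sum]
    refine Finset.sum_congr rfl fun i _ => Finset.sum_congr rfl fun j _ => ?_
    rw [AddChar.starComp_apply (by rw [ZMod.ringChar_zmod_n]; exact NeZero.pos c),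
      AddChar.inv_apply, ← AddChar.map_add_eq_mul, ← AddChar.map_add_eq_mul]
    congr 1
    ring
  apply Complex.ofReal_injective
  push_cast [Complex.ofReal_sum]
  have key' : ∀ m n : ZMod c, ((‖∑ i, ZMod.stdAddChar (m * f i + n * g i)‖ : ℝ) : ℂ) ^ 2 =
      ∑ i, ∑ j, ZMod.stdAddChar (m * (f i - f j)) * ZMod.stdAddChar (n * (g i - g j)) := by
    intro m n
    rw [← key]; push_cast; rfl
  simp_rw [key']
  have h1 : ∀ m : ZMod c, ∑ n : ZMod c, ∑ i, ∑ j,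
      (ZMod.stdAddChar (m * (f i - f j)) : ℂ) * ZMod.stdAddChar (n * (g i - g j)) =
      ∑ i, ∑ j, ZMod.stdAddChar (m * (f i - f j)) *
        ∑ n : ZMod c, ZMod.stdAddChar (n * (g i - g j)) := by
    intro m
    rw [Finset.sum_comm]
    refine Finset.sum_congr rfl fun i _ => ?_
    rw [Finset.sum_comm]
    exact Finset.sum_congr rfl fun j _ => by rw [Finset.mul_sum]
  simp_rw [h1]
  rw [Finset.sum_comm]
  have h2 : ∀ i : ι, ∑ m : ZMod c, ∑ j, (ZMod.stdAddChar (m * (f i - f j)) : ℂ) *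
        ∑ n : ZMod c, ZMod.stdAddChar (n * (g i - g j)) =
      ∑ j, (∑ m : ZMod c, ZMod.stdAddChar (m * (f i - f j))) *
        ∑ n : ZMod c, ZMod.stdAddChar (n * (g i - g j)) := by
    intro i
    rw [Finset.sum_comm]
    exact Finset.sum_congr rfl fun j _ => by rw [Finset.sum_mul]
  simp_rw [h2, AddChar.sum_mulShift _ hprim, ZMod.card, sub_eq_zero]
  rw [← Fintype.sum_prod_type', Finset.card_filter]
  push_cast
  rw [Finset.mul_sum]
  refine Finset.sum_congr rfl fun x _ => ?_
  by_cases h1 : f x.1 = f x.2 <;> by_cases h2 : g x.1 = g x.2 <;> simp [h1, h2, sq]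

/-- The Kloosterman sum `∑ e((m u + n u⁻¹) / c)` over the units modulo `c`. -/
def kloostermanSum (m n : ZMod c) : ℂ :=
  ∑ u : (ZMod c)ˣ, ZMod.stdAddChar (m * (u : ZMod c) + n * ((u⁻¹ : (ZMod c)ˣ) : ZMod c))

lemma kloostermanSum_sq (m n : ZMod c) :
    kloostermanSum m n ^ 2 = ∑ w : (ZMod c)ˣ × (ZMod c)ˣ,
      ZMod.stdAddChar (m * ((w.1 : ZMod c) + (w.2 : ZMod c)) +
        n * (((w.1⁻¹ : (ZMod c)ˣ) : ZMod c) + ((w.2⁻¹ : (ZMod c)ˣ) : ZMod c))) := by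
  rw [kloostermanSum, sq, Finset.sum_mul_sum, Fintype.sum_prod_type]
  refine Finset.sum_congr rfl fun i _ => Finset.sum_congr rfl fun j _ => ?_
  rw [← AddChar.map_add_eq_mul]
  congr 1
  ring

/-- The fourth moment of the Kloosterman sums is `c²` times the energy of the hyperbola. -/
lemma sum_norm_kloostermanSum_pow_four_le :
    ∑ m : ZMod c, ∑ n : ZMod c, ‖kloostermanSum m n‖ ^ 4 ≤
      2 * (c : ℝ) ^ 4 * (c.divisors.card : ℝ) ^ 2 := by
  have h : ∀ m n : ZMod c, ‖kloostermanSum m n‖ ^ 4 = ‖∑ w : (ZMod c)ˣ × (ZMod c)ˣ,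
      ZMod.stdAddChar (m * ((w.1 : ZMod c) + (w.2 : ZMod c)) +
        n * (((w.1⁻¹ : (ZMod c)ˣ) : ZMod c) + ((w.2⁻¹ : (ZMod c)ˣ) : ZMod c)))‖ ^ 2 := by
    intro m n
    rw [← kloostermanSum_sq, norm_pow]; ring
  simp_rw [h]
  rw [sum_sq_norm_sum_stdAddChar]
  have h1 := hyperbola_energy_le (R := ZMod c)
  have h2 : annCard (2 : ZMod c) ≤ 2 := by
    simpa using annCard_le_of_pos (c := c) (d := 2) (by norm_num)
  have h3 : #{x : ((ZMod c)ˣ × (ZMod c)ˣ) × ((ZMod c)ˣ × (ZMod c)ˣ) |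
        (x.1.1 : ZMod c) + x.1.2 = x.2.1 + x.2.2 ∧
        ((x.1.1⁻¹ : (ZMod c)ˣ) : ZMod c) + (x.1.2⁻¹ : (ZMod c)ˣ) =
          (x.2.1⁻¹ : (ZMod c)ˣ) + (x.2.2⁻¹ : (ZMod c)ˣ)} ≤ 2 * (c * c.divisors.card) ^ 2 :=
    h1.trans (Nat.mul_le_mul h2 (Nat.pow_le_pow_left sum_annCard_le 2))
  have h4 : ((#{x : ((ZMod c)ˣ × (ZMod c)ˣ) × ((ZMod c)ˣ × (ZMod c)ˣ) |
        (x.1.1 : ZMod c) + x.1.2 = x.2.1 + x.2.2 ∧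
        ((x.1.1⁻¹ : (ZMod c)ˣ) : ZMod c) + (x.1.2⁻¹ : (ZMod c)ˣ) =
          (x.2.1⁻¹ : (ZMod c)ˣ) + (x.2.2⁻¹ : (ZMod c)ˣ)} : ℕ) : ℝ) ≤
      2 * (c * c.divisors.card) ^ 2 := by exact_mod_cast h3
  calc _ ≤ (c : ℝ) ^ 2 * (2 * (c * c.divisors.card) ^ 2) := by gcongr
    _ = _ := by ring

lemma kloostermanSum_mul_unit (m n : ZMod c) (v : (ZMod c)ˣ) :
    kloostermanSum (m * (v : ZMod c)) (n * ((v⁻¹ : (ZMod c)ˣ) : ZMod c)) = kloostermanSum m n := by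
  unfold kloostermanSum
  refine Fintype.sum_equiv (Equiv.mulLeft v) _ _ fun u => ?_
  simp only [Equiv.coe_mulLeft, Units.val_mul, mul_inv]
  congr 1
  ring

lemma kloostermanSum_comm (m n : ZMod c) : kloostermanSum m n = kloostermanSum n m := by
  unfold kloostermanSum
  refine Fintype.sum_equiv (Equiv.inv _) _ _ fun u => ?_
  simp only [Equiv.inv_apply, inv_inv]
  congr 1
  ring

lemma le_totient_mul_card_divisors (n : ℕ) : n ≤ n.totient * n.divisors.card := by
  rcases Nat.eq_zero_or_pos n with rfl | hn
  · simp
  calc n = ∑ d ∈ n.divisors, d.totient := (Nat.sum_totient n).symm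
    _ ≤ ∑ d ∈ n.divisors, n.totient := Finset.sum_le_sum fun d hd =>
        Nat.le_of_dvd (Nat.totient_pos.2 hn) (Nat.totient_dvd_of_dvd (Nat.dvd_of_mem_divisors hd))
    _ = _ := by rw [Finset.sum_const, smul_eq_mul, mul_comm]

/-- Kloosterman's bound: `|K(m, n)|` is constant along the `φ(c)` pairs `(m v, n v⁻¹)`, each of
which arises from at most `gcd(m, c)` units `v`, so that the fourth moment controls each
single sum. -/
lemma norm_kloostermanSum_pow_four_le (m n : ZMod c) :
    ‖kloostermanSum m n‖ ^ 4 ≤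
      Nat.gcd m.val c * (2 * (c : ℝ) ^ 3 * (c.divisors.card : ℝ) ^ 3) := by
  classical
  have hc : (0 : ℝ) < c := by exact_mod_cast NeZero.pos c
  let F : (ZMod c)ˣ → ZMod c × ZMod c := fun v =>
    (m * (v : ZMod c), n * ((v⁻¹ : (ZMod c)ˣ) : ZMod c))
  have h1 : (c.totient : ℝ) * ‖kloostermanSum m n‖ ^ 4 ≤
      Nat.gcd m.val c * (2 * (c : ℝ) ^ 4 * (c.divisors.card : ℝ) ^ 2) := by
    calc (c.totient : ℝ) * ‖kloostermanSum m n‖ ^ 4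
        = ∑ v : (ZMod c)ˣ,
            ‖kloostermanSum (m * (v : ZMod c)) (n * ((v⁻¹ : (ZMod c)ˣ) : ZMod c))‖ ^ 4 := by
          simp_rw [kloostermanSum_mul_unit]
          rw [Finset.sum_const, Finset.card_univ, ZMod.card_units_eq_totient, nsmul_eq_mul]
      _ = ∑ w : ZMod c × ZMod c, ∑ v ∈ univ.filter (fun v : (ZMod c)ˣ => F v = w),
            ‖kloostermanSum (m * (v : ZMod c)) (n * ((v⁻¹ : (ZMod c)ˣ) : ZMod c))‖ ^ 4 :=
          (Finset.sum_fiberwise univ F _).symm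
      _ ≤ ∑ w : ZMod c × ZMod c, Nat.gcd m.val c * ‖kloostermanSum w.1 w.2‖ ^ 4 := by
          refine Finset.sum_le_sum fun w _ => ?_
          calc _ = ∑ v ∈ univ.filter (fun v : (ZMod c)ˣ => F v = w),
                ‖kloostermanSum w.1 w.2‖ ^ 4 := by
                refine Finset.sum_congr rfl fun v hv => ?_
                rw [← (Finset.mem_filter.1 hv).2]
            _ ≤ _ := by
                rw [Finset.sum_const, nsmul_eq_mul]
                gcongr
                refine le_trans ?_ ((card_mul_eq_le_annCard m w.1).trans (annCard_le_gcd m))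
                refine Finset.card_le_card_of_injOn (fun v => (v : ZMod c)) ?_
                  (fun a _ b _ h => Units.ext h)
                intro v hv
                simp only [Finset.coe_filter, Finset.mem_univ, true_and, Set.mem_ofPred_eq] at hv ⊢
                rw [← hv]
      _ ≤ _ := by
          rw [← Finset.mul_sum, Fintype.sum_prod_type]
          gcongr
          exact sum_norm_kloostermanSum_pow_four_le
  have h2 : (c : ℝ) ≤ c.totient * c.divisors.card := by
    exact_mod_cast le_totient_mul_card_divisors c
  have h3 : (c : ℝ) * ‖kloostermanSum m n‖ ^ 4 ≤
      c * (Nat.gcd m.val c * (2 * (c : ℝ) ^ 3 * (c.divisors.card : ℝ) ^ 3)) := by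
    calc _ ≤ (c.totient * c.divisors.card : ℝ) * ‖kloostermanSum m n‖ ^ 4 := by gcongr
      _ = c.divisors.card * (c.totient * ‖kloostermanSum m n‖ ^ 4) := by ring
      _ ≤ c.divisors.card *
          (Nat.gcd m.val c * (2 * (c : ℝ) ^ 4 * (c.divisors.card : ℝ) ^ 2)) := by gcongr
      _ = _ := by ring
  exact le_of_mul_le_mul_left h3 hc

/-- The quantity `(2 c³ τ(c)³)^(1/4)` that bounds Kloosterman sums modulo `c`, up to a greatest
common divisor. -/
def kloostermanBound (c : ℕ) : ℝ := (2 * (c : ℝ) ^ 3 * (c.divisors.card : ℝ) ^ 3) ^ (1 / 4 : ℝ)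

lemma kloostermanBound_nonneg (c : ℕ) : 0 ≤ kloostermanBound c := by
  unfold kloostermanBound; positivity

lemma norm_kloostermanSum_le_left (m n : ZMod c) :
    ‖kloostermanSum m n‖ ≤ kloostermanBound c * Nat.gcd m.val c := by
  have hg : (1 : ℝ) ≤ Nat.gcd m.val c := by
    exact_mod_cast Nat.gcd_pos_of_pos_right _ (NeZero.pos c)
  refine le_of_pow_le_pow_left₀ (n := 4) (by norm_num)
    (mul_nonneg (kloostermanBound_nonneg c) (by positivity)) ?_
  refine (norm_kloostermanSum_pow_four_le m n).trans ?_
  have hB : kloostermanBound c ^ 4 = 2 * (c : ℝ) ^ 3 * (c.divisors.card : ℝ) ^ 3 := by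
    unfold kloostermanBound
    rw [← Real.rpow_natCast, ← Real.rpow_mul (by positivity)]
    norm_num
  rw [mul_pow, hB, mul_comm]
  gcongr
  exact le_self_pow₀ hg (by norm_num)

lemma norm_kloostermanSum_le_right (m n : ZMod c) :
    ‖kloostermanSum m n‖ ≤ kloostermanBound c * Nat.gcd n.val c := by
  rw [kloostermanSum_comm]
  exact norm_kloostermanSum_le_left n m

end Kloosterman

/-! ### Points of the modular hyperbola in boxes -/

section Discrepancy

variable {c : ℕ} [NeZero c]

/-- The Fourier coefficient at `m` of the residues `1, …, X` modulo `c`. -/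
def intervalFourier (X : ℕ) (m : ZMod c) : ℂ :=
  ∑ y ∈ Icc 1 X, ZMod.stdAddChar (-(m * (y : ZMod c)))

lemma norm_stdAddChar (x : ZMod c) : ‖(ZMod.stdAddChar x : ℂ)‖ = 1 := by
  rw [ZMod.stdAddChar_apply, Circle.norm_coe]

lemma norm_intervalFourier_le (X : ℕ) (m : ZMod c) : ‖intervalFourier X m‖ ≤ X := by
  refine (norm_sum_le _ _).trans ?_
  simp

lemma two_mul_mul_one_sub_le_sin {t : ℝ} (h0 : 0 ≤ t) (h1 : t ≤ 1) :
    2 * (t * (1 - t)) ≤ Real.sin (Real.pi * t) := by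
  have hpi := Real.pi_pos
  rcases le_total t (1 / 2) with h | h
  · have := Real.mul_le_sin (x := Real.pi * t) (by positivity) (by nlinarith)
    have e : 2 / Real.pi * (Real.pi * t) = 2 * t := by field_simp
    nlinarith
  · have := Real.mul_le_sin (x := Real.pi * (1 - t)) (by nlinarith) (by nlinarith)
    have e : 2 / Real.pi * (Real.pi * (1 - t)) = 2 * (1 - t) := by field_simp
    have e2 : Real.sin (Real.pi * (1 - t)) = Real.sin (Real.pi * t) := by
      rw [mul_sub, mul_one, Real.sin_pi_sub]
    nlinarith

lemma norm_stdAddChar_sub_one_ge (m : ZMod c) :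
    4 * ((m.val : ℝ) * (c - m.val)) / (c : ℝ) ^ 2 ≤ ‖(ZMod.stdAddChar m : ℂ) - 1‖ := by
  have hc : (0 : ℝ) < c := by exact_mod_cast NeZero.pos c
  have hm : (m.val : ℝ) ≤ c := by exact_mod_cast (ZMod.val_lt m).le
  have e : (ZMod.stdAddChar m : ℂ) =
      Complex.exp (Complex.I * ((2 * Real.pi * m.val / c : ℝ) : ℂ)) := by
    have := ZMod.stdAddChar_coe (N := c) (m.val : ℤ)
    rw [Int.cast_natCast, ZMod.natCast_zmod_val] at this
    rw [this]
    congr 1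
    push_cast
    ring
  rw [e, Complex.norm_exp_I_mul_ofReal_sub_one]
  have h := two_mul_mul_one_sub_le_sin (t := m.val / c) (by positivity)
    ((div_le_one hc).2 hm)
  have e2 : 2 * Real.pi * m.val / c / 2 = Real.pi * (m.val / c) := by ring
  rw [e2, norm_mul, Real.norm_ofNat]
  have e3 : 4 * ((m.val : ℝ) * (c - m.val)) / (c : ℝ) ^ 2 =
      2 * (2 * (m.val / c * (1 - m.val / c))) := by field_simp; ring
  rw [e3]
  have := Real.le_norm_self (Real.sin (Real.pi * (m.val / c)))
  linarith

lemma norm_intervalFourier_le_of_ne_zero (X : ℕ) {m : ZMod c} (hm : m ≠ 0) :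
    ‖intervalFourier X m‖ ≤ c / 2 * (1 / (m.val : ℝ) + 1 / ((c : ℝ) - m.val)) := by
  have hc : (0 : ℝ) < c := by exact_mod_cast NeZero.pos c
  have hlt : (m.val : ℝ) < c := by exact_mod_cast ZMod.val_lt m
  have hpos : (0 : ℝ) < m.val := by
    exact_mod_cast Nat.pos_of_ne_zero (by rwa [Ne, ZMod.val_eq_zero])
  set z : ℂ := ZMod.stdAddChar (-m) with hz
  have hz1 : ‖z‖ = 1 := norm_stdAddChar _
  have hge : 4 * ((m.val : ℝ) * (c - m.val)) / (c : ℝ) ^ 2 ≤ ‖z - 1‖ := by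
    have h := norm_stdAddChar_sub_one_ge (-m)
    rw [ZMod.neg_val, if_neg hm, Nat.cast_sub (ZMod.val_lt m).le] at h
    refine le_trans (le_of_eq ?_) h
    ring
  have hne : z ≠ 1 := by
    intro h
    rw [h, sub_self, norm_zero] at hge
    have : 0 < 4 * ((m.val : ℝ) * (c - m.val)) / (c : ℝ) ^ 2 := by
      have : (0 : ℝ) < c - m.val := by linarith
      positivity
    linarith
  have hsum : intervalFourier X m = z * ((z ^ X - 1) / (z - 1)) := by
    rw [← geom_sum_eq hne]
    unfold intervalFourier
    induction X with
    | zero => simp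
    | succ X ih =>
      have e : ZMod.stdAddChar (-(m * ((X + 1 : ℕ) : ZMod c))) = z ^ (X + 1) := by
        rw [hz, ← AddChar.map_nsmul_eq_pow, nsmul_eq_mul]
        congr 1
        ring
      rw [Finset.sum_Icc_succ_top (by omega), ih, Finset.sum_range_succ, e]
      ring
  have h2 : ‖z ^ X - 1‖ ≤ 2 := by
    refine (norm_sub_le _ _).trans ?_
    rw [norm_pow, hz1, one_pow, norm_one]; norm_num
  rw [hsum, norm_mul, hz1, one_mul, norm_div]
  have hd : (0 : ℝ) < c - m.val := by linarith
  calc _ ≤ 2 / (4 * ((m.val : ℝ) * (c - m.val)) / (c : ℝ) ^ 2) := by gcongr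
    _ = _ := by field_simp; ring

lemma sum_gcd_div_le (c : ℕ) (hc : c ≠ 0) :
    ∑ j ∈ Icc 1 c, (Nat.gcd j c : ℝ) / j ≤ c.divisors.card * (1 + Real.log c) := by
  calc ∑ j ∈ Icc 1 c, (Nat.gcd j c : ℝ) / j
      ≤ ∑ j ∈ Icc 1 c, ∑ d ∈ c.divisors, (if d ∣ j then (d : ℝ) else 0) / j := by
        refine Finset.sum_le_sum fun j _ => ?_
        rw [← Finset.sum_div]
        gcongr
        have := gcd_le_sum_divisors j hc
        exact_mod_cast this
    _ = ∑ d ∈ c.divisors, ∑ j ∈ Icc 1 c, (if d ∣ j then (d : ℝ) else 0) / j := Finset.sum_comm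
    _ ≤ ∑ d ∈ c.divisors, (1 + Real.log c) := by
        refine Finset.sum_le_sum fun d hd => ?_
        have hd0 : 0 < d := Nat.pos_of_mem_divisors hd
        have hd0' : (0 : ℝ) < d := by exact_mod_cast hd0
        refine le_trans ?_ (harmonic_le_one_add_log c)
        rw [harmonic_eq_sum_Icc]
        push_cast
        have e : ∀ j ∈ Icc 1 c, (if d ∣ j then (d : ℝ) else 0) / j =
            if d ∣ j then ((j / d : ℕ) : ℝ)⁻¹ else 0 := by
          intro j _
          split_ifs with h
          · rw [Nat.cast_div h hd0'.ne', inv_div]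
          · simp
        rw [Finset.sum_congr rfl e, ← Finset.sum_filter]
        have himg : ∑ j ∈ Icc 1 c with d ∣ j, ((j / d : ℕ) : ℝ)⁻¹ =
            ∑ i ∈ (filter (fun j => d ∣ j) (Icc 1 c)).image (fun j => j / d), (i : ℝ)⁻¹ := by
          rw [Finset.sum_image]
          intro j hj j' hj' h
          simp only [Finset.coe_filter, Set.mem_ofPred_eq] at hj hj'
          exact (Nat.div_left_inj hj.2 hj'.2).1 h
        rw [himg]
        refine Finset.sum_le_sum_of_subset_of_nonneg ?_ (fun _ _ _ => by positivity)
        intro i hi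
        simp only [Finset.mem_image, Finset.mem_filter, Finset.mem_Icc] at hi ⊢
        obtain ⟨j, ⟨⟨h1, h2⟩, h3⟩, rfl⟩ := hi
        exact ⟨Nat.div_pos (Nat.le_of_dvd h1 h3) hd0, (Nat.div_le_self _ _).trans h2⟩
    _ = _ := by rw [Finset.sum_const, nsmul_eq_mul]

/-- The number of pairs `x ≤ X`, `y ≤ Y` of positive integers with `x y ≡ 1` modulo `c`. -/
def hyperbolaCount (c X Y : ℕ) : ℕ :=
  #{w ∈ Icc 1 X ×ˢ Icc 1 Y | ((w.1 : ZMod c) * (w.2 : ZMod c) = 1)}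

/-- Detecting `u = x` and `u⁻¹ = y` by characters expresses the count through Kloosterman sums. -/
lemma sq_mul_hyperbolaCount (X Y : ℕ) :
    ((c : ℂ) ^ 2 * hyperbolaCount c X Y) =
      ∑ m : ZMod c, ∑ n : ZMod c,
        intervalFourier X m * intervalFourier Y n * kloostermanSum m n := by
  classical
  have hprim := ZMod.isPrimitive_stdAddChar c
  have hpt : ∀ x y : ℕ, (if (x : ZMod c) * (y : ZMod c) = 1 then (c : ℂ) ^ 2 else 0) =
      ∑ u : (ZMod c)ˣ, (∑ m : ZMod c, ZMod.stdAddChar (m * ((u : ZMod c) - (x : ZMod c)))) *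
        ∑ n : ZMod c, ZMod.stdAddChar (n * (((u⁻¹ : (ZMod c)ˣ) : ZMod c) - (y : ZMod c))) := by
    intro x y
    simp_rw [AddChar.sum_mulShift _ hprim, ZMod.card, sub_eq_zero]
    split_ifs with h
    · let u₀ : (ZMod c)ˣ := ⟨x, y, h, by rw [mul_comm]; exact h⟩
      rw [Finset.sum_eq_single u₀]
      · rw [if_pos rfl, if_pos (show ((u₀⁻¹ : (ZMod c)ˣ) : ZMod c) = (y : ZMod c) from rfl), sq]
      · intro u _ hu
        rw [if_neg (fun h' => hu (Units.ext h'))]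
        simp
      · simp
    · symm
      apply Finset.sum_eq_zero
      intro u _
      by_cases h1 : (u : ZMod c) = x
      · by_cases h2 : ((u⁻¹ : (ZMod c)ˣ) : ZMod c) = y
        · exact absurd (by rw [← h1, ← h2, Units.mul_inv]) h
        · rw [if_neg h2]; simp
      · rw [if_neg h1]; simp
  have hexp : ∀ m n : ZMod c, intervalFourier X m * intervalFourier Y n * kloostermanSum m n =
      ∑ w ∈ Icc 1 X ×ˢ Icc 1 Y, ∑ u : (ZMod c)ˣ,
        ZMod.stdAddChar (m * ((u : ZMod c) - (w.1 : ZMod c))) *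
        ZMod.stdAddChar (n * (((u⁻¹ : (ZMod c)ˣ) : ZMod c) - (w.2 : ZMod c))) := by
    intro m n
    rw [intervalFourier, intervalFourier, Finset.sum_mul_sum, ← Finset.sum_product',
      kloostermanSum, Finset.sum_mul_sum]
    refine Finset.sum_congr rfl fun w _ => Finset.sum_congr rfl fun u _ => ?_
    rw [← AddChar.map_add_eq_mul, ← AddChar.map_add_eq_mul, ← AddChar.map_add_eq_mul]
    congr 1
    ring
  simp_rw [hexp]
  calc (c : ℂ) ^ 2 * hyperbolaCount c X Y
      = ∑ w ∈ Icc 1 X ×ˢ Icc 1 Y,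
          (if (w.1 : ZMod c) * (w.2 : ZMod c) = 1 then (c : ℂ) ^ 2 else 0) := by
        rw [hyperbolaCount, ← Finset.sum_filter, Finset.sum_const, nsmul_eq_mul, mul_comm]
    _ = ∑ w ∈ Icc 1 X ×ˢ Icc 1 Y, ∑ u : (ZMod c)ˣ, ∑ m : ZMod c, ∑ n : ZMod c,
        ZMod.stdAddChar (m * ((u : ZMod c) - (w.1 : ZMod c))) *
        ZMod.stdAddChar (n * (((u⁻¹ : (ZMod c)ˣ) : ZMod c) - (w.2 : ZMod c))) := by
        refine Finset.sum_congr rfl fun w _ => ?_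
        rw [hpt]
        exact Finset.sum_congr rfl fun u _ => by rw [Finset.sum_mul_sum]
    _ = ∑ w ∈ Icc 1 X ×ˢ Icc 1 Y, ∑ m : ZMod c, ∑ n : ZMod c, ∑ u : (ZMod c)ˣ,
        ZMod.stdAddChar (m * ((u : ZMod c) - (w.1 : ZMod c))) *
        ZMod.stdAddChar (n * (((u⁻¹ : (ZMod c)ˣ) : ZMod c) - (w.2 : ZMod c))) := by
        refine Finset.sum_congr rfl fun w _ => ?_
        rw [Finset.sum_comm]
        exact Finset.sum_congr rfl fun m _ => Finset.sum_comm
    _ = _ := by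
        rw [Finset.sum_comm]
        exact Finset.sum_congr rfl fun m _ => Finset.sum_comm

lemma kloostermanSum_zero_zero : kloostermanSum (0 : ZMod c) 0 = c.totient := by
  simp [kloostermanSum, ZMod.card_units_eq_totient]

lemma intervalFourier_zero (X : ℕ) : intervalFourier X (0 : ZMod c) = X := by
  simp [intervalFourier]

lemma sum_norm_intervalFourier_mul_gcd_le (X : ℕ) :
    ∑ m ∈ univ.erase (0 : ZMod c), ‖intervalFourier X m‖ * Nat.gcd m.val c ≤
      c * (c.divisors.card * (1 + Real.log c)) := by
  have hc0 := NeZero.ne c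
  have hcpos := NeZero.pos c
  set S := ∑ j ∈ Icc 1 (c - 1), (Nat.gcd j c : ℝ) / j with hS
  have hSle : S ≤ c.divisors.card * (1 + Real.log c) := by
    refine le_trans ?_ (sum_gcd_div_le c hc0)
    refine Finset.sum_le_sum_of_subset_of_nonneg (Finset.Icc_subset_Icc_right (by omega))
      (fun _ _ _ => by positivity)
  have hrefl : ∑ j ∈ Icc 1 (c - 1), (Nat.gcd j c : ℝ) / ((c : ℝ) - j) = S := by
    rw [hS]
    refine Finset.sum_nbij' (fun j => c - j) (fun j => c - j) ?_ ?_ ?_ ?_ ?_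
    · intro j hj; rw [mem_Icc] at hj ⊢; omega
    · intro j hj; rw [mem_Icc] at hj ⊢; omega
    · intro j hj; rw [mem_Icc] at hj; omega
    · intro j hj; rw [mem_Icc] at hj; omega
    · intro j hj
      rw [mem_Icc] at hj
      have hjc : j ≤ c := by omega
      rw [Nat.cast_sub hjc]
      congr 2
      exact (Nat.gcd_self_sub_left hjc).symm
  calc ∑ m ∈ univ.erase (0 : ZMod c), ‖intervalFourier X m‖ * Nat.gcd m.val c
      ≤ ∑ m ∈ univ.erase (0 : ZMod c),
          c / 2 * (1 / (m.val : ℝ) + 1 / ((c : ℝ) - m.val)) * Nat.gcd m.val c := by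
        refine Finset.sum_le_sum fun m hm => ?_
        gcongr
        exact norm_intervalFourier_le_of_ne_zero X (Finset.ne_of_mem_erase hm)
    _ = ∑ j ∈ Icc 1 (c - 1), c / 2 * (1 / (j : ℝ) + 1 / ((c : ℝ) - j)) * Nat.gcd j c := by
        refine Finset.sum_bij (fun m _ => m.val) ?_ (fun a _ b _ h => ZMod.val_injective c h)
          ?_ (fun _ _ => rfl)
        · intro m hm
          have h0 : m.val ≠ 0 := by
            rw [Ne, ZMod.val_eq_zero]; exact Finset.ne_of_mem_erase hm
          have := ZMod.val_lt m
          rw [mem_Icc]; omega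
        · intro j hj
          rw [mem_Icc] at hj
          have hv : ((j : ZMod c)).val = j := ZMod.val_cast_of_lt (by omega)
          refine ⟨(j : ZMod c), ?_, hv⟩
          refine Finset.mem_erase.2 ⟨?_, mem_univ _⟩
          intro h
          rw [h, ZMod.val_zero] at hv
          omega
    _ = c / 2 * (S + ∑ j ∈ Icc 1 (c - 1), (Nat.gcd j c : ℝ) / ((c : ℝ) - j)) := by
        rw [hS, ← Finset.sum_add_distrib, Finset.mul_sum]
        exact Finset.sum_congr rfl fun j _ => by ring
    _ = c * S := by rw [hrefl]; ring
    _ ≤ _ := by gcongr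

/-- Fourier expansion in both variables together with Kloosterman's bound: inverses modulo `c` are
equidistributed in short boxes. -/
lemma abs_hyperbolaCount_sub_le {X Y : ℕ} (hX : X ≤ c) (hY : Y ≤ c) :
    |(hyperbolaCount c X Y : ℝ) - c.totient * X * Y / (c : ℝ) ^ 2| ≤
      kloostermanBound c * (c.divisors.card * (1 + Real.log c)) *
        (c.divisors.card * (1 + Real.log c) + 2) := by
  classical
  set T : ℝ := c.divisors.card * (1 + Real.log c) with hT
  set K := kloostermanBound c with hK
  have hK0 : 0 ≤ K := kloostermanBound_nonneg c
  have hc : (0 : ℝ) < c := by exact_mod_cast NeZero.pos c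
  have hc1 : (1 : ℝ) ≤ c := by exact_mod_cast NeZero.pos c
  have hT0 : 0 ≤ T := mul_nonneg (by positivity) (by linarith [Real.log_nonneg hc1])
  have hgcd : ∀ m : ZMod c, (1 : ℝ) ≤ Nat.gcd m.val c := fun m => by
    exact_mod_cast Nat.gcd_pos_of_pos_right _ (NeZero.pos c)
  set F : ZMod c → ZMod c → ℂ := fun m n =>
    intervalFourier X m * intervalFourier Y n * kloostermanSum m n with hF
  have hall : ∑ n : ZMod c, ‖intervalFourier Y n‖ ≤ c + c * T := by
    rw [← Finset.add_sum_erase univ _ (mem_univ (0 : ZMod c))]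
    gcongr
    · exact (norm_intervalFourier_le Y 0).trans (by exact_mod_cast hY)
    · refine le_trans (Finset.sum_le_sum fun n _ => ?_) (sum_norm_intervalFourier_mul_gcd_le Y)
      exact le_mul_of_one_le_right (norm_nonneg _) (hgcd n)
  have h1 : ∑ m ∈ univ.erase (0 : ZMod c), ∑ n : ZMod c, ‖F m n‖ ≤ K * (c * T) * (c + c * T) := by
    calc _ ≤ ∑ m ∈ univ.erase (0 : ZMod c), ∑ n : ZMod c,
          K * (‖intervalFourier X m‖ * Nat.gcd m.val c) * ‖intervalFourier Y n‖ := by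
          refine Finset.sum_le_sum fun m _ => Finset.sum_le_sum fun n _ => ?_
          rw [hF, norm_mul, norm_mul]
          calc _ ≤ ‖intervalFourier X m‖ * ‖intervalFourier Y n‖ * (K * Nat.gcd m.val c) := by
                gcongr
                exact norm_kloostermanSum_le_left m n
            _ = _ := by ring
      _ = K * (∑ m ∈ univ.erase (0 : ZMod c), ‖intervalFourier X m‖ * Nat.gcd m.val c) *
            ∑ n : ZMod c, ‖intervalFourier Y n‖ := by
          rw [mul_assoc, Finset.sum_mul_sum, Finset.mul_sum]
          refine Finset.sum_congr rfl fun m _ => ?_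
          rw [Finset.mul_sum]
          exact Finset.sum_congr rfl fun n _ => by ring
      _ ≤ _ := by
          gcongr
          exact sum_norm_intervalFourier_mul_gcd_le X
  have h2 : ∑ n ∈ univ.erase (0 : ZMod c), ‖F 0 n‖ ≤ c * (K * (c * T)) := by
    calc _ ≤ ∑ n ∈ univ.erase (0 : ZMod c),
          c * (K * (‖intervalFourier Y n‖ * Nat.gcd n.val c)) := by
          refine Finset.sum_le_sum fun n _ => ?_
          rw [hF, norm_mul, norm_mul]
          calc _ ≤ (c : ℝ) * ‖intervalFourier Y n‖ * (K * Nat.gcd n.val c) := by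
                gcongr
                · exact (norm_intervalFourier_le X 0).trans (by exact_mod_cast hX)
                · exact norm_kloostermanSum_le_right 0 n
            _ = _ := by ring
      _ = c * (K * ∑ n ∈ univ.erase (0 : ZMod c), ‖intervalFourier Y n‖ * Nat.gcd n.val c) := by
          rw [Finset.mul_sum, Finset.mul_sum]
      _ ≤ _ := by
          gcongr
          exact sum_norm_intervalFourier_mul_gcd_le Y
  have hsplit : (c : ℂ) ^ 2 * hyperbolaCount c X Y - X * Y * c.totient =
      ∑ m ∈ univ.erase (0 : ZMod c), ∑ n : ZMod c, F m n +
        ∑ n ∈ univ.erase (0 : ZMod c), F 0 n := by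
    rw [sq_mul_hyperbolaCount, ← Finset.add_sum_erase univ _ (mem_univ (0 : ZMod c)),
      ← Finset.add_sum_erase univ (fun n => intervalFourier X 0 * _ * _) (mem_univ (0 : ZMod c)),
      kloostermanSum_zero_zero, intervalFourier_zero, intervalFourier_zero]
    simp only [hF, intervalFourier_zero]
    ring
  have hnorm : (c : ℝ) ^ 2 * |(hyperbolaCount c X Y : ℝ) - c.totient * X * Y / (c : ℝ) ^ 2| ≤
      K * (c * T) * (c + c * T) + c * (K * (c * T)) := by
    calc _ = ‖(c : ℂ) ^ 2 * hyperbolaCount c X Y - X * Y * c.totient‖ := by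
          rw [← abs_of_pos (pow_pos hc 2), ← abs_mul, ← Real.norm_eq_abs, ← Complex.norm_real]
          congr 1
          rw [abs_of_pos (pow_pos hc 2), mul_sub, mul_div_cancel₀ _ (by positivity)]
          push_cast
          ring
      _ ≤ _ := by
          rw [hsplit]
          refine (norm_add_le _ _).trans (add_le_add ?_ ((norm_sum_le _ _).trans h2))
          exact ((norm_sum_le _ _).trans (Finset.sum_le_sum fun m _ => norm_sum_le _ _)).trans h1
  refine le_of_mul_le_mul_left (hnorm.trans (le_of_eq ?_)) (pow_pos hc 2)
  ring

end Discrepancy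

/-! ### The divisor bound -/

section DivisorBound

lemma succ_le_mul_two_rpow {ε : ℝ} (hε : 0 < ε) (hε1 : ε ≤ 1) (k : ℕ) :
    ((k : ℝ) + 1) ≤ 1 / (ε * Real.log 2) * 2 ^ (k * ε : ℝ) := by
  have hl : 0 < Real.log 2 := Real.log_pos (by norm_num)
  have hl1 : Real.log 2 ≤ 1 := by linarith [Real.log_le_sub_one_of_pos (x := 2) (by norm_num)]
  have h1 : 1 + k * ε * Real.log 2 ≤ 2 ^ (k * ε : ℝ) := by
    rw [Real.rpow_def_of_pos (by norm_num)]
    have := Real.add_one_le_exp (Real.log 2 * (k * ε))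
    linarith
  have h2 : ε * Real.log 2 ≤ 1 := by nlinarith
  have hp : 0 < ε * Real.log 2 := by positivity
  rw [one_div, ← div_eq_inv_mul, le_div_iff₀ hp]
  linarith

/-- The divisor bound `τ(n) ≪ n^ε`. -/
lemma exists_card_divisors_le_rpow {ε : ℝ} (hε : 0 < ε) (hε1 : ε ≤ 1) :
    ∃ C : ℝ, 1 ≤ C ∧ ∀ n : ℕ, 1 ≤ n → (n.divisors.card : ℝ) ≤ C * (n : ℝ) ^ ε := by
  classical
  set A : ℝ := max 1 (1 / (ε * Real.log 2)) with hA
  set P : ℕ := ⌈(2 : ℝ) ^ (1 / ε)⌉₊ with hP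
  have hA1 : 1 ≤ A := le_max_left _ _
  refine ⟨A ^ P, one_le_pow₀ hA1, fun n hn => ?_⟩
  have hn0 : n ≠ 0 := by omega
  have hpt : ∀ p ∈ n.primeFactors, ((n.factorization p + 1 : ℕ) : ℝ) ≤
      (if p < P then A else 1) * ((p : ℝ) ^ n.factorization p) ^ ε := by
    intro p hp
    have hp2 : (2 : ℝ) ≤ p := by exact_mod_cast (Nat.prime_of_mem_primeFactors hp).two_le
    set k := n.factorization p
    have e : ((p : ℝ) ^ k) ^ ε = (p : ℝ) ^ (k * ε : ℝ) := by
      rw [← Real.rpow_natCast, ← Real.rpow_mul (by positivity)]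
    rw [e]
    push_cast
    split_ifs with h
    · calc (k : ℝ) + 1 ≤ 1 / (ε * Real.log 2) * 2 ^ (k * ε : ℝ) := succ_le_mul_two_rpow hε hε1 k
        _ ≤ A * (p : ℝ) ^ (k * ε : ℝ) := by
            gcongr
            exact le_max_right _ _
    · rw [one_mul]
      have hge : (2 : ℝ) ^ (1 / ε) ≤ p := by
        refine (Nat.le_ceil _).trans ?_
        exact_mod_cast not_lt.1 h
      have h2 : (2 : ℝ) ≤ (p : ℝ) ^ ε := by
        calc (2 : ℝ) = ((2 : ℝ) ^ (1 / ε)) ^ ε := by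
              rw [← Real.rpow_mul (by norm_num), one_div, inv_mul_cancel₀ hε.ne', Real.rpow_one]
          _ ≤ _ := by gcongr
      calc (k : ℝ) + 1 ≤ 2 ^ k := by exact_mod_cast Nat.lt_two_pow_self
        _ ≤ ((p : ℝ) ^ ε) ^ k := by gcongr
        _ = _ := by rw [← Real.rpow_natCast, ← Real.rpow_mul (by positivity), mul_comm]
  rw [Nat.card_divisors hn0]
  push_cast
  calc ∏ p ∈ n.primeFactors, ((n.factorization p : ℝ) + 1)
      ≤ ∏ p ∈ n.primeFactors, (if p < P then A else 1) * ((p : ℝ) ^ n.factorization p) ^ ε := by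
        refine Finset.prod_le_prod (fun _ _ => by positivity) fun p hp => ?_
        exact_mod_cast hpt p hp
    _ = (∏ p ∈ n.primeFactors, if p < P then A else 1) *
          (∏ p ∈ n.primeFactors, (p : ℝ) ^ n.factorization p) ^ ε := by
        rw [Finset.prod_mul_distrib, Real.finsetProd_rpow _ _ (fun _ _ => by positivity)]
    _ ≤ A ^ P * (n : ℝ) ^ ε := by
        have e1 : (∏ p ∈ n.primeFactors, (p : ℝ) ^ n.factorization p) = n := by
          have := Nat.prod_factorization_pow_eq_self hn0
          rw [Finsupp.prod, Nat.support_factorization] at this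
          exact_mod_cast this
        rw [e1]
        gcongr
        rw [← Finset.prod_filter, Finset.prod_const]
        refine pow_le_pow_right₀ hA1 ?_
        calc _ ≤ #(range P) := Finset.card_le_card fun p hp => by
              simp only [Finset.mem_filter] at hp; exact mem_range.2 hp.2
          _ = P := card_range P

lemma one_add_log_le_rpow {ε : ℝ} (hε : 0 < ε) (hε1 : ε ≤ 1) {x : ℝ} (hx : 1 ≤ x) :
    1 + Real.log x ≤ 1 / ε * x ^ ε := by
  have h := Real.log_le_rpow_div (x := x) (ε := ε) (by linarith) hε
  have h1 : 1 + ε * Real.log x ≤ x ^ ε := by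
    rw [Real.rpow_def_of_pos (by linarith)]
    have := Real.add_one_le_exp (Real.log x * ε)
    linarith
  rw [one_div, ← div_eq_inv_mul, le_div_iff₀ hε]
  linarith

/-- The discrepancy of inverses modulo `c` in boxes is `O(c^(7/8))`. -/
lemma exists_discrepancy_le :
    ∃ C : ℝ, 0 < C ∧ ∀ c : ℕ, 1 ≤ c →
      kloostermanBound c * (c.divisors.card * (1 + Real.log c)) *
        (c.divisors.card * (1 + Real.log c) + 2) ≤ C * (c : ℝ) ^ (7 / 8 : ℝ) := by
  obtain ⟨A, hA1, hA⟩ := exists_card_divisors_le_rpow (ε := 1 / 40) (by norm_num) (by norm_num)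
  refine ⟨2 * A * (A * 40) * (A * 40 + 2), by positivity, fun c hc => ?_⟩
  have hc1 : (1 : ℝ) ≤ c := by exact_mod_cast hc
  have hc0 : (0 : ℝ) < c := by linarith
  set y : ℝ := (c : ℝ) ^ (1 / 40 : ℝ) with hy
  have hy1 : 1 ≤ y := Real.one_le_rpow hc1 (by norm_num)
  have hlog0 : 0 ≤ Real.log c := Real.log_nonneg hc1
  have hd := hA c hc
  have hl : 1 + Real.log c ≤ 40 * y := by
    have := one_add_log_le_rpow (ε := 1 / 40) (by norm_num) (by norm_num) hc1
    norm_num at this ⊢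
    exact this
  have hT : (c.divisors.card : ℝ) * (1 + Real.log c) ≤ A * 40 * y ^ 2 := by
    calc _ ≤ (A * y) * (40 * y) := by gcongr
      _ = _ := by ring
  have hT2 : (c.divisors.card : ℝ) * (1 + Real.log c) + 2 ≤ (A * 40 + 2) * y ^ 2 := by
    nlinarith [one_le_pow₀ (n := 2) hy1]
  have hd1 : (1 : ℝ) ≤ c.divisors.card := by
    exact_mod_cast Finset.card_pos.2 ⟨1, Nat.one_mem_divisors.2 (by omega)⟩
  have hK : kloostermanBound c ≤ 2 * A * ((c : ℝ) ^ (3 / 4 : ℝ) * y) := by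
    unfold kloostermanBound
    have e : 2 * (c : ℝ) ^ 3 * (c.divisors.card : ℝ) ^ 3 ≤
        (2 * ((c : ℝ) ^ (3 / 4 : ℝ)) * c.divisors.card) ^ (4 : ℕ) := by
      have e1 : ((c : ℝ) ^ (3 / 4 : ℝ)) ^ 4 = (c : ℝ) ^ 3 := by
        rw [← Real.rpow_natCast, ← Real.rpow_mul hc0.le, ← Real.rpow_natCast]; norm_num
      rw [mul_pow, mul_pow, e1]
      have : (c.divisors.card : ℝ) ^ 3 ≤ (c.divisors.card : ℝ) ^ 4 :=
        pow_le_pow_right₀ hd1 (by norm_num)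
      gcongr
      norm_num
    calc _ ≤ ((2 * ((c : ℝ) ^ (3 / 4 : ℝ)) * c.divisors.card) ^ (4 : ℕ)) ^ (1 / 4 : ℝ) := by
          gcongr
      _ = 2 * ((c : ℝ) ^ (3 / 4 : ℝ)) * c.divisors.card := by
          rw [← Real.rpow_natCast, ← Real.rpow_mul (by positivity)]; norm_num
      _ ≤ 2 * ((c : ℝ) ^ (3 / 4 : ℝ)) * (A * y) := by gcongr
      _ = _ := by ring
  have hy5 : (c : ℝ) ^ (3 / 4 : ℝ) * y * y ^ 2 * y ^ 2 = (c : ℝ) ^ (7 / 8 : ℝ) := by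
    have : (c : ℝ) ^ (3 / 4 : ℝ) * y * y ^ 2 * y ^ 2 =
        (c : ℝ) ^ (3 / 4 : ℝ) * y ^ (5 : ℕ) := by ring
    rw [this, hy, ← Real.rpow_natCast, ← Real.rpow_mul hc0.le, ← Real.rpow_add hc0]
    norm_num
  calc _ ≤ 2 * A * ((c : ℝ) ^ (3 / 4 : ℝ) * y) * (A * 40 * y ^ 2) * ((A * 40 + 2) * y ^ 2) := by
        gcongr
    _ = 2 * A * (A * 40) * (A * 40 + 2) * ((c : ℝ) ^ (3 / 4 : ℝ) * y * y ^ 2 * y ^ 2) := by ring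
    _ = _ := by rw [hy5]

end DivisorBound

/-! ### Inverses in the lower half: reciprocity and equidistribution -/

section ModInv

lemma exists_mul_modEq_one {p q : ℕ} (hp : 1 ≤ p) (h : Nat.gcd p q = 1) :
    ∃ a, 1 ≤ a ∧ a ≤ p ∧ a * q ≡ 1 [MOD p] := by
  rcases hp.eq_or_lt with rfl | hp1
  · exact ⟨1, le_rfl, le_rfl, Nat.modEq_one⟩
  obtain ⟨m, hm, h1⟩ := Nat.exists_mul_mod_eq_one_of_coprime (Nat.Coprime.symm h) hp1
  have hmod : m * q ≡ 1 [MOD p] := by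
    rw [mul_comm]
    unfold Nat.ModEq
    rw [h1, Nat.mod_eq_of_lt hp1]
  refine ⟨m, Nat.pos_of_ne_zero ?_, hm.le, hmod⟩
  rintro rfl
  rw [mul_zero, Nat.zero_mod] at h1
  omega

lemma modInv_spec {p q : ℕ} (hp : 1 ≤ p) (h : Nat.gcd p q = 1) :
    1 ≤ modInv p q ∧ modInv p q ≤ p ∧ modInv p q * q ≡ 1 [MOD p] := by
  obtain ⟨a, h1, h2, h3⟩ := exists_mul_modEq_one hp h
  have hmem := Nat.sInf_mem (s := {a : ℕ | 1 ≤ a ∧ a * q ≡ 1 [MOD p]}) ⟨a, h1, h3⟩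
  have hle := Nat.sInf_le (show a ∈ {a : ℕ | 1 ≤ a ∧ a * q ≡ 1 [MOD p]} from ⟨h1, h3⟩)
  exact ⟨hmem.1, hle.trans h2, hmem.2⟩

lemma eq_modInv {p q a : ℕ} (hp : 1 ≤ p) (h : Nat.gcd p q = 1) (h1 : 1 ≤ a) (h2 : a ≤ p)
    (h3 : a * q ≡ 1 [MOD p]) : a = modInv p q := by
  obtain ⟨k1, k2, k3⟩ := modInv_spec hp h
  have : a ≡ modInv p q [MOD p] := Nat.ModEq.cancel_right_of_coprime h (h3.trans k3.symm)
  have hd := (Nat.modEq_iff_dvd).1 this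
  have := Int.eq_zero_of_abs_lt_dvd hd (by rw [abs_lt]; constructor <;> omega)
  omega

/-- The arithmetic condition on `(p, q)`: they are coprime and the inverse of `q` modulo `p` lies
in the lower half. -/
def LowerInv (p q : ℕ) : Prop := Nat.gcd p q = 1 ∧ 2 * modInv p q ≤ p

/-- Reciprocity: for the least positive inverses `a` of `q` modulo `p` and `b` of `p` modulo `q`
one has `a q + b p = 1 + p q`, so that exactly one of them lies in the lower half. -/
lemma lowerInv_comm_iff {p q : ℕ} (hp : 1 ≤ p) (hq : 1 ≤ q) (h : Nat.gcd p q = 1)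
    (hne : 2 < p + q) : LowerInv q p ↔ ¬ LowerInv p q := by
  have h' : Nat.gcd q p = 1 := by rwa [Nat.gcd_comm]
  obtain ⟨a1, a2, a3⟩ := modInv_spec hp h
  obtain ⟨b1, b2, b3⟩ := modInv_spec hq h'
  set a := modInv p q with ha
  set b := modInv q p with hb
  have key : a * q + b * p = 1 + p * q := by
    have m1 : a * q + b * p ≡ 1 [MOD p] := by
      have : b * p ≡ 0 [MOD p] := (Nat.modEq_zero_iff_dvd).2 (Dvd.intro_left _ rfl)
      simpa using a3.add this
    have m2 : a * q + b * p ≡ 1 [MOD q] := by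
      have : a * q ≡ 0 [MOD q] := (Nat.modEq_zero_iff_dvd).2 (Dvd.intro_left _ rfl)
      simpa using this.add b3
    have m3 : 1 ≡ a * q + b * p [MOD p * q] :=
      ((Nat.modEq_and_modEq_iff_modEq_mul h).1 ⟨m1, m2⟩).symm
    have hge : 2 ≤ a * q + b * p := by nlinarith
    have hd := (Nat.modEq_iff_dvd' (by omega)).1 m3
    obtain ⟨t, ht⟩ := hd
    have hle : a * q + b * p ≤ 2 * (p * q) := by nlinarith
    have hpq : 1 ≤ p * q := Nat.mul_pos hp hq
    have ht1 : t = 1 := by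
      have h0 : t ≠ 0 := by rintro rfl; omega
      have h2 : t < 2 := by
        by_contra hcon
        have : p * q * 2 ≤ p * q * t := Nat.mul_le_mul_left _ (not_lt.1 hcon)
        omega
      omega
    rw [ht1] at ht
    omega
  have e1 : LowerInv p q ↔ 2 * a ≤ p := by simp [LowerInv, h, ha]
  have e2 : LowerInv q p ↔ 2 * b ≤ q := by simp [LowerInv, h', hb]
  rw [e1, e2]
  constructor
  · intro hb' ha'
    nlinarith
  · intro ha'
    by_contra hb'
    have h1 : p + 1 ≤ 2 * a := by omega
    have h2 : q + 1 ≤ 2 * b := by omega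
    nlinarith

open Classical in
lemma card_hyperbola_fiber {c Y : ℕ} (hc : 1 ≤ c) (hY : Y ≤ c) (x : ℕ) :
    #{y ∈ Icc 1 Y | ((x : ZMod c) * (y : ℕ) = 1)} =
      if Nat.gcd c x = 1 ∧ modInv c x ≤ Y then 1 else 0 := by
  have hiff : ∀ y : ℕ, ((x : ZMod c) * (y : ZMod c) = 1) ↔ y * x ≡ 1 [MOD c] := by
    intro y
    rw [← ZMod.natCast_eq_natCast_iff]
    push_cast
    rw [mul_comm]
  simp_rw [hiff]
  split_ifs with h
  · obtain ⟨k1, k2, k3⟩ := modInv_spec hc h.1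
    rw [Finset.card_eq_one]
    refine ⟨modInv c x, ?_⟩
    ext y
    simp only [Finset.mem_filter, mem_Icc, mem_singleton]
    constructor
    · rintro ⟨⟨h1, h2⟩, h3⟩
      exact eq_modInv hc h.1 h1 (h2.trans hY) h3
    · rintro rfl
      exact ⟨⟨k1, h.2⟩, k3⟩
  · rw [Finset.card_eq_zero, Finset.filter_eq_empty_iff]
    intro y hy h3
    rw [mem_Icc] at hy
    have hcop : Nat.gcd c x = 1 := by
      have := (Nat.coprime_of_mul_modEq_one y (by rwa [mul_comm] at h3 : x * y ≡ 1 [MOD c]))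
      exact this.symm
    exact h ⟨hcop, by rw [← eq_modInv hc hcop hy.1 (hy.2.trans hY) h3]; exact hy.2⟩

lemma hyperbolaCount_eq_sum (c X Y : ℕ) :
    hyperbolaCount c X Y =
      ∑ x ∈ Icc 1 X, #{y ∈ Icc 1 Y | ((x : ZMod c) * ((y : ℕ) : ZMod c) = 1)} := by
  rw [hyperbolaCount, Finset.card_filter, Finset.sum_product]
  exact Finset.sum_congr rfl fun x _ => by rw [Finset.card_filter]

open Classical in
lemma hyperbolaCount_eq_card {c Y : ℕ} (hc : 1 ≤ c) (hY : Y ≤ c) (X : ℕ) :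
    hyperbolaCount c X Y = #{x ∈ Icc 1 X | Nat.gcd c x = 1 ∧ modInv c x ≤ Y} := by
  rw [hyperbolaCount_eq_sum, Finset.card_filter]
  exact Finset.sum_congr rfl fun x _ => by rw [card_hyperbola_fiber hc hY]

lemma hyperbolaCount_add_period (c X Y : ℕ) :
    hyperbolaCount c (X + c) Y = hyperbolaCount c c Y + hyperbolaCount c X Y := by
  simp only [hyperbolaCount_eq_sum]
  induction X with
  | zero => simp
  | succ X ih =>
    rw [add_right_comm, Finset.sum_Icc_succ_top (by omega), ih,
      Finset.sum_Icc_succ_top (by omega), add_assoc]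
    congr 2
    have : (((X + c + 1 : ℕ)) : ZMod c) = ((X + 1 : ℕ) : ZMod c) := by
      push_cast; rw [ZMod.natCast_self]; ring
    rw [this]

lemma hyperbolaCount_mul_period_add (c j r Y : ℕ) :
    hyperbolaCount c (j * c + r) Y = j * hyperbolaCount c c Y + hyperbolaCount c r Y := by
  induction j with
  | zero => simp
  | succ j ih =>
    rw [show (j + 1) * c + r = (j * c + r) + c by ring, hyperbolaCount_add_period, ih]
    ring

lemma hyperbolaCount_self {c : ℕ} (hc : 1 ≤ c) : hyperbolaCount c c c = c.totient := by
  classical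
  rw [hyperbolaCount_eq_card hc le_rfl, ← Nat.filter_coprime_Ico_eq_totient c 1]
  congr 1
  ext x
  simp only [Finset.mem_filter, mem_Icc, mem_Ico, Nat.Coprime]
  constructor
  · rintro ⟨h1, h2, h3⟩
    exact ⟨⟨h1.1, by omega⟩, h2⟩
  · rintro ⟨h1, h2⟩
    exact ⟨⟨h1.1, by omega⟩, h2, (modInv_spec hc h2).2.1⟩

lemma modInv_sub {c x : ℕ} (hc : 2 ≤ c) (hx : x < c) (h : Nat.gcd c x = 1) :
    Nat.gcd c (c - x) = 1 ∧ modInv c (c - x) = c - modInv c x := by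
  have h' : Nat.gcd c (c - x) = 1 := by rw [Nat.gcd_self_sub_right hx.le, h]
  obtain ⟨k1, k2, k3⟩ := modInv_spec (by omega) h
  have hlt : modInv c x < c := by
    refine lt_of_le_of_ne k2 fun he => ?_
    rw [he] at k3
    have : c ∣ 1 := (Nat.modEq_zero_iff_dvd).1 (k3.symm.trans
      ((Nat.modEq_zero_iff_dvd).2 (Dvd.intro _ rfl)))
    have := Nat.le_of_dvd one_pos this
    omega
  refine ⟨h', (eq_modInv (by omega) h' (by omega) (by omega) ?_).symm⟩
  rw [← ZMod.natCast_eq_natCast_iff] at k3 ⊢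
  push_cast [Nat.cast_sub hx.le, Nat.cast_sub hlt.le] at k3 ⊢
  rw [ZMod.natCast_self]
  linear_combination k3

/-- The involution `x ↦ -x` exchanges the two halves of the inverses. -/
lemma two_mul_hyperbolaCount_half {c : ℕ} (hc : 3 ≤ c) :
    2 * hyperbolaCount c c (c / 2) = c.totient := by
  classical
  rw [← hyperbolaCount_self (by omega : 1 ≤ c), hyperbolaCount_eq_card (by omega) (by omega),
    hyperbolaCount_eq_card (by omega) le_rfl]
  have hlt : ∀ x, x ∈ Icc 1 c → Nat.gcd c x = 1 → x < c := by
    intro x hx h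
    rw [mem_Icc] at hx
    refine lt_of_le_of_ne hx.2 ?_
    rintro rfl
    rw [Nat.gcd_self] at h
    omega
  -- An inverse is coprime to `c`, so it is not `c / 2`, as `c` exceeds `2`.
  have hne : ∀ x, Nat.gcd c x = 1 → 2 * modInv c x ≠ c := by
    intro x h he
    obtain ⟨k1, k2, k3⟩ := modInv_spec (by omega : 1 ≤ c) h
    have hcop := Nat.coprime_of_mul_modEq_one x k3
    have hd : modInv c x ∣ c := Dvd.intro_left _ he
    have := Nat.eq_one_of_dvd_coprimes hcop (dvd_refl _) hd
    omega
  have hsplit := Finset.card_filter_add_card_filter_not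
    (s := {x ∈ Icc 1 c | Nat.gcd c x = 1 ∧ modInv c x ≤ c}) (fun x => modInv c x ≤ c / 2)
  rw [← hsplit, two_mul]
  congr 1
  · congr 1
    ext x
    simp only [Finset.mem_filter]
    constructor
    · rintro ⟨h1, h2, h3⟩
      exact ⟨⟨h1, h2, h3.trans (Nat.div_le_self _ _)⟩, h3⟩
    · rintro ⟨⟨h1, h2, -⟩, h3⟩
      exact ⟨h1, h2, h3⟩
  · refine Finset.card_nbij' (fun x => c - x) (fun x => c - x) ?_ ?_ ?_ ?_
    · intro x hx
      simp only [Finset.coe_filter, Set.mem_ofPred_eq, Finset.mem_filter] at hx ⊢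
      have hxc := hlt x hx.1 hx.2.1
      obtain ⟨g, e⟩ := modInv_sub (by omega) hxc hx.2.1
      have := hne x hx.2.1
      have h1 := hx.1
      rw [mem_Icc] at h1 ⊢
      refine ⟨⟨by omega, g, ?_⟩, ?_⟩ <;> rw [e] <;> omega
    · intro x hx
      simp only [Finset.coe_filter, Set.mem_ofPred_eq, Finset.mem_filter] at hx ⊢
      have hxc := hlt x hx.1.1 hx.1.2.1
      obtain ⟨g, e⟩ := modInv_sub (by omega) hxc hx.1.2.1
      have h1 := hx.1.1
      rw [mem_Icc] at h1 ⊢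
      refine ⟨by omega, g, ?_⟩
      rw [e]; omega
    · intro x hx
      simp only [Finset.coe_filter, Set.mem_ofPred_eq] at hx
      have := hlt x hx.1 hx.2.1
      simp only []
      omega
    · intro x hx
      simp only [Finset.coe_filter, Set.mem_ofPred_eq, Finset.mem_filter] at hx
      have := hlt x hx.1.1 hx.1.2.1
      simp only []
      omega

/-- The density of the `q` for which `LowerInv c q`: the proportion over the period `c`. -/
def lowerDensity (c : ℕ) : ℝ := hyperbolaCount c c (c / 2) / c

/-- The density of the `p` for which `LowerInv p c`. This condition is not periodic in `p`; by
reciprocity it holds, but for `p = c = 1`, for exactly those `p` coprime to `c` for which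
`LowerInv c p` fails. -/
def upperDensity (c : ℕ) : ℝ := c.totient / c - lowerDensity c

/-- The moduli `1` and `2` are exceptional: no inverse modulo `1`, and the only one modulo `2`, lies
in the lower half. -/
lemma lowerDensity_eq {c : ℕ} (hc : 1 ≤ c) :
    lowerDensity c = c.totient / (2 * c) - (if c = 1 then 1 / 2 else 0) +
      (if c = 2 then 1 / 4 else 0) := by
  unfold lowerDensity
  rcases hc.eq_or_lt with rfl | hc1
  · norm_num [hyperbolaCount]
  rcases (show 2 ≤ c from hc1).eq_or_lt with rfl | hc2
  · have : hyperbolaCount 2 2 (2 / 2) = 1 := by decide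
    rw [this]
    norm_num
  · have h := two_mul_hyperbolaCount_half (c := c) hc2
    rw [if_neg (by omega), if_neg (by omega), ← h]
    have : (c : ℝ) ≠ 0 := by positivity
    push_cast
    field_simp
    ring

lemma upperDensity_eq {c : ℕ} (hc : 1 ≤ c) :
    upperDensity c = c.totient / (2 * c) + (if c = 1 then 1 / 2 else 0) -
      (if c = 2 then 1 / 4 else 0) := by
  have : (c : ℝ) ≠ 0 := by positivity
  rw [upperDensity, lowerDensity_eq hc]
  field_simp
  ring

lemma lowerDensity_nonneg (c : ℕ) : 0 ≤ lowerDensity c := by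
  unfold lowerDensity; positivity

lemma lowerDensity_le_totient {c : ℕ} (hc : 1 ≤ c) : lowerDensity c ≤ c.totient / c := by
  unfold lowerDensity
  gcongr
  rw [← hyperbolaCount_self hc]
  unfold hyperbolaCount
  refine Finset.card_le_card (Finset.filter_subset_filter _ (Finset.product_subset_product ?_ ?_))
  · exact subset_rfl
  · exact Finset.Icc_subset_Icc_right (Nat.div_le_self _ _)

lemma totient_div_le_one (c : ℕ) : (c.totient : ℝ) / c ≤ 1 := by
  rcases Nat.eq_zero_or_pos c with rfl | hc
  · simp
  rw [div_le_one (by positivity)]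
  exact_mod_cast Nat.totient_le c

lemma lowerDensity_le_one {c : ℕ} (hc : 1 ≤ c) : lowerDensity c ≤ 1 :=
  (lowerDensity_le_totient hc).trans (totient_div_le_one c)

lemma upperDensity_nonneg {c : ℕ} (hc : 1 ≤ c) : 0 ≤ upperDensity c :=
  sub_nonneg.2 (lowerDensity_le_totient hc)

lemma upperDensity_le_one (c : ℕ) : upperDensity c ≤ 1 := by
  have := lowerDensity_nonneg c
  have := totient_div_le_one c
  unfold upperDensity
  linarith

/-- Full periods are counted exactly, so the discrepancy is that of the incomplete period. -/
lemma abs_hyperbolaCount_sub_density_le {c Y : ℕ} (hc : 1 ≤ c) (hY : Y ≤ c) (X : ℕ) :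
    |(hyperbolaCount c X Y : ℝ) - hyperbolaCount c c Y / c * X| ≤
      2 * (kloostermanBound c * (c.divisors.card * (1 + Real.log c)) *
        (c.divisors.card * (1 + Real.log c) + 2)) := by
  have : NeZero c := ⟨by omega⟩
  have hc0 : (0 : ℝ) < c := by exact_mod_cast hc
  set j := X / c
  set r := X % c
  have hX : X = j * c + r := (Nat.div_add_mod' X c).symm
  have hr : r ≤ c := (Nat.mod_lt X hc).le
  have hr' : (r : ℝ) / c ≤ 1 := (div_le_one hc0).2 (by exact_mod_cast hr)
  have h1 := abs_hyperbolaCount_sub_le (c := c) hr hY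
  have h2 := abs_hyperbolaCount_sub_le (c := c) le_rfl hY
  set E := kloostermanBound c * (c.divisors.card * (1 + Real.log c)) *
        (c.divisors.card * (1 + Real.log c) + 2)
  rw [hX, hyperbolaCount_mul_period_add]
  push_cast
  have e : (j * hyperbolaCount c c Y + hyperbolaCount c r Y : ℝ) -
      hyperbolaCount c c Y / c * (j * c + r) =
      (hyperbolaCount c r Y - c.totient * r * Y / (c : ℝ) ^ 2) -
        r / c * (hyperbolaCount c c Y - c.totient * c * Y / (c : ℝ) ^ 2) := by
    field_simp
    ring
  rw [e]
  refine (abs_sub _ _).trans ?_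
  rw [abs_mul, abs_of_nonneg (by positivity : (0 : ℝ) ≤ r / c)]
  have : (r / c : ℝ) * |(hyperbolaCount c c Y : ℝ) - c.totient * c * Y / (c : ℝ) ^ 2| ≤ 1 * E := by
    gcongr
  linarith

open Classical in
/-- Equidistribution of the arithmetic condition in either variable, with a power saving. -/
lemma exists_abs_card_lowerInv_sub_le :
    ∃ C : ℝ, 0 < C ∧ ∀ c : ℕ, 1 ≤ c → ∀ X : ℕ,
      |(#{x ∈ Icc 1 X | LowerInv c x} : ℝ) - lowerDensity c * X| ≤ C * (c : ℝ) ^ (7 / 8 : ℝ) ∧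
      |(#{x ∈ Icc 1 X | LowerInv x c} : ℝ) - upperDensity c * X| ≤ C * (c : ℝ) ^ (7 / 8 : ℝ) := by
  obtain ⟨C, hC, h⟩ := exists_discrepancy_le
  refine ⟨4 * C + 1, by positivity, fun c hc X => ?_⟩
  have hc1 : (1 : ℝ) ≤ c := by exact_mod_cast hc
  set P := (c : ℝ) ^ (7 / 8 : ℝ)
  have hP : 1 ≤ P := Real.one_le_rpow hc1 (by norm_num)
  have hE := h c hc
  have h1 := abs_hyperbolaCount_sub_density_le hc (Nat.div_le_self c 2) X
  have h2 := abs_hyperbolaCount_sub_density_le hc le_rfl X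
  set E := kloostermanBound c * (c.divisors.card * (1 + Real.log c)) *
        (c.divisors.card * (1 + Real.log c) + 2)
  have hCP : 0 ≤ C * P := by positivity
  have e1 : hyperbolaCount c X (c / 2) = #{x ∈ Icc 1 X | LowerInv c x} := by
    rw [hyperbolaCount_eq_card hc (Nat.div_le_self c 2)]
    congr 1
    ext x
    rw [Finset.mem_filter, Finset.mem_filter, LowerInv]
    constructor <;> rintro ⟨h1, h2, h3⟩ <;> exact ⟨h1, h2, by omega⟩
  have e2 : hyperbolaCount c X c = #{x ∈ Icc 1 X | Nat.gcd c x = 1} := by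
    rw [hyperbolaCount_eq_card hc le_rfl]
    congr 1
    ext x
    simp only [Finset.mem_filter]
    constructor
    · rintro ⟨h1, h2, h3⟩; exact ⟨h1, h2⟩
    · rintro ⟨h1, h2⟩; exact ⟨h1, h2, (modInv_spec hc h2).2.1⟩
  rw [e1] at h1
  rw [e2, hyperbolaCount_self hc] at h2
  refine ⟨h1.trans (by nlinarith), ?_⟩
  -- Reciprocity; the pair `(1, 1)` is the only exception.
  have e3 : |(#{x ∈ Icc 1 X | LowerInv x c} : ℝ) + #{x ∈ Icc 1 X | LowerInv c x} -
      #{x ∈ Icc 1 X | Nat.gcd c x = 1}| ≤ 1 := by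
    simp only [Finset.card_filter]
    push_cast
    rw [← Finset.sum_add_distrib, ← Finset.sum_sub_distrib]
    refine (Finset.abs_sum_le_sum_abs _ _).trans ?_
    calc _ ≤ ∑ x ∈ Icc 1 X, if x = 1 then (1 : ℝ) else 0 := by
          refine Finset.sum_le_sum fun x hx => ?_
          rw [mem_Icc] at hx
          by_cases hg : Nat.gcd c x = 1
          · by_cases hs : 2 < c + x
            · have := lowerInv_comm_iff hc hx.1 hg hs
              by_cases hl : LowerInv c x
              · simp only [this, hl, hg]
                norm_num
                split_ifs <;> norm_num
              · simp only [this, hl, hg]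
                norm_num
                split_ifs <;> norm_num
            · have hx1 : x = 1 := by omega
              have hc1 : c = 1 := by omega
              subst hx1 hc1
              have hl : ¬ LowerInv 1 1 := by
                rintro ⟨-, h⟩
                have := (modInv_spec le_rfl (by norm_num : Nat.gcd 1 1 = 1)).1
                omega
              simp [hl]
          · have n1 : ¬ LowerInv c x := fun h => hg h.1
            have n2 : ¬ LowerInv x c := fun h => hg (by rw [Nat.gcd_comm]; exact h.1)
            simp only [n1, n2, hg]
            norm_num
            split_ifs <;> norm_num
      _ ≤ 1 := by
          rw [Finset.sum_ite_eq']
          split_ifs <;> norm_num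
  have e4 : (#{x ∈ Icc 1 X | LowerInv x c} : ℝ) - upperDensity c * X =
      ((#{x ∈ Icc 1 X | LowerInv x c} : ℝ) + #{x ∈ Icc 1 X | LowerInv c x} -
        #{x ∈ Icc 1 X | Nat.gcd c x = 1}) +
      (#{x ∈ Icc 1 X | Nat.gcd c x = 1} - (c.totient : ℝ) / c * X) -
      (#{x ∈ Icc 1 X | LowerInv c x} - lowerDensity c * X) := by
    rw [upperDensity]; ring
  rw [e4]
  refine (abs_sub _ _).trans ?_
  refine (add_le_add (abs_add_le _ _) le_rfl).trans ?_
  have h1' : |(#{x ∈ Icc 1 X | LowerInv c x} : ℝ) - lowerDensity c * X| ≤ 2 * E := h1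
  nlinarith

end ModInv

/-! ### Harmonic sums and the quadratic kernel -/

section Harmonic

local notation "γ" => Real.eulerMascheroniConstant

lemma gamma_bounds : (1 / 2 : ℝ) < γ ∧ γ < 2 / 3 :=
  ⟨Real.one_half_lt_eulerMascheroniConstant, Real.eulerMascheroniConstant_lt_two_thirds⟩

lemma abs_sum_inv_sub_log_le {x : ℝ} (hx : 1 ≤ x) :
    |∑ k ∈ Icc 1 ⌊x⌋₊, (1 : ℝ) / k - (Real.log x + γ)| ≤ 2 / x := by
  set m := ⌊x⌋₊ with hm
  have hm1 : 1 ≤ m := Nat.le_floor (by simpa using hx)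
  have hm1' : (1 : ℝ) ≤ m := by exact_mod_cast hm1
  have hmx : (m : ℝ) ≤ x := Nat.floor_le (by linarith)
  have hxm : x < m + 1 := Nat.lt_floor_add_one x
  have hH : ∑ k ∈ Icc 1 m, (1 : ℝ) / k = (harmonic m : ℝ) := by
    rw [harmonic_eq_sum_Icc]; push_cast; simp
  have h1 := Real.eulerMascheroniSeq_lt_eulerMascheroniConstant m
  have h2 := Real.eulerMascheroniConstant_lt_eulerMascheroniSeq' m
  rw [Real.eulerMascheroniSeq] at h1
  rw [Real.eulerMascheroniSeq', if_neg (by omega)] at h2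
  have h3 : Real.log (m + 1) - Real.log x ≤ 1 / x := by
    rw [← Real.log_div (by positivity) (by positivity)]
    refine (Real.log_le_sub_one_of_pos (by positivity)).trans ?_
    rw [div_sub_one (by positivity)]
    gcongr
    linarith
  have h4 : Real.log x - Real.log m ≤ 2 / x := by
    rw [← Real.log_div (by positivity) (by positivity)]
    refine (Real.log_le_sub_one_of_pos (by positivity)).trans ?_
    rw [div_sub_one (by positivity), div_le_div_iff₀ (by positivity) (by positivity)]
    nlinarith
  have h5 : 1 / x ≤ 2 / x := by gcongr; norm_num
  rw [hH, abs_le]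
  constructor <;> linarith

/-- The sum `∑ (Y - k)² / k` over positive integers `k ≤ Y`. All lattice point counts below are
expressed through it. -/
def quadKernel (Y : ℝ) : ℝ := ∑ k ∈ Icc 1 ⌊Y⌋₊, (Y - k) ^ 2 / k

lemma sum_Icc_cast (m : ℕ) : ∑ k ∈ Icc 1 m, (k : ℝ) = m * (m + 1) / 2 := by
  induction m with
  | zero => simp
  | succ m ih => rw [Finset.sum_Icc_succ_top (by omega), ih]; push_cast; ring

/-- The estimate holds for all `Y > 0`; for `Y < 1` the kernel is zero. -/
lemma abs_quadKernel_sub_le {Y : ℝ} (hY : 0 < Y) :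
    |quadKernel Y - Y ^ 2 * (Real.log Y + γ - 3 / 2)| ≤ 5 * Y := by
  obtain ⟨g1, g2⟩ := gamma_bounds
  rcases lt_or_ge Y 1 with h | h
  · have h0 : quadKernel Y = 0 := by simp [quadKernel, Nat.floor_eq_zero.2 h]
    have h1 := (Real.abs_log_mul_self_lt Y hY h.le).le
    rw [abs_le] at h1
    rw [h0, abs_le]
    constructor <;> nlinarith
  · set m := ⌊Y⌋₊ with hm
    have hm1 : 1 ≤ m := Nat.le_floor (by simpa using h)
    have hmx : (m : ℝ) ≤ Y := Nat.floor_le (by linarith)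
    have hxm : Y < m + 1 := Nat.lt_floor_add_one Y
    have e : quadKernel Y = Y ^ 2 * ∑ k ∈ Icc 1 m, (1 : ℝ) / k - 2 * Y * m + m * (m + 1) / 2 := by
      rw [quadKernel, ← hm, ← sum_Icc_cast, Finset.mul_sum]
      have : (2 * Y * m : ℝ) = ∑ k ∈ Icc 1 m, 2 * Y := by simp; ring
      rw [this, ← Finset.sum_sub_distrib, ← Finset.sum_add_distrib]
      refine Finset.sum_congr rfl fun k hk => ?_
      have : (k : ℝ) ≠ 0 := Nat.cast_ne_zero.2 (by rw [mem_Icc] at hk; omega)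
      field_simp
      ring
    have h1 := abs_sum_inv_sub_log_le h
    rw [← hm] at h1
    set S := ∑ k ∈ Icc 1 m, (1 : ℝ) / k
    have h2 : |Y ^ 2 * (S - (Real.log Y + γ))| ≤ 2 * Y := by
      rw [abs_mul, abs_of_nonneg (sq_nonneg Y)]
      calc _ ≤ Y ^ 2 * (2 / Y) := by gcongr
        _ = _ := by field_simp
    rw [abs_le] at h2
    rw [e, abs_le]
    constructor <;> nlinarith

lemma log_le_four_mul_rpow {x : ℝ} (hx : 0 ≤ x) : Real.log x ≤ 4 * x ^ (1 / 4 : ℝ) := by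
  have := Real.log_le_rpow_div (x := x) (ε := 1 / 4) hx (by norm_num)
  linarith

lemma one_add_log_le_two_mul_sqrt {x : ℝ} (hx : 0 < x) : 1 + Real.log x ≤ 2 * √x := by
  have h := Real.log_le_sub_one_of_pos (Real.sqrt_pos.2 hx)
  rw [Real.log_sqrt hx.le] at h
  linarith

lemma summable_inv_rpow_five_quarters : Summable (fun n : ℕ => 1 / (n : ℝ) ^ (5 / 4 : ℝ)) :=
  Real.summable_one_div_nat_rpow.2 (by norm_num)

/-- Telescoping against `log² / 2`. -/
lemma exists_abs_sum_log_div_sub_le :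
    ∃ C : ℝ, 0 ≤ C ∧ ∀ m : ℕ, 1 ≤ m →
      |∑ k ∈ Icc 1 m, Real.log k / k - Real.log m ^ 2 / 2| ≤ C := by
  have hs := summable_inv_rpow_five_quarters
  refine ⟨5 * ∑' n : ℕ, 1 / (n : ℝ) ^ (5 / 4 : ℝ), by positivity, fun m hm => ?_⟩
  have key : |∑ k ∈ Icc 1 m, Real.log k / k - Real.log m ^ 2 / 2| ≤
      ∑ k ∈ range m, 5 * (1 / (k : ℝ) ^ (5 / 4 : ℝ)) := by
    induction m, hm using Nat.le_induction with
    | base => simp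
    | succ m hm ih =>
      have hm1 : (1 : ℝ) ≤ m := by exact_mod_cast hm
      rw [Finset.sum_Icc_succ_top (by omega), Finset.sum_range_succ]
      push_cast
      set a := Real.log m with ha
      set b := Real.log (m + 1) with hb
      have hbpos : 0 ≤ b := Real.log_nonneg (by linarith)
      have hd1 : 1 / ((m : ℝ) + 1) ≤ b - a := by
        have := Real.one_sub_inv_le_log_of_pos (x := ((m : ℝ) + 1) / m) (by positivity)
        rw [Real.log_div (by positivity) (by positivity)] at this
        refine le_trans (le_of_eq ?_) this
        field_simp
        ring
      have hd2 : b - a ≤ 1 / m := by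
        have := Real.log_le_sub_one_of_pos (x := ((m : ℝ) + 1) / m) (by positivity)
        rw [Real.log_div (by positivity) (by positivity)] at this
        refine this.trans (le_of_eq ?_)
        field_simp
        ring
      have hstep : |b / (m + 1) - (b ^ 2 / 2 - a ^ 2 / 2)| ≤ 5 * (1 / (m : ℝ) ^ (5 / 4 : ℝ)) := by
        have hp : (m : ℝ) ^ (5 / 4 : ℝ) = m * (m : ℝ) ^ (1 / 4 : ℝ) := by
          rw [show (5 / 4 : ℝ) = 1 + 1 / 4 by norm_num, Real.rpow_add (by positivity),
            Real.rpow_one]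
        set y := (m : ℝ) ^ (1 / 4 : ℝ) with hy
        have hy1 : 1 ≤ y := Real.one_le_rpow hm1 (by norm_num)
        have hy4 : y ^ 4 = m := by
          rw [hy, ← Real.rpow_natCast, ← Real.rpow_mul (by positivity)]; norm_num
        have hy2m : y ^ 2 ≤ m := by rw [← hy4]; exact pow_le_pow_right₀ hy1 (by norm_num)
        have hbb : b ≤ 4 * ((m : ℝ) + 1) / y := by
          have h1 : Real.log (m + 1) ≤ 1 / m + a := by linarith
          have h2 : a ≤ 4 * y := log_le_four_mul_rpow (by positivity)
          rw [le_div_iff₀ (by positivity)]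
          have h3 : (1 : ℝ) / m ≤ 1 := by rw [div_le_one (by positivity)]; exact hm1
          have h5 : b ≤ 1 + 4 * y := by linarith
          have h6 : y ≤ y ^ 2 := by nlinarith
          nlinarith
        have e : b / (m + 1) - (b ^ 2 / 2 - a ^ 2 / 2) =
            (b - a) ^ 2 / 2 - b * ((b - a) - 1 / (m + 1)) := by
          field_simp; ring
        rw [e]
        have k1 : (b - a) ^ 2 / 2 ≤ 1 / (m * y) := by
          have h0 : 0 ≤ b - a := le_trans (by positivity) hd1
          have : (b - a) ^ 2 ≤ (1 / m) ^ 2 := by gcongr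
          have h1 : (1 / (m : ℝ)) ^ 2 ≤ 1 / (m * y) := by
            rw [div_pow, one_pow, sq]
            gcongr
            nlinarith
          have : 0 ≤ (b - a) ^ 2 := sq_nonneg _
          linarith
        have k2 : b * ((b - a) - 1 / (m + 1)) ≤ 4 / (m * y) := by
          calc _ ≤ (4 * ((m : ℝ) + 1) / y) * (1 / m - 1 / (m + 1)) := by
                gcongr
            _ = _ := by field_simp; ring
        have k3 : 0 ≤ b * ((b - a) - 1 / (m + 1)) := mul_nonneg hbpos (by linarith)
        have k4 : 0 ≤ (b - a) ^ 2 / 2 := by positivity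
        have k5 : 5 * (1 / ((m : ℝ) * y)) = 1 / (m * y) + 4 / (m * y) := by ring
        have k6 : 0 ≤ 1 / ((m : ℝ) * y) := by positivity
        have k7 : 4 / ((m : ℝ) * y) = 4 * (1 / (m * y)) := by ring
        rw [hp, abs_le]
        constructor <;> linarith
      have e : (∑ k ∈ Icc 1 m, Real.log k / k + b / (m + 1) - b ^ 2 / 2) =
          (∑ k ∈ Icc 1 m, Real.log k / k - a ^ 2 / 2) +
            (b / (m + 1) - (b ^ 2 / 2 - a ^ 2 / 2)) := by ring
      rw [e]
      exact (abs_add_le _ _).trans (add_le_add ih hstep)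
  refine key.trans ?_
  rw [← Finset.mul_sum]
  gcongr
  exact hs.sum_le_tsum _ (fun _ _ => by positivity)

lemma exists_abs_sum_inv_mul_log_sub_le :
    ∃ C : ℝ, 0 ≤ C ∧ ∀ x : ℝ, 1 ≤ x →
      |∑ k ∈ Icc 1 ⌊x⌋₊, (1 : ℝ) / k * Real.log (x / k) -
        (Real.log x ^ 2 / 2 + γ * Real.log x)| ≤ C := by
  obtain ⟨C, hC, h⟩ := exists_abs_sum_log_div_sub_le
  refine ⟨C + 4, by positivity, fun x hx => ?_⟩
  have hx0 : 0 < x := by linarith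
  set m := ⌊x⌋₊ with hm
  have hm1 : 1 ≤ m := Nat.le_floor (by simpa using hx)
  have hm1' : (1 : ℝ) ≤ m := by exact_mod_cast hm1
  have hmx : (m : ℝ) ≤ x := Nat.floor_le (by linarith)
  have hxm : x < m + 1 := Nat.lt_floor_add_one x
  have h1 := abs_sum_inv_sub_log_le hx
  rw [← hm] at h1
  have h2 := h m hm1
  set L := Real.log x with hL
  have hL0 : 0 ≤ L := Real.log_nonneg hx
  have hLx : L ≤ x := (Real.log_le_sub_one_of_pos hx0).trans (by linarith)
  have e : ∑ k ∈ Icc 1 m, (1 : ℝ) / k * Real.log (x / k) =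
      L * ∑ k ∈ Icc 1 m, (1 : ℝ) / k - ∑ k ∈ Icc 1 m, Real.log k / k := by
    rw [Finset.mul_sum, ← Finset.sum_sub_distrib]
    refine Finset.sum_congr rfl fun k hk => ?_
    have : (k : ℝ) ≠ 0 := Nat.cast_ne_zero.2 (by rw [mem_Icc] at hk; omega)
    rw [Real.log_div hx0.ne' this]
    ring
  set S := ∑ k ∈ Icc 1 m, (1 : ℝ) / k
  set T := ∑ k ∈ Icc 1 m, Real.log k / k
  have h3 : |L * (S - (L + γ))| ≤ 2 := by
    rw [abs_mul, abs_of_nonneg hL0]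
    calc L * |S - (L + γ)| ≤ x * (2 / x) := by gcongr
      _ = 2 := by field_simp
  have h4 : |L ^ 2 / 2 - Real.log m ^ 2 / 2| ≤ 2 := by
    have l1 : Real.log m ≤ L := Real.log_le_log (by positivity) hmx
    have l0 : 0 ≤ Real.log m := Real.log_nonneg hm1'
    have l2 : L - Real.log m ≤ 2 / x := by
      rw [hL, ← Real.log_div (by positivity) (by positivity)]
      refine (Real.log_le_sub_one_of_pos (by positivity)).trans ?_
      rw [div_sub_one (by positivity), div_le_div_iff₀ (by positivity) (by positivity)]
      nlinarith
    have e2 : L ^ 2 / 2 - Real.log m ^ 2 / 2 = (L - Real.log m) * ((L + Real.log m) / 2) := by ring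
    rw [e2, abs_of_nonneg (mul_nonneg (by linarith) (by positivity))]
    calc _ ≤ 2 / x * x := by
          gcongr
          linarith
      _ = 2 := by field_simp
  rw [e]
  have e3 : L * S - T - (L ^ 2 / 2 + γ * L) =
      L * (S - (L + γ)) - (T - Real.log m ^ 2 / 2) + (L ^ 2 / 2 - Real.log m ^ 2 / 2) := by ring
  rw [e3]
  refine (abs_add_le _ _).trans ?_
  have := abs_sub (L * (S - (L + γ))) (T - Real.log m ^ 2 / 2)
  linarith

end Harmonic

/-! ### Möbius sums and `ζ(2)`, `ζ'(2)` -/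

section Moebius

open ArithmeticFunction.Moebius

local notation "γ" => Real.eulerMascheroniConstant

lemma riemannZeta_two_eq : riemannZeta 2 = (zetaTwo : ℂ) := by
  have h : riemannZeta 2 = ((Real.pi ^ 2 / 6 : ℝ) : ℂ) := by
    rw [riemannZeta_two]; push_cast; rfl
  rw [zetaTwo, h, Complex.ofReal_re]

lemma zetaTwo_pos : 0 < zetaTwo := by
  have h : riemannZeta 2 = ((Real.pi ^ 2 / 6 : ℝ) : ℂ) := by
    rw [riemannZeta_two]; push_cast; rfl
  rw [zetaTwo, h, Complex.ofReal_re]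
  positivity

lemma LSeries_term_moebius_two (n : ℕ) :
    LSeries.term (fun n => ((μ n : ℤ) : ℂ)) 2 n = ((μ n / (n : ℝ) ^ 2 : ℝ) : ℂ) := by
  rcases eq_or_ne n 0 with rfl | hn
  · simp
  · rw [LSeries.term_of_ne_zero hn]
    push_cast
    norm_num

lemma hasSum_moebius_div_sq : HasSum (fun n : ℕ => (μ n : ℝ) / (n : ℝ) ^ 2) (1 / zetaTwo) := by
  have h2 : (1 : ℝ) < (2 : ℂ).re := by norm_num
  have h1 := ArithmeticFunction.LSeries_zeta_mul_Lseries_moebius h2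
  rw [ArithmeticFunction.LSeries_zeta_eq_riemannZeta h2, riemannZeta_two_eq] at h1
  have hs := (ArithmeticFunction.LSeriesSummable_moebius_iff.2 h2).LSeriesHasSum
  have e : LSeries (fun n => ((μ n : ℤ) : ℂ)) 2 = ((1 / zetaTwo : ℝ) : ℂ) := by
    have hz : (zetaTwo : ℂ) ≠ 0 := by exact_mod_cast zetaTwo_pos.ne'
    push_cast
    field_simp
    rw [mul_comm]; exact h1
  rw [e] at hs
  unfold LSeriesHasSum at hs
  rw [funext LSeries_term_moebius_two] at hs
  exact Complex.hasSum_ofReal.1 hs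

/-- The derivative of `∑ μ(n) n^(-s) = 1 / ζ(s)` at `s = 2`. -/
lemma hasSum_moebius_mul_log_div_sq :
    HasSum (fun n : ℕ => (μ n : ℝ) * Real.log n / (n : ℝ) ^ 2) (zetaDerivTwo / zetaTwo ^ 2) := by
  have h2 : (1 : ℝ) < (2 : ℂ).re := by norm_num
  have habs : LSeries.abscissaOfAbsConv (fun n => ((μ n : ℤ) : ℂ)) < (2 : ℂ).re := by
    rw [ArithmeticFunction.abscissaOfAbsConv_moebius]
    exact_mod_cast h2
  have hsum := (LSeriesSummable_logMul_of_lt_re habs).LSeriesHasSum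
  have hderiv := LSeries_deriv habs
  have hz : (zetaTwo : ℂ) ≠ 0 := by exact_mod_cast zetaTwo_pos.ne'
  have hev : LSeries (fun n => ((μ n : ℤ) : ℂ)) =ᶠ[nhds 2] fun s => (riemannZeta s)⁻¹ := by
    have hopen : IsOpen {s : ℂ | 1 < s.re} := isOpen_lt continuous_const Complex.continuous_re
    filter_upwards [hopen.mem_nhds (show (2 : ℂ) ∈ {s : ℂ | 1 < s.re} from h2)] with s hs
    have h := ArithmeticFunction.LSeries_zeta_mul_Lseries_moebius (s := s) hs
    rw [ArithmeticFunction.LSeries_zeta_eq_riemannZeta hs] at h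
    exact (inv_eq_of_mul_eq_one_right h).symm
  have hd : deriv (LSeries (fun n => ((μ n : ℤ) : ℂ))) 2 =
      -deriv riemannZeta 2 / riemannZeta 2 ^ 2 := by
    rw [hev.deriv_eq]
    exact ((differentiableAt_riemannZeta (by norm_num)).hasDerivAt.inv
      (by rw [riemannZeta_two_eq]; exact hz)).deriv
  have e : LSeries (LSeries.logMul (fun n => ((μ n : ℤ) : ℂ))) 2 =
      deriv riemannZeta 2 / ((zetaTwo ^ 2 : ℝ) : ℂ) := by
    rw [hd, riemannZeta_two_eq] at hderiv
    have : LSeries (LSeries.logMul (fun n => ((μ n : ℤ) : ℂ))) 2 =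
      -(-deriv riemannZeta 2 / (zetaTwo : ℂ) ^ 2) := by rw [hderiv, neg_neg]
    rw [this]
    push_cast
    ring
  rw [e] at hsum
  have hterm : ∀ n : ℕ, LSeries.term (LSeries.logMul (fun n => ((μ n : ℤ) : ℂ))) 2 n =
      (((μ n : ℝ) * Real.log n / (n : ℝ) ^ 2 : ℝ) : ℂ) := by
    intro n
    rcases eq_or_ne n 0 with rfl | hn
    · simp
    · rw [LSeries.term_of_ne_zero hn, LSeries.logMul]
      push_cast
      norm_num
      ring
  unfold LSeriesHasSum at hsum
  rw [funext hterm] at hsum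
  have hre := Complex.hasSum_re hsum
  simp only [Complex.ofReal_re, Complex.div_ofReal_re] at hre
  exact hre

/-- Tail bound for series whose terms are `O(n^(-7/4))`. -/
lemma exists_abs_sum_sub_le_of_hasSum {f : ℕ → ℝ} {S A : ℝ} (hf : HasSum f S)
    (hA : 0 ≤ A) (hbd : ∀ n : ℕ, 1 ≤ n → |f n| ≤ A / (n : ℝ) ^ (7 / 4 : ℝ)) (hf0 : f 0 = 0) :
    ∃ C : ℝ, 0 ≤ C ∧ ∀ x : ℝ, 1 ≤ x → |∑ n ∈ Icc 1 ⌊x⌋₊, f n - S| ≤ C / √x := by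
  have hs := summable_inv_rpow_five_quarters
  refine ⟨A * ∑' n : ℕ, 1 / (n : ℝ) ^ (5 / 4 : ℝ), by positivity, fun x hx => ?_⟩
  have hx0 : 0 < x := by linarith
  set s := Icc 1 ⌊x⌋₊ with hsdef
  have h1 : HasSum (fun n => if n ∈ s then f n else 0) (∑ n ∈ s, f n) := by
    have : HasSum (fun n => if n ∈ s then f n else 0) (∑ n ∈ s, if n ∈ s then f n else 0) :=
      hasSum_sum_of_ne_finset_zero (fun b hb => if_neg hb)
    rwa [Finset.sum_congr rfl (fun n hn => if_pos hn)] at this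
  have h2 := h1.sub hf
  have h3 : HasSum (fun n : ℕ => A / √x * (1 / (n : ℝ) ^ (5 / 4 : ℝ)))
      (A / √x * ∑' n : ℕ, 1 / (n : ℝ) ^ (5 / 4 : ℝ)) := hs.hasSum.mul_left _
  have h4 := h2.norm_le_of_bounded h3 (fun n => ?_)
  · rw [Real.norm_eq_abs] at h4
    refine h4.trans (le_of_eq ?_)
    ring
  · rw [Real.norm_eq_abs]
    split_ifs with hn
    · rw [sub_self, abs_zero]; positivity
    · rw [zero_sub, abs_neg]
      rcases Nat.eq_zero_or_pos n with rfl | hn0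
      · rw [hf0, abs_zero]; positivity
      · have hxn : x ≤ n := by
          by_contra hcon
          exact hn (mem_Icc.2 ⟨hn0, Nat.le_floor (not_le.1 hcon).le⟩)
        have hn0' : (0 : ℝ) < n := by exact_mod_cast hn0
        refine (hbd n hn0).trans ?_
        have e : (n : ℝ) ^ (7 / 4 : ℝ) = √n * (n : ℝ) ^ (5 / 4 : ℝ) := by
          rw [Real.sqrt_eq_rpow, ← Real.rpow_add hn0']; norm_num
        rw [e, div_mul_div_comm, mul_one]
        gcongr

lemma abs_moebius_le_one_real (n : ℕ) : |(μ n : ℝ)| ≤ 1 := by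
  exact_mod_cast ArithmeticFunction.abs_moebius_le_one

lemma exists_abs_sum_moebius_sub_le :
    ∃ C : ℝ, 0 ≤ C ∧ ∀ x : ℝ, 1 ≤ x →
      |∑ d ∈ Icc 1 ⌊x⌋₊, (μ d : ℝ) / (d : ℝ) ^ 2 - 1 / zetaTwo| ≤ C / √x := by
  refine exists_abs_sum_sub_le_of_hasSum hasSum_moebius_div_sq (A := 1) (by norm_num)
    (fun n hn => ?_) (by simp)
  have hn1 : (1 : ℝ) ≤ n := by exact_mod_cast hn
  rw [abs_div, abs_of_nonneg (by positivity : (0 : ℝ) ≤ (n : ℝ) ^ 2)]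
  gcongr
  · exact abs_moebius_le_one_real n
  · rw [← Real.rpow_natCast]
    exact Real.rpow_le_rpow_of_exponent_le hn1 (by norm_num)

lemma exists_abs_sum_moebius_mul_log_sub_le :
    ∃ C : ℝ, 0 ≤ C ∧ ∀ x : ℝ, 1 ≤ x →
      |∑ d ∈ Icc 1 ⌊x⌋₊, (μ d : ℝ) * Real.log d / (d : ℝ) ^ 2 - zetaDerivTwo / zetaTwo ^ 2| ≤
        C / √x := by
  refine exists_abs_sum_sub_le_of_hasSum hasSum_moebius_mul_log_div_sq (A := 4) (by norm_num)
    (fun n hn => ?_) (by simp)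
  have hn1 : (1 : ℝ) ≤ n := by exact_mod_cast hn
  have hn0 : (0 : ℝ) < n := by linarith
  have hl0 : 0 ≤ Real.log n := Real.log_nonneg hn1
  rw [abs_div, abs_mul, abs_of_nonneg (by positivity : (0 : ℝ) ≤ (n : ℝ) ^ 2),
    abs_of_nonneg hl0, div_le_div_iff₀ (by positivity) (by positivity)]
  have e : (n : ℝ) ^ 2 = (n : ℝ) ^ (1 / 4 : ℝ) * (n : ℝ) ^ (7 / 4 : ℝ) := by
    rw [← Real.rpow_add hn0, ← Real.rpow_natCast]; norm_num
  rw [e, ← mul_assoc]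
  refine mul_le_mul_of_nonneg_right ?_ (by positivity)
  calc _ ≤ 1 * Real.log n := mul_le_mul_of_nonneg_right (abs_moebius_le_one_real n) hl0
    _ ≤ _ := by rw [one_mul]; exact log_le_four_mul_rpow hn0.le

lemma totient_eq_sum_moebius {n : ℕ} (hn : 0 < n) :
    ∑ x ∈ n.divisorsAntidiagonal, (μ x.1 : ℝ) * x.2 = n.totient := by
  refine (ArithmeticFunction.sum_eq_iff_sum_mul_moebius_eq (R := ℝ)
    (f := fun n => (n.totient : ℝ)) (g := fun n => (n : ℝ))).1 (fun n _ => ?_) n hn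
  exact_mod_cast Nat.sum_totient n

lemma sum_sum_divisorsAntidiagonal (n : ℕ) (F : ℕ → ℕ → ℝ) :
    ∑ q ∈ Icc 1 n, ∑ x ∈ q.divisorsAntidiagonal, F x.1 x.2 =
      ∑ d ∈ Icc 1 n, ∑ m ∈ Icc 1 (n / d), F d m := by
  rw [Finset.sum_sigma', Finset.sum_sigma']
  refine Finset.sum_bij' (fun y _ => ⟨y.2.1, y.2.2⟩) (fun y _ => ⟨y.1 * y.2, (y.1, y.2)⟩)
    ?_ ?_ ?_ ?_ ?_
  · rintro ⟨q, d, m⟩ h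
    simp only [mem_sigma, mem_Icc, Nat.mem_divisorsAntidiagonal] at h ⊢
    obtain ⟨⟨h1, h2⟩, h3, h4⟩ := h
    have hd : 0 < d := Nat.pos_of_ne_zero (by rintro rfl; simp at h3; omega)
    have hm : 0 < m := Nat.pos_of_ne_zero (by rintro rfl; simp at h3; omega)
    refine ⟨⟨hd, ?_⟩, hm, ?_⟩
    · exact le_trans (le_trans (Nat.le_mul_of_pos_right d hm) h3.le) h2
    · rw [Nat.le_div_iff_mul_le hd, mul_comm, h3]; exact h2
  · rintro ⟨d, m⟩ h
    simp only [mem_sigma, mem_Icc, Nat.mem_divisorsAntidiagonal] at h ⊢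
    obtain ⟨⟨h1, h2⟩, h3, h4⟩ := h
    have : 1 ≤ d * m := Nat.mul_pos h1 h3
    rw [Nat.le_div_iff_mul_le h1, mul_comm] at h4
    exact ⟨⟨this, h4⟩, trivial, by omega⟩
  · rintro ⟨q, d, m⟩ h
    simp only [mem_sigma, mem_Icc, Nat.mem_divisorsAntidiagonal] at h
    obtain ⟨-, h3, -⟩ := h
    subst h3
    rfl
  · rintro ⟨d, m⟩ h
    rfl
  · rintro ⟨q, d, m⟩ h
    rfl

/-- Sums of `φ(q) / q²` against a kernel in `x / q`, reduced to harmonic sums. -/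
lemma sum_totient_div_sq_mul (x : ℝ) (k : ℝ → ℝ) :
    ∑ q ∈ Icc 1 ⌊x⌋₊, (q.totient : ℝ) / (q : ℝ) ^ 2 * k (x / q) =
      ∑ d ∈ Icc 1 ⌊x⌋₊, (μ d : ℝ) / (d : ℝ) ^ 2 *
        ∑ m ∈ Icc 1 ⌊x / d⌋₊, (1 : ℝ) / m * k (x / d / m) := by
  calc _ = ∑ q ∈ Icc 1 ⌊x⌋₊, ∑ y ∈ q.divisorsAntidiagonal,
        (μ y.1 : ℝ) / (y.1 : ℝ) ^ 2 * ((1 : ℝ) / y.2 * k (x / y.1 / y.2)) := by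
        refine Finset.sum_congr rfl fun q hq => ?_
        have hq0 : 0 < q := (mem_Icc.1 hq).1
        rw [← totient_eq_sum_moebius hq0, Finset.sum_div, Finset.sum_mul]
        refine Finset.sum_congr rfl fun y hy => ?_
        obtain ⟨h1, -⟩ := Nat.mem_divisorsAntidiagonal.1 hy
        have hy1 : (y.1 : ℝ) ≠ 0 := Nat.cast_ne_zero.2 (by
            rintro h; rw [h] at h1; simp at h1; omega)
        have hy2 : (y.2 : ℝ) ≠ 0 := Nat.cast_ne_zero.2 (by
            rintro h; rw [h] at h1; simp at h1; omega)
        have e : (q : ℝ) = y.1 * y.2 := by exact_mod_cast h1.symm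
        rw [e, ← div_div]
        field_simp
    _ = _ := by
        rw [sum_sum_divisorsAntidiagonal ⌊x⌋₊ (fun d m =>
          (μ d : ℝ) / (d : ℝ) ^ 2 * ((1 : ℝ) / m * k (x / d / m)))]
        refine Finset.sum_congr rfl fun d hd => ?_
        rw [Nat.floor_div_natCast, Finset.mul_sum]

lemma sum_inv_sq_le (n : ℕ) : ∑ d ∈ Icc 1 n, (1 : ℝ) / (d : ℝ) ^ 2 ≤ 2 := by
  have : ∀ n : ℕ, 1 ≤ n → ∑ d ∈ Icc 1 n, (1 : ℝ) / (d : ℝ) ^ 2 ≤ 2 - 1 / n := by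
    intro n hn
    induction n, hn using Nat.le_induction with
    | base => norm_num
    | succ n hn ih =>
      have hn1 : (1 : ℝ) ≤ n := by exact_mod_cast hn
      rw [Finset.sum_Icc_succ_top (by omega)]
      have : (1 : ℝ) / ((n + 1 : ℕ) : ℝ) ^ 2 ≤ 1 / n - 1 / ((n + 1 : ℕ) : ℝ) := by
        push_cast
        rw [div_sub_div _ _ (by positivity) (by positivity),
          div_le_div_iff₀ (by positivity) (by positivity)]
        nlinarith
      linarith
  rcases Nat.eq_zero_or_pos n with rfl | hn
  · simp
  · have h := this n hn
    have : (0 : ℝ) ≤ 1 / n := by positivity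
    linarith

lemma sum_inv_le {x : ℝ} (hx : 1 ≤ x) : ∑ d ∈ Icc 1 ⌊x⌋₊, (1 : ℝ) / d ≤ 2 * √x := by
  have h := harmonic_floor_le_one_add_log x hx
  rw [harmonic_eq_sum_Icc] at h
  push_cast at h
  have := one_add_log_le_two_mul_sqrt (x := x) (by linarith)
  simp only [one_div]
  linarith

end Moebius

/-! ### Sums of the densities against kernels -/

section KernelSums

open ArithmeticFunction.Moebius

local notation "γ" => Real.eulerMascheroniConstant

lemma rpow_quarter_facts {x : ℝ} (hx : 1 ≤ x) :
    1 ≤ x ^ (1 / 4 : ℝ) ∧ √x = (x ^ (1 / 4 : ℝ)) ^ 2 ∧ 0 ≤ Real.log x ∧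
      Real.log x ≤ 4 * x ^ (1 / 4 : ℝ) := by
  refine ⟨Real.one_le_rpow hx (by norm_num), ?_, Real.log_nonneg hx,
    log_le_four_mul_rpow (by linarith)⟩
  rw [Real.sqrt_eq_rpow, ← Real.rpow_natCast, ← Real.rpow_mul (by linarith)]
  norm_num

lemma one_le_div_of_mem_Icc {x : ℝ} (hx : 1 ≤ x) {d : ℕ} (hd : d ∈ Icc 1 ⌊x⌋₊) :
    (1 : ℝ) ≤ d ∧ (d : ℝ) ≤ x ∧ 1 ≤ x / d := by
  rw [mem_Icc] at hd
  have h1 : (1 : ℝ) ≤ d := by exact_mod_cast hd.1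
  have h2 : (d : ℝ) ≤ x := (Nat.le_floor_iff (by linarith)).1 hd.2
  exact ⟨h1, h2, (one_le_div (by linarith)).2 h2⟩

/-- Möbius sums of a function of logarithmic growth, with a small remainder. -/
lemma exists_abs_sum_moebius_mul_sub_le_of_log {G : ℝ → ℝ} {κ A : ℝ} (hA : 0 ≤ A)
    (hG : ∀ y : ℝ, 1 ≤ y → |G y - (Real.log y + κ)| ≤ A / y) :
    ∃ C : ℝ, 0 ≤ C ∧ ∀ x : ℝ, 1 ≤ x →
      |∑ d ∈ Icc 1 ⌊x⌋₊, (μ d : ℝ) / (d : ℝ) ^ 2 * G (x / d) -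
        ((Real.log x + κ) / zetaTwo - zetaDerivTwo / zetaTwo ^ 2)| ≤ C / x ^ (1 / 4 : ℝ) := by
  obtain ⟨C1, hC1, h1⟩ := exists_abs_sum_moebius_sub_le
  obtain ⟨C2, hC2, h2⟩ := exists_abs_sum_moebius_mul_log_sub_le
  refine ⟨2 * A + (4 + |κ|) * C1 + C2, by positivity, fun x hx => ?_⟩
  obtain ⟨w1, w2, w3, w4⟩ := rpow_quarter_facts hx
  have hP := h1 x hx
  have hQ := h2 x hx
  have hx0 : 0 < x := by linarith
  set w := x ^ (1 / 4 : ℝ)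
  set L := Real.log x with hL
  set P := ∑ d ∈ Icc 1 ⌊x⌋₊, (μ d : ℝ) / (d : ℝ) ^ 2
  set Q := ∑ d ∈ Icc 1 ⌊x⌋₊, (μ d : ℝ) * Real.log d / (d : ℝ) ^ 2
  rw [w2] at hP hQ
  have hww : ∀ B : ℝ, 0 ≤ B → B / w ^ 2 ≤ B / w := fun B hB => by
    gcongr; nlinarith
  have e1 : ∑ d ∈ Icc 1 ⌊x⌋₊, (μ d : ℝ) / (d : ℝ) ^ 2 * (Real.log (x / d) + κ) =
      (L + κ) * P - Q := by
    rw [Finset.mul_sum, ← Finset.sum_sub_distrib]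
    refine Finset.sum_congr rfl fun d hd => ?_
    obtain ⟨d1, d2, d3⟩ := one_le_div_of_mem_Icc hx hd
    rw [Real.log_div hx0.ne' (by positivity)]
    ring
  have e2 : |∑ d ∈ Icc 1 ⌊x⌋₊, (μ d : ℝ) / (d : ℝ) ^ 2 * G (x / d) - ((L + κ) * P - Q)| ≤
      2 * A / w := by
    rw [← e1, ← Finset.sum_sub_distrib]
    calc _ ≤ ∑ d ∈ Icc 1 ⌊x⌋₊, A / x * (1 / (d : ℝ)) := by
          refine (Finset.abs_sum_le_sum_abs _ _).trans (Finset.sum_le_sum fun d hd => ?_)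
          obtain ⟨d1, d2, d3⟩ := one_le_div_of_mem_Icc hx hd
          rw [← mul_sub, abs_mul, abs_div, abs_of_nonneg (by positivity : (0 : ℝ) ≤ (d : ℝ) ^ 2)]
          calc _ ≤ 1 / (d : ℝ) ^ 2 * (A / (x / d)) := by
                gcongr
                · exact abs_moebius_le_one_real d
                · exact hG _ d3
            _ = _ := by field_simp
      _ = A / x * ∑ d ∈ Icc 1 ⌊x⌋₊, 1 / (d : ℝ) := by rw [Finset.mul_sum]
      _ ≤ A / x * (2 * √x) := by
          gcongr
          exact sum_inv_le hx
      _ = 2 * A / w ^ 2 := by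
          rw [← w2]
          have := Real.mul_self_sqrt hx0.le
          have hs : 0 < √x := Real.sqrt_pos.2 hx0
          field_simp
          linear_combination A * this
      _ ≤ _ := hww _ (by positivity)
  have e3 : |(L + κ) * (P - 1 / zetaTwo)| ≤ (4 + |κ|) * C1 / w := by
    rw [abs_mul]
    calc _ ≤ ((4 + |κ|) * w) * (C1 / w ^ 2) := by
          gcongr
          refine (abs_add_le _ _).trans ?_
          rw [abs_of_nonneg w3]
          nlinarith [abs_nonneg κ]
      _ = _ := by field_simp
  have e4 := hQ.trans (hww C2 hC2)
  have e5 : ∑ d ∈ Icc 1 ⌊x⌋₊, (μ d : ℝ) / (d : ℝ) ^ 2 * G (x / d) -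
        ((L + κ) / zetaTwo - zetaDerivTwo / zetaTwo ^ 2) =
      (∑ d ∈ Icc 1 ⌊x⌋₊, (μ d : ℝ) / (d : ℝ) ^ 2 * G (x / d) - ((L + κ) * P - Q)) +
      (L + κ) * (P - 1 / zetaTwo) - (Q - zetaDerivTwo / zetaTwo ^ 2) := by ring
  rw [e5]
  refine (abs_sub _ _).trans ((add_le_add (abs_add_le _ _) le_rfl).trans ?_)
  rw [add_div, add_div]
  gcongr

/-- Möbius sums of a function of quadratic logarithmic growth. -/
lemma exists_abs_sum_moebius_mul_sub_le_of_log_sq {G : ℝ → ℝ} {κ A : ℝ} (hA : 0 ≤ A)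
    (hG : ∀ y : ℝ, 1 ≤ y → |G y - (Real.log y ^ 2 / 2 + κ * Real.log y)| ≤ A) :
    ∃ C : ℝ, 0 ≤ C ∧ ∀ x : ℝ, 1 ≤ x →
      |∑ d ∈ Icc 1 ⌊x⌋₊, (μ d : ℝ) / (d : ℝ) ^ 2 * G (x / d) -
        (Real.log x ^ 2 / (2 * zetaTwo) +
          Real.log x * (κ / zetaTwo - zetaDerivTwo / zetaTwo ^ 2))| ≤ C := by
  obtain ⟨C1, hC1, h1⟩ := exists_abs_sum_moebius_sub_le
  obtain ⟨C2, hC2, h2⟩ := exists_abs_sum_moebius_mul_log_sub_le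
  have hs := summable_inv_rpow_five_quarters
  refine ⟨2 * A + (8 + 4 * |κ|) * (∑' n : ℕ, 1 / (n : ℝ) ^ (5 / 4 : ℝ)) +
    (8 + 4 * |κ|) * C1 + 4 * C2, by positivity, fun x hx => ?_⟩
  obtain ⟨w1, w2, w3, w4⟩ := rpow_quarter_facts hx
  have hP := h1 x hx
  have hQ := h2 x hx
  have hx0 : 0 < x := by linarith
  set w := x ^ (1 / 4 : ℝ)
  set L := Real.log x with hL
  set P := ∑ d ∈ Icc 1 ⌊x⌋₊, (μ d : ℝ) / (d : ℝ) ^ 2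
  set Q := ∑ d ∈ Icc 1 ⌊x⌋₊, (μ d : ℝ) * Real.log d / (d : ℝ) ^ 2
  set R := ∑ d ∈ Icc 1 ⌊x⌋₊, (μ d : ℝ) / (d : ℝ) ^ 2 * (Real.log d ^ 2 / 2 - κ * Real.log d)
  rw [w2] at hP hQ
  have e1 : ∑ d ∈ Icc 1 ⌊x⌋₊, (μ d : ℝ) / (d : ℝ) ^ 2 *
      (Real.log (x / d) ^ 2 / 2 + κ * Real.log (x / d)) =
      (L ^ 2 / 2 + κ * L) * P - L * Q + R := by
    rw [Finset.mul_sum, Finset.mul_sum, ← Finset.sum_sub_distrib, ← Finset.sum_add_distrib]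
    refine Finset.sum_congr rfl fun d hd => ?_
    obtain ⟨d1, d2, d3⟩ := one_le_div_of_mem_Icc hx hd
    rw [Real.log_div hx0.ne' (by positivity)]
    ring
  have e2 : |∑ d ∈ Icc 1 ⌊x⌋₊, (μ d : ℝ) / (d : ℝ) ^ 2 * G (x / d) -
      ((L ^ 2 / 2 + κ * L) * P - L * Q + R)| ≤ 2 * A := by
    rw [← e1, ← Finset.sum_sub_distrib]
    calc _ ≤ ∑ d ∈ Icc 1 ⌊x⌋₊, A * (1 / (d : ℝ) ^ 2) := by
          refine (Finset.abs_sum_le_sum_abs _ _).trans (Finset.sum_le_sum fun d hd => ?_)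
          obtain ⟨d1, d2, d3⟩ := one_le_div_of_mem_Icc hx hd
          rw [← mul_sub, abs_mul, abs_div, abs_of_nonneg (by positivity : (0 : ℝ) ≤ (d : ℝ) ^ 2),
            mul_comm]
          gcongr
          · exact hG _ d3
          · exact abs_moebius_le_one_real d
      _ ≤ A * 2 := by
          rw [← Finset.mul_sum]
          gcongr
          exact sum_inv_sq_le _
      _ = _ := mul_comm _ _
  have e6 : |R| ≤ (8 + 4 * |κ|) * (∑' n : ℕ, 1 / (n : ℝ) ^ (5 / 4 : ℝ)) := by
    calc _ ≤ ∑ d ∈ Icc 1 ⌊x⌋₊, (8 + 4 * |κ|) * (1 / (d : ℝ) ^ (5 / 4 : ℝ)) := by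
          refine (Finset.abs_sum_le_sum_abs _ _).trans (Finset.sum_le_sum fun d hd => ?_)
          obtain ⟨d1, d2, d3⟩ := one_le_div_of_mem_Icc hx hd
          obtain ⟨v1, v2, v3, v4⟩ := rpow_quarter_facts d1
          have ed : (d : ℝ) ^ (5 / 4 : ℝ) = ((d : ℝ) ^ (1 / 4 : ℝ)) ^ 5 := by
            rw [← Real.rpow_natCast, ← Real.rpow_mul (by linarith)]; norm_num
          have ed2 : (d : ℝ) ^ 2 = ((d : ℝ) ^ (1 / 4 : ℝ)) ^ 8 := by
            rw [← Real.rpow_natCast, ← Real.rpow_natCast, ← Real.rpow_mul (by linarith)]; norm_num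
          rw [ed, abs_mul, abs_div, abs_of_nonneg (by positivity : (0 : ℝ) ≤ (d : ℝ) ^ 2), ed2]
          set v := (d : ℝ) ^ (1 / 4 : ℝ)
          have hl : |Real.log d ^ 2 / 2 - κ * Real.log d| ≤ (8 + 4 * |κ|) * v ^ 2 := by
            refine (abs_sub _ _).trans ?_
            rw [abs_mul, abs_of_nonneg v3, abs_of_nonneg (by positivity : 0 ≤ Real.log d ^ 2 / 2)]
            have a1 : Real.log d ^ 2 ≤ (4 * v) ^ 2 := by gcongr
            have a2 : |κ| * Real.log d ≤ |κ| * (4 * v ^ 2) := by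
              gcongr
              nlinarith
            nlinarith
          calc _ ≤ 1 / v ^ 8 * ((8 + 4 * |κ|) * v ^ 2) := by
                gcongr
                exact abs_moebius_le_one_real d
            _ = (8 + 4 * |κ|) * (1 / v ^ 6) := by field_simp
            _ ≤ _ := by
                refine mul_le_mul_of_nonneg_left ?_ (by positivity)
                exact one_div_le_one_div_of_le (by positivity)
                  (pow_le_pow_right₀ v1 (by norm_num))
      _ ≤ _ := by
          rw [← Finset.mul_sum]
          gcongr
          exact hs.sum_le_tsum _ (fun _ _ => by positivity)
  have e3 : |(L ^ 2 / 2 + κ * L) * (P - 1 / zetaTwo)| ≤ (8 + 4 * |κ|) * C1 := by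
    rw [abs_mul]
    calc _ ≤ ((8 + 4 * |κ|) * w ^ 2) * (C1 / w ^ 2) := by
          gcongr
          refine (abs_add_le _ _).trans ?_
          rw [abs_mul, abs_of_nonneg w3, abs_of_nonneg (by positivity : 0 ≤ L ^ 2 / 2)]
          have a1 : L ^ 2 ≤ (4 * w) ^ 2 := by gcongr
          have a2 : |κ| * L ≤ |κ| * (4 * w ^ 2) := by
            gcongr
            nlinarith
          nlinarith
      _ = _ := by field_simp
  have e4 : |L * (Q - zetaDerivTwo / zetaTwo ^ 2)| ≤ 4 * C2 := by
    rw [abs_mul, abs_of_nonneg w3]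
    calc _ ≤ (4 * w ^ 2) * (C2 / w ^ 2) := by
          gcongr
          nlinarith
      _ = _ := by field_simp
  have e5 : ∑ d ∈ Icc 1 ⌊x⌋₊, (μ d : ℝ) / (d : ℝ) ^ 2 * G (x / d) -
        (L ^ 2 / (2 * zetaTwo) + L * (κ / zetaTwo - zetaDerivTwo / zetaTwo ^ 2)) =
      (∑ d ∈ Icc 1 ⌊x⌋₊, (μ d : ℝ) / (d : ℝ) ^ 2 * G (x / d) -
        ((L ^ 2 / 2 + κ * L) * P - L * Q + R)) + R +
      (L ^ 2 / 2 + κ * L) * (P - 1 / zetaTwo) - L * (Q - zetaDerivTwo / zetaTwo ^ 2) := by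
    have := zetaTwo_pos
    field_simp
    ring
  rw [e5]
  refine (abs_sub _ _).trans ((add_le_add ((abs_add_le _ _).trans
    (add_le_add (abs_add_le _ _) le_rfl)) le_rfl).trans ?_)
  linarith

/-- The coefficient of the leading term of `∑ upperDensity q / q`. -/
def densityLead : ℝ := 1 / (2 * zetaTwo)

/-- The constant term of `∑ upperDensity q / q`. -/
def densityConst : ℝ := (γ / zetaTwo - zetaDerivTwo / zetaTwo ^ 2) / 2 + 3 / 8

/-- The densities differ from `φ(q) / (2 q)` at `q = 1` and `q = 2` only. -/
lemma sum_correction {x : ℝ} (hx : 1 ≤ x) (k : ℝ → ℝ) :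
    ∑ q ∈ Icc 1 ⌊x⌋₊, ((if q = 1 then (1 : ℝ) / 2 else 0) - (if q = 2 then 1 / 4 else 0)) / q *
      k (x / q) = k x / 2 - if 2 ≤ x then k (x / 2) / 8 else 0 := by
  have h1 : 1 ∈ Icc 1 ⌊x⌋₊ := mem_Icc.2 ⟨le_rfl, Nat.le_floor (by simpa using hx)⟩
  have h2 : 2 ∈ Icc 1 ⌊x⌋₊ ↔ 2 ≤ x := by
    rw [mem_Icc, Nat.le_floor_iff (by linarith)]
    norm_num
  have e : ∀ q ∈ Icc 1 ⌊x⌋₊,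
      ((if q = 1 then (1 : ℝ) / 2 else 0) - (if q = 2 then 1 / 4 else 0)) / q * k (x / q) =
      (if q = 1 then k x / 2 else 0) - (if q = 2 then k (x / 2) / 8 else 0) := by
    intro q _
    by_cases hq1 : q = 1
    · subst hq1; norm_num; ring
    · by_cases hq2 : q = 2
      · subst hq2; norm_num; ring
      · simp [hq1, hq2]
  rw [Finset.sum_congr rfl e, Finset.sum_sub_distrib, Finset.sum_ite_eq', Finset.sum_ite_eq',
    if_pos h1]
  simp only [h2]

lemma sum_upperDensity_div_mul {x : ℝ} (hx : 1 ≤ x) (k : ℝ → ℝ) :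
    ∑ q ∈ Icc 1 ⌊x⌋₊, upperDensity q / q * k (x / q) =
      (∑ d ∈ Icc 1 ⌊x⌋₊, (μ d : ℝ) / (d : ℝ) ^ 2 *
        ∑ m ∈ Icc 1 ⌊x / d⌋₊, (1 : ℝ) / m * k (x / d / m)) / 2 +
      (k x / 2 - if 2 ≤ x then k (x / 2) / 8 else 0) := by
  rw [← sum_totient_div_sq_mul, ← sum_correction hx, Finset.sum_div, ← Finset.sum_add_distrib]
  refine Finset.sum_congr rfl fun q hq => ?_
  obtain ⟨d1, -, -⟩ := one_le_div_of_mem_Icc hx hq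
  rw [upperDensity_eq (mem_Icc.1 hq).1]
  field_simp
  ring

lemma exists_abs_sum_upperDensity_div_sub_le :
    ∃ C : ℝ, 0 ≤ C ∧ ∀ x : ℝ, 1 ≤ x →
      |∑ q ∈ Icc 1 ⌊x⌋₊, upperDensity q / q - densityLead * Real.log x| ≤ C := by
  obtain ⟨C, hC, h⟩ := exists_abs_sum_moebius_mul_sub_le_of_log (κ := γ)
    (G := fun y => ∑ m ∈ Icc 1 ⌊y⌋₊, (1 : ℝ) / m) (A := 2) (by norm_num)
    (fun y hy => abs_sum_inv_sub_log_le hy)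
  refine ⟨C + |γ / zetaTwo - zetaDerivTwo / zetaTwo ^ 2| + 1, by positivity, fun x hx => ?_⟩
  have h0 := h x hx
  obtain ⟨w1, -, -, -⟩ := rpow_quarter_facts hx
  have h1 : C / x ^ (1 / 4 : ℝ) ≤ C := div_le_self hC w1
  have e := sum_upperDensity_div_mul hx (fun _ => 1)
  simp only [mul_one] at e
  rw [e]
  have hc : |(1 / 2 - if 2 ≤ x then 1 / 8 else 0 : ℝ)| ≤ 1 := by
    split_ifs <;> norm_num [abs_le]
  set S := ∑ d ∈ Icc 1 ⌊x⌋₊, (μ d : ℝ) / (d : ℝ) ^ 2 * ∑ m ∈ Icc 1 ⌊x / d⌋₊, (1 : ℝ) / m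
  have e2 : S / 2 + (1 / 2 - if 2 ≤ x then 1 / 8 else 0) - densityLead * Real.log x =
      (S - ((Real.log x + γ) / zetaTwo - zetaDerivTwo / zetaTwo ^ 2)) / 2 +
      (γ / zetaTwo - zetaDerivTwo / zetaTwo ^ 2) / 2 + (1 / 2 - if 2 ≤ x then 1 / 8 else 0) := by
    have := zetaTwo_pos
    rw [densityLead]
    field_simp
    ring
  rw [e2]
  refine (abs_add_le _ _).trans ((add_le_add (abs_add_le _ _) le_rfl).trans ?_)
  rw [abs_div, abs_div, abs_two]
  have := abs_nonneg (S - ((Real.log x + γ) / zetaTwo - zetaDerivTwo / zetaTwo ^ 2))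
  have := abs_nonneg (γ / zetaTwo - zetaDerivTwo / zetaTwo ^ 2)
  linarith

lemma exists_abs_sum_upperDensity_div_mul_log_sub_le :
    ∃ C : ℝ, 0 ≤ C ∧ ∀ x : ℝ, 1 ≤ x →
      |∑ q ∈ Icc 1 ⌊x⌋₊, upperDensity q / q * Real.log (x / q) -
        (densityLead * Real.log x ^ 2 / 2 + densityConst * Real.log x)| ≤ C := by
  obtain ⟨A, hA, hA'⟩ := exists_abs_sum_inv_mul_log_sub_le
  obtain ⟨C, hC, h⟩ := exists_abs_sum_moebius_mul_sub_le_of_log_sq hA hA'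
  refine ⟨C + 1, by positivity, fun x hx => ?_⟩
  have h0 := h x hx
  have hL : 0 ≤ Real.log x := Real.log_nonneg hx
  rw [sum_upperDensity_div_mul hx Real.log]
  have hl2 : 0 < Real.log 2 := Real.log_pos (by norm_num)
  have hl2' : Real.log 2 ≤ 1 := by linarith [Real.log_le_sub_one_of_pos (x := 2) (by norm_num)]
  have hc : |Real.log x / 2 - (if 2 ≤ x then Real.log (x / 2) / 8 else 0) -
      3 / 8 * Real.log x| ≤ 1 := by
    split_ifs with h2
    · rw [Real.log_div (by positivity) (by norm_num), abs_le]
      constructor <;> linarith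
    · have : Real.log x ≤ Real.log 2 := Real.log_le_log (by linarith) (by linarith)
      rw [abs_le]
      constructor <;> linarith
  set S := ∑ d ∈ Icc 1 ⌊x⌋₊, (μ d : ℝ) / (d : ℝ) ^ 2 *
    ∑ m ∈ Icc 1 ⌊x / d⌋₊, (1 : ℝ) / m * Real.log (x / d / m)
  set T := Real.log x / 2 - (if 2 ≤ x then Real.log (x / 2) / 8 else 0)
  have e2 : S / 2 + T - (densityLead * Real.log x ^ 2 / 2 + densityConst * Real.log x) =
      (S - (Real.log x ^ 2 / (2 * zetaTwo) +
        Real.log x * (γ / zetaTwo - zetaDerivTwo / zetaTwo ^ 2))) / 2 +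
      (T - 3 / 8 * Real.log x) := by
    have := zetaTwo_pos
    rw [densityLead, densityConst]
    field_simp
    ring
  rw [e2]
  refine (abs_add_le _ _).trans ?_
  rw [abs_div, abs_two]
  have := abs_nonneg (S - (Real.log x ^ 2 / (2 * zetaTwo) +
        Real.log x * (γ / zetaTwo - zetaDerivTwo / zetaTwo ^ 2)))
  linarith

lemma sum_inv_mul_one_sub_sq {y : ℝ} (hy : 0 < y) :
    ∑ m ∈ Icc 1 ⌊y⌋₊, (1 : ℝ) / m * (1 - 1 / (y / m)) ^ 2 = quadKernel y / y ^ 2 := by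
  rw [quadKernel, Finset.sum_div]
  refine Finset.sum_congr rfl fun m hm => ?_
  have : (m : ℝ) ≠ 0 := Nat.cast_ne_zero.2 (by rw [mem_Icc] at hm; omega)
  field_simp

lemma exists_abs_sum_upperDensity_div_mul_sq_sub_le :
    ∃ C : ℝ, 0 ≤ C ∧ ∀ x : ℝ, 1 ≤ x →
      |∑ q ∈ Icc 1 ⌊x⌋₊, upperDensity q / q * (1 - q / x) ^ 2 -
        (densityLead * (Real.log x - 3 / 2) + densityConst)| ≤ C / x ^ (1 / 4 : ℝ) := by
  have hG : ∀ y : ℝ, 1 ≤ y →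
      |(fun y => ∑ m ∈ Icc 1 ⌊y⌋₊, (1 : ℝ) / m * (1 - 1 / (y / m)) ^ 2) y -
        (Real.log y + (γ - 3 / 2))| ≤ 5 / y := by
    intro y hy
    have hy0 : 0 < y := by linarith
    simp only []
    rw [sum_inv_mul_one_sub_sq hy0]
    have h := abs_quadKernel_sub_le hy0
    have e : quadKernel y / y ^ 2 - (Real.log y + (γ - 3 / 2)) =
        (quadKernel y - y ^ 2 * (Real.log y + γ - 3 / 2)) / y ^ 2 := by field_simp; ring
    rw [e, abs_div, abs_of_nonneg (sq_nonneg y), div_le_div_iff₀ (by positivity) hy0]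
    nlinarith
  obtain ⟨C, hC, h⟩ := exists_abs_sum_moebius_mul_sub_le_of_log (by norm_num) hG
  refine ⟨C + 2, by positivity, fun x hx => ?_⟩
  have h0 := h x hx
  have hx0 : 0 < x := by linarith
  obtain ⟨w1, -, -, -⟩ := rpow_quarter_facts hx
  have e := sum_upperDensity_div_mul hx (fun t => (1 - 1 / t) ^ 2)
  simp only [one_div_div] at e
  rw [e]
  simp only [one_div_div] at h0
  have hc : |(1 - 1 / x) ^ 2 / 2 - (if 2 ≤ x then (1 - 2 / x) ^ 2 / 8 else 0) - 3 / 8| ≤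
      2 / x := by
    set t := 1 / x with ht
    have e2 : 2 / x = 2 * t := by rw [ht]; ring
    have t0 : 0 < t := by positivity
    have t1 : t ≤ 1 := by rw [ht, div_le_one hx0]; exact hx
    rw [e2]
    split_ifs with h2
    · rw [abs_le]; constructor <;> nlinarith
    · have : 1 / 2 < t := by
        rw [ht]; exact one_div_lt_one_div_of_lt hx0 (by linarith)
      rw [abs_le]; constructor <;> nlinarith
  have hxw : 2 / x ≤ 2 / x ^ (1 / 4 : ℝ) := by
    gcongr
    calc x ^ (1 / 4 : ℝ) ≤ x ^ (1 : ℝ) := Real.rpow_le_rpow_of_exponent_le hx (by norm_num)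
      _ = x := Real.rpow_one x
  set S := ∑ d ∈ Icc 1 ⌊x⌋₊, (μ d : ℝ) / (d : ℝ) ^ 2 *
    ∑ m ∈ Icc 1 ⌊x / d⌋₊, (1 : ℝ) / m * (1 - m / (x / d)) ^ 2
  set T := (1 - 1 / x) ^ 2 / 2 - (if 2 ≤ x then (1 - 2 / x) ^ 2 / 8 else 0)
  have e2 : S / 2 + T - (densityLead * (Real.log x - 3 / 2) + densityConst) =
      (S - ((Real.log x + (γ - 3 / 2)) / zetaTwo - zetaDerivTwo / zetaTwo ^ 2)) / 2 +
      (T - 3 / 8) := by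
    have := zetaTwo_pos
    rw [densityLead, densityConst]
    field_simp
    ring
  rw [e2]
  refine (abs_add_le _ _).trans ?_
  rw [abs_div, abs_two, add_div C]
  have := abs_nonneg (S - ((Real.log x + (γ - 3 / 2)) / zetaTwo - zetaDerivTwo / zetaTwo ^ 2))
  linarith

lemma exists_abs_sum_lowerDensity_div_sub_le :
    ∃ C : ℝ, 0 ≤ C ∧ ∀ x : ℝ, 1 ≤ x →
      |∑ q ∈ Icc 1 ⌊x⌋₊, lowerDensity q / q - densityLead * Real.log x| ≤ C := by
  obtain ⟨C, hC, h⟩ := exists_abs_sum_upperDensity_div_sub_le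
  refine ⟨C + 2, by positivity, fun x hx => ?_⟩
  have h0 := h x hx
  have e := sum_correction hx (fun _ => 1)
  have e2 : ∑ q ∈ Icc 1 ⌊x⌋₊, lowerDensity q / q = ∑ q ∈ Icc 1 ⌊x⌋₊, upperDensity q / q -
      2 * ∑ q ∈ Icc 1 ⌊x⌋₊,
        ((if q = 1 then (1 : ℝ) / 2 else 0) - (if q = 2 then 1 / 4 else 0)) / q * 1 := by
    rw [Finset.mul_sum, ← Finset.sum_sub_distrib]
    refine Finset.sum_congr rfl fun q hq => ?_
    rw [upperDensity_eq (mem_Icc.1 hq).1, lowerDensity_eq (mem_Icc.1 hq).1]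
    ring
  rw [e2, e]
  have hc : |(1 / 2 - if 2 ≤ x then 1 / 8 else 0 : ℝ)| ≤ 1 := by
    split_ifs <;> norm_num [abs_le]
  rw [abs_le] at h0 hc ⊢
  constructor <;> linarith

end KernelSums

/-! ### Total lengths of the interval fibres -/

section Geometry

local notation "γ" => Real.eulerMascheroniConstant

lemma sq_posPart_sub_bounds {x q s t : ℝ} (hq : 0 < q) (hst : s ≤ t) :
    (t - s) * max (x - t * q) 0 ≤
      max (x - s * q) 0 ^ 2 / (2 * q) - max (x - t * q) 0 ^ 2 / (2 * q) ∧
    max (x - s * q) 0 ^ 2 / (2 * q) - max (x - t * q) 0 ^ 2 / (2 * q) ≤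
      (t - s) * max (x - s * q) 0 := by
  have hle : s * q ≤ t * q := by gcongr
  set u := max (x - s * q) 0 with hu
  set v := max (x - t * q) 0 with hv
  have hu0 : 0 ≤ u := le_max_right _ _
  have hv0 : 0 ≤ v := le_max_right _ _
  have hvu : v ≤ u := max_le_max (by linarith) le_rfl
  have hd : u - v ≤ (t - s) * q := by
    rcases le_total (x - s * q) 0 with h | h
    · have : u = 0 := max_eq_right h
      nlinarith
    · have : u = x - s * q := max_eq_left h
      have : x - t * q ≤ v := le_max_left _ _
      nlinarith
  have e : u ^ 2 / (2 * q) - v ^ 2 / (2 * q) = (u - v) * (u + v) / (2 * q) := by ring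
  rw [e, le_div_iff₀ (by positivity), div_le_iff₀ (by positivity)]
  constructor
  · rcases le_total (x - t * q) 0 with h | h
    · have : v = 0 := max_eq_right h
      rw [this]; nlinarith
    · have h1 : v = x - t * q := max_eq_left h
      have h2 : u = x - s * q := max_eq_left (by linarith)
      have h3 : u - v = (t - s) * q := by rw [h1, h2]; ring
      have h4 : 0 ≤ (t - s) * q := by linarith
      rw [h3]
      nlinarith
  · have h4 : 0 ≤ (t - s) * q := by nlinarith
    nlinarith

/-- Comparison of a sum of the decreasing function `n ↦ (x - n q)₊` with its integral, for `n`
beyond a real threshold `m`. -/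
lemma abs_sum_posPart_sub_le {x q m : ℝ} (hq : 0 < q) (hm : 0 ≤ m) {K : ℕ}
    (hK : x ≤ (K + 1) * q) :
    |∑ n ∈ Ioc ⌊m⌋₊ K, max (x - n * q) 0 - max (x - m * q) 0 ^ 2 / (2 * q)| ≤
      max (x - m * q) 0 := by
  set F : ℝ → ℝ := fun t => max (x - t * q) 0 ^ 2 / (2 * q) with hF
  have hF0 : ∀ t, 0 ≤ F t := fun t => by rw [hF]; positivity
  have hstep : ∀ s t : ℝ, s ≤ t → (t - s) * max (x - t * q) 0 ≤ F s - F t ∧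
      F s - F t ≤ (t - s) * max (x - s * q) 0 := fun s t h => sq_posPart_sub_bounds hq h
  set a := ⌊m⌋₊ with ha
  have ham : (a : ℝ) ≤ m := Nat.floor_le hm
  have hma : m < a + 1 := Nat.lt_floor_add_one m
  have hg0 : 0 ≤ max (x - m * q) 0 := le_max_right _ _
  have hFK : F (K + 1) = 0 := by
    have : max (x - ((K : ℝ) + 1) * q) 0 = 0 := max_eq_right (by linarith)
    simp [hF, this]
  have hup : ∀ b L : ℕ, b ≤ L → ∑ n ∈ Ioc b L, max (x - n * q) 0 ≤ F b - F L := by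
    intro b L hbL
    induction L, hbL using Nat.le_induction with
    | base => simp
    | succ L hL ih =>
      rw [Finset.sum_Ioc_succ_top hL]
      have := (hstep L (L + 1) (by linarith)).1
      push_cast
      linarith
  have hlow : ∀ b L : ℕ, b ≤ L → F (b + 1) - F (L + 1) ≤ ∑ n ∈ Ioc b L, max (x - n * q) 0 := by
    intro b L hbL
    induction L, hbL using Nat.le_induction with
    | base => simp
    | succ L hL ih =>
      rw [Finset.sum_Ioc_succ_top hL]
      have := (hstep (L + 1) (L + 1 + 1) (by linarith)).2
      push_cast
      linarith
  have hsum0 : 0 ≤ ∑ n ∈ Ioc a K, max (x - n * q) 0 := Finset.sum_nonneg fun _ _ => le_max_right _ _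
  have hdiff := hstep m (a + 1) hma.le
  have hdiff2 : F m - F (a + 1) ≤ max (x - m * q) 0 := by
    refine hdiff.2.trans ?_
    have : (a : ℝ) + 1 - m ≤ 1 := by linarith
    nlinarith
  have hdiff3 : 0 ≤ F m - F (a + 1) :=
    le_trans (mul_nonneg (by linarith) (le_max_right _ _)) hdiff.1
  change |_ - F m| ≤ _
  rcases lt_or_ge K a with h | h
  · have : x - m * q ≤ 0 := by
      have h1 : (K : ℝ) + 1 ≤ a := by exact_mod_cast h
      have : ((K : ℝ) + 1) * q ≤ m * q := by gcongr; linarith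
      linarith
    have h2 : F m = 0 := by simp [hF, max_eq_right this]
    rw [Finset.Ioc_eq_empty (by omega), Finset.sum_empty, h2]
    simp
  · have l1 := hlow a K h
    rw [hFK] at l1
    have u1 : ∑ n ∈ Ioc a K, max (x - n * q) 0 ≤ max (x - m * q) 0 + F m := by
      rcases h.eq_or_lt with h' | h'
      · rw [← h']; simp only [Finset.Ioc_self, Finset.sum_empty]
        have := hF0 m
        positivity
      · have e : Ioc a K = insert (a + 1) (Ioc (a + 1) K) := by
          ext n; simp only [mem_Ioc, mem_insert]; omega
        rw [e, Finset.sum_insert (by simp)]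
        have h2 := hup (a + 1) K h'
        have h3 : max (x - ((a + 1 : ℕ) : ℝ) * q) 0 ≤ max (x - m * q) 0 := by
          refine max_le_max ?_ le_rfl
          push_cast
          nlinarith
        have := hF0 K
        push_cast at h2 h3 ⊢
        linarith
    rw [abs_le]
    constructor <;> linarith

/-- Extending the range of a sum of positive parts `(Y - k)₊` does not change it. -/
lemma sum_posPart_eq_sum_floor {N s : ℝ} (hs : 0 < s) {K : ℕ} (hK : ⌊N / s⌋₊ ≤ K)
    (f : ℝ → ℕ → ℝ) (hf : ∀ k, f 0 k = 0) :
    ∑ k ∈ Icc 1 K, f (max (N - k * s) 0) k = ∑ k ∈ Icc 1 ⌊N / s⌋₊, f (N - k * s) k := by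
  rw [← Finset.sum_subset (Finset.Icc_subset_Icc_right hK)]
  · refine Finset.sum_congr rfl fun k hk => ?_
    rw [mem_Icc] at hk
    have h0 : k ≠ 0 := by omega
    have := (Nat.le_floor_iff' h0).1 hk.2
    rw [le_div_iff₀ hs] at this
    rw [max_eq_left (by linarith)]
  · intro k hk hk'
    rw [mem_Icc] at hk hk'
    have h0 : k ≠ 0 := by omega
    have : ¬ (k : ℝ) ≤ N / s := fun h => hk' ⟨hk.1, (Nat.le_floor_iff' h0).2 h⟩
    rw [le_div_iff₀ hs] at this
    rw [max_eq_right (by linarith), hf]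

lemma sum_sq_posPart_div {N s : ℝ} (hs : 0 < s) {K : ℕ} (hK : ⌊N / s⌋₊ ≤ K) :
    ∑ k ∈ Icc 1 K, max (N - k * s) 0 ^ 2 / k = s ^ 2 * quadKernel (N / s) := by
  rw [sum_posPart_eq_sum_floor hs hK (fun y k => y ^ 2 / k) (fun k => by simp), quadKernel,
    Finset.mul_sum]
  refine Finset.sum_congr rfl fun k _ => ?_
  field_simp

lemma sum_posPart_div_le {N s : ℝ} (hN : 0 ≤ N) (hs : 0 < s) {K : ℕ} (hK : ⌊N / s⌋₊ ≤ K) :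
    ∑ k ∈ Icc 1 K, max (N - k * s) 0 / k ≤ 2 * N * √(N / s) := by
  rw [sum_posPart_eq_sum_floor hs hK (fun y k => y / k) (fun k => by simp)]
  rcases lt_or_ge (N / s) 1 with h | h
  · rw [Nat.floor_eq_zero.2 h]
    simp only [Finset.Icc_eq_empty_of_lt (show (0:ℕ) < 1 by norm_num), Finset.sum_empty]
    positivity
  · calc _ ≤ ∑ k ∈ Icc 1 ⌊N / s⌋₊, N * (1 / (k : ℝ)) := by
          refine Finset.sum_le_sum fun k _ => ?_
          rw [mul_one_div]
          gcongr
          have : 0 ≤ (k : ℝ) * s := by positivity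
          linarith
      _ ≤ N * (2 * √(N / s)) := by
          rw [← Finset.mul_sum]
          gcongr
          exact sum_inv_le h
      _ = _ := by ring

/-- The pairs `(n, k)` with `1 ≤ k < n ≤ K`. -/
def coeffPairs (K : ℕ) : Finset (ℕ × ℕ) := {w ∈ Icc 1 K ×ˢ Icc 1 K | w.2 < w.1}

lemma sum_coeffPairs_snd (K : ℕ) (f : ℕ → ℕ → ℝ) :
    ∑ w ∈ coeffPairs K, f w.1 w.2 = ∑ k ∈ Icc 1 K, ∑ n ∈ Ioc k K, f n k := by
  rw [coeffPairs, Finset.sum_filter, Finset.sum_product_right]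
  refine Finset.sum_congr rfl fun k hk => ?_
  rw [← Finset.sum_filter]
  refine Finset.sum_congr ?_ fun _ _ => rfl
  ext n
  simp only [Finset.mem_filter, mem_Icc, mem_Ioc] at hk ⊢
  omega

lemma sum_coeffPairs_fst (K : ℕ) (f : ℕ → ℕ → ℝ) :
    ∑ w ∈ coeffPairs K, f w.1 w.2 = ∑ n ∈ Icc 1 K, ∑ k ∈ Ico 1 n, f n k := by
  rw [coeffPairs, Finset.sum_filter, Finset.sum_product]
  refine Finset.sum_congr rfl fun n hn => ?_
  rw [← Finset.sum_filter]
  refine Finset.sum_congr ?_ fun _ _ => rfl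
  ext k
  simp only [Finset.mem_filter, mem_Icc, mem_Ico] at hn ⊢
  omega

/-- The total length of the intervals `(c, (N - n q) / k]` over the pairs with `n > t`. The sum over
`n > max k t` is replaced by its integral for each `k`. -/
lemma abs_sum_length_sub_le {N q c t : ℝ} (hq : 1 ≤ q) (hc : 0 ≤ c) :
    |∑ w ∈ coeffPairs ⌊N⌋₊, (if t < w.1 then max ((N - w.1 * q) / w.2 - c) 0 else 0) -
      1 / (2 * q) * ∑ k ∈ Icc 1 ⌊N⌋₊, max (N - k * c - max (k : ℝ) t * q) 0 ^ 2 / k| ≤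
      ∑ k ∈ Icc 1 ⌊N⌋₊, max (N - k * c - max (k : ℝ) t * q) 0 / k := by
  set K := ⌊N⌋₊ with hK
  have hNK : N < K + 1 := Nat.lt_floor_add_one N
  rw [sum_coeffPairs_snd K (fun n k => if t < n then max ((N - n * q) / k - c) 0 else 0),
    Finset.mul_sum, ← Finset.sum_sub_distrib]
  refine (Finset.abs_sum_le_sum_abs _ _).trans (Finset.sum_le_sum fun k hk => ?_)
  have hk1 : 1 ≤ k := (mem_Icc.1 hk).1
  have hk0 : (0 : ℝ) < k := by exact_mod_cast hk1
  have hm0 : 0 ≤ max (k : ℝ) t := le_trans hk0.le (le_max_left _ _)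
  have hset : (filter (fun n : ℕ => t < n) (Ioc k K)) = Ioc ⌊max (k : ℝ) t⌋₊ K := by
    ext n
    simp only [Finset.mem_filter, mem_Ioc]
    rw [Nat.floor_lt hm0, max_lt_iff, Nat.cast_lt]
    tauto
  have e : ∑ n ∈ Ioc k K, (if t < (n : ℝ) then max ((N - n * q) / k - c) 0 else 0) =
      1 / k * ∑ n ∈ Ioc ⌊max (k : ℝ) t⌋₊ K, max ((N - k * c) - n * q) 0 := by
    rw [← Finset.sum_filter, hset, Finset.mul_sum]
    refine Finset.sum_congr rfl fun n _ => ?_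
    rw [mul_max_of_nonneg _ _ (by positivity : (0 : ℝ) ≤ 1 / k), mul_zero]
    congr 1
    field_simp
    ring
  have h := abs_sum_posPart_sub_le (x := N - k * c) (q := q) (m := max (k : ℝ) t) (K := K)
    (by linarith) hm0 (by
      have : 0 ≤ (k : ℝ) * c := by positivity
      nlinarith)
  rw [e]
  set S := ∑ n ∈ Ioc ⌊max (k : ℝ) t⌋₊ K, max ((N - k * c) - n * q) 0
  set g := max (N - k * c - max (k : ℝ) t * q) 0
  have e2 : 1 / k * S - 1 / (2 * q) * (g ^ 2 / k) = (S - g ^ 2 / (2 * q)) / k := by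
    field_simp
  rw [e2, abs_div, abs_of_pos hk0]
  gcongr

lemma floor_div_le_floor {N s : ℝ} (hN : 0 ≤ N) (hs : 1 ≤ s) : ⌊N / s⌋₊ ≤ ⌊N⌋₊ :=
  Nat.floor_le_floor (div_le_self hN hs)

/-- Total length of the intervals `(c, (N - n q) / k]`. -/
lemma abs_sum_length_sub_quadKernel_le {N q c : ℝ} (hN : 0 ≤ N) (hq : 1 ≤ q) (hc : 0 ≤ c) :
    |∑ w ∈ coeffPairs ⌊N⌋₊, max ((N - w.1 * q) / w.2 - c) 0 -
      (q + c) ^ 2 / (2 * q) * quadKernel (N / (q + c))| ≤ 2 * N * √(N / q) := by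
  have h := abs_sum_length_sub_le (N := N) (t := 0) hq hc
  have hs : 0 < q + c := by linarith
  have hfl := floor_div_le_floor hN (s := q + c) (by linarith)
  have e1 : ∀ k ∈ Icc 1 ⌊N⌋₊, max (N - k * c - max (k : ℝ) 0 * q) 0 = max (N - k * (q + c)) 0 := by
    intro k _
    rw [max_eq_left (by positivity : (0 : ℝ) ≤ k)]
    congr 1
    ring
  have s1 : ∑ k ∈ Icc 1 ⌊N⌋₊, max (N - k * c - max (k : ℝ) 0 * q) 0 ^ 2 / k =
      ∑ k ∈ Icc 1 ⌊N⌋₊, max (N - k * (q + c)) 0 ^ 2 / (k : ℝ) :=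
    Finset.sum_congr rfl fun k hk => by rw [e1 k hk]
  have s2 : ∑ k ∈ Icc 1 ⌊N⌋₊, max (N - k * c - max (k : ℝ) 0 * q) 0 / k =
      ∑ k ∈ Icc 1 ⌊N⌋₊, max (N - k * (q + c)) 0 / (k : ℝ) :=
    Finset.sum_congr rfl fun k hk => by rw [e1 k hk]
  rw [s1, s2, sum_sq_posPart_div hs hfl] at h
  have e2 : ∑ w ∈ coeffPairs ⌊N⌋₊, (if (0 : ℝ) < w.1 then max ((N - w.1 * q) / w.2 - c) 0 else 0) =
      ∑ w ∈ coeffPairs ⌊N⌋₊, max ((N - w.1 * q) / w.2 - c) 0 := by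
    refine Finset.sum_congr rfl fun w hw => ?_
    rw [if_pos]
    simp only [coeffPairs, Finset.mem_filter, Finset.mem_product, mem_Icc] at hw
    exact_mod_cast hw.1.1.1
  rw [e2] at h
  have e3 : 1 / (2 * q) * ((q + c) ^ 2 * quadKernel (N / (q + c))) =
      (q + c) ^ 2 / (2 * q) * quadKernel (N / (q + c)) := by ring
  rw [e3] at h
  refine h.trans ((sum_posPart_div_le hN hs hfl).trans ?_)
  gcongr
  linarith

lemma abs_sum_length_sub_log_le {N q c : ℝ} (hN : 0 < N) (hq : 1 ≤ q) (hc : 0 ≤ c) :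
    |∑ w ∈ coeffPairs ⌊N⌋₊, max ((N - w.1 * q) / w.2 - c) 0 -
      N ^ 2 / (2 * q) * (Real.log (N / (q + c)) + γ - 3 / 2)| ≤
      2 * N * √(N / q) + 5 / 2 * N * ((q + c) / q) := by
  have h := abs_sum_length_sub_quadKernel_le hN.le hq hc
  have hs : 0 < q + c := by linarith
  have h2 := abs_quadKernel_sub_le (Y := N / (q + c)) (by positivity)
  set S := ∑ w ∈ coeffPairs ⌊N⌋₊, max ((N - w.1 * q) / w.2 - c) 0
  set Φ := quadKernel (N / (q + c))
  set L := Real.log (N / (q + c))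
  have e : S - N ^ 2 / (2 * q) * (L + γ - 3 / 2) = (S - (q + c) ^ 2 / (2 * q) * Φ) +
      (q + c) ^ 2 / (2 * q) * (Φ - (N / (q + c)) ^ 2 * (L + γ - 3 / 2)) := by
    field_simp
    ring
  rw [e]
  refine (abs_add_le _ _).trans (add_le_add h ?_)
  rw [abs_mul, abs_of_nonneg (by positivity)]
  calc _ ≤ (q + c) ^ 2 / (2 * q) * (5 * (N / (q + c))) := by gcongr
    _ = _ := by field_simp

/-- Total length of the intervals `(p, (N - k p) / n]`. -/
lemma abs_sum_length_fst_sub_le {N p : ℝ} (hN : 0 < N) (hp : 1 ≤ p) (hpN : p ≤ N) :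
    |∑ w ∈ coeffPairs ⌊N⌋₊, max ((N - w.2 * p) / w.1 - p) 0 -
      N ^ 2 / (2 * p) * Real.log 2| ≤ 14 * N * √(N / p) := by
  set K := ⌊N⌋₊ with hK
  have hp0 : 0 < p := by linarith
  have hNK : N < K + 1 := Nat.lt_floor_add_one N
  have hfl1 : ⌊N / p⌋₊ ≤ K := floor_div_le_floor hN.le hp
  have hfl2 : ⌊N / (2 * p)⌋₊ ≤ K := floor_div_le_floor hN.le (by linarith)
  have hmain : |∑ w ∈ coeffPairs K, max ((N - w.2 * p) / w.1 - p) 0 -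
      (1 / (2 * p) * ∑ n ∈ Icc 1 K, max (N - n * p) 0 ^ 2 / n -
        1 / (2 * p) * ∑ n ∈ Icc 1 K, max (N - n * (2 * p)) 0 ^ 2 / n)| ≤
      ∑ n ∈ Icc 1 K, 3 * (max (N - n * p) 0 / n) := by
    rw [sum_coeffPairs_fst K (fun n k => max ((N - k * p) / n - p) 0), Finset.mul_sum,
      Finset.mul_sum, ← Finset.sum_sub_distrib, ← Finset.sum_sub_distrib]
    refine (Finset.abs_sum_le_sum_abs _ _).trans (Finset.sum_le_sum fun n hn => ?_)
    rw [mem_Icc] at hn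
    have hn0 : (0 : ℝ) < n := by exact_mod_cast hn.1
    have e : ∑ k ∈ Ico 1 n, max ((N - k * p) / n - p) 0 =
        1 / n * ∑ k ∈ Ico 1 n, max ((N - n * p) - k * p) 0 := by
      rw [Finset.mul_sum]
      refine Finset.sum_congr rfl fun k _ => ?_
      rw [mul_max_of_nonneg _ _ (by positivity : (0 : ℝ) ≤ 1 / n), mul_zero]
      congr 1
      field_simp
      ring
    have hnp : 0 ≤ (n : ℝ) * p := by positivity
    have hKp : N - n * p ≤ (K + 1) * p := by nlinarith
    have h0 := abs_sum_posPart_sub_le (x := N - n * p) (m := 0) hp0 le_rfl hKp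
    have h1 := abs_sum_posPart_sub_le (x := N - n * p) (m := n) hp0 hn0.le hKp
    rw [Nat.floor_zero, zero_mul, sub_zero] at h0
    rw [Nat.floor_natCast] at h1
    have e2 : N - n * p - n * p = N - n * (2 * p) := by ring
    rw [e2] at h1
    -- The range `1 ≤ k < n` is `(0, K]` without `n` and `(n, K]`.
    have hsplit : ∑ k ∈ Ioc 0 K, max ((N - n * p) - k * p) 0 =
        ∑ k ∈ Ico 1 n, max ((N - n * p) - k * p) 0 + max (N - n * (2 * p)) 0 +
          ∑ k ∈ Ioc n K, max ((N - n * p) - k * p) 0 := by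
      have e3 : Ioc 0 K = Ico 1 n ∪ ({n} ∪ Ioc n K) := by
        ext k; simp only [mem_Ioc, mem_union, mem_Ico, mem_singleton]; omega
      rw [e3, Finset.sum_union, Finset.sum_union, Finset.sum_singleton, e2, add_assoc]
      · rw [Finset.disjoint_left]; intro k; simp only [mem_Ioc, mem_singleton]; omega
      · rw [Finset.disjoint_left]; intro k
        simp only [mem_Ico, mem_union, mem_Ioc, mem_singleton]; omega
    have hle : max (N - n * (2 * p)) 0 ≤ max (N - n * p) 0 :=
      max_le_max (by linarith) le_rfl
    have hge : 0 ≤ max (N - n * (2 * p)) 0 := le_max_right _ _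
    rw [e]
    set A := ∑ k ∈ Ico 1 n, max ((N - n * p) - k * p) 0
    set B := ∑ k ∈ Ioc 0 K, max ((N - n * p) - k * p) 0
    set D := ∑ k ∈ Ioc n K, max ((N - n * p) - k * p) 0
    set g0 := max (N - n * p) 0
    set g1 := max (N - n * (2 * p)) 0
    have e4 : 1 / n * A - (1 / (2 * p) * (g0 ^ 2 / n) - 1 / (2 * p) * (g1 ^ 2 / n)) =
        ((B - g0 ^ 2 / (2 * p)) - (D - g1 ^ 2 / (2 * p)) - g1) / n := by
      rw [hsplit]
      field_simp
      ring
    rw [e4, abs_div, abs_of_pos hn0, ← mul_div_assoc]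
    gcongr
    rw [abs_le] at h0 h1 ⊢
    constructor <;> linarith
  rw [← Finset.mul_sum, sum_sq_posPart_div hp0 hfl1, sum_sq_posPart_div (by linarith) hfl2] at hmain
  have herr := sum_posPart_div_le hN.le hp0 hfl1
  have k1 := abs_quadKernel_sub_le (Y := N / p) (by positivity)
  have k2 := abs_quadKernel_sub_le (Y := N / (2 * p)) (by positivity)
  have hlog : Real.log (N / (2 * p)) = Real.log (N / p) - Real.log 2 := by
    rw [← Real.log_div (by positivity) (by norm_num)]
    congr 1
    field_simp
  have hsq : 1 ≤ √(N / p) := Real.one_le_sqrt.2 ((one_le_div hp0).2 hpN)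
  set S := ∑ w ∈ coeffPairs K, max ((N - w.2 * p) / w.1 - p) 0
  set Φ1 := quadKernel (N / p)
  set Φ2 := quadKernel (N / (2 * p))
  rw [hlog] at k2
  set L := Real.log (N / p)
  have k1' : |p / 2 * (Φ1 - (N / p) ^ 2 * (L + γ - 3 / 2))| ≤ 5 / 2 * N := by
    rw [abs_mul, abs_of_pos (by positivity)]
    calc _ ≤ p / 2 * (5 * (N / p)) := by gcongr
      _ = _ := by field_simp
  have k2' : |2 * p * (Φ2 - (N / (2 * p)) ^ 2 * (L - Real.log 2 + γ - 3 / 2))| ≤ 5 * N := by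
    rw [abs_mul, abs_of_pos (by positivity)]
    calc _ ≤ 2 * p * (5 * (N / (2 * p))) := by gcongr
      _ = _ := by field_simp
  have e : S - N ^ 2 / (2 * p) * Real.log 2 =
      (S - (1 / (2 * p) * (p ^ 2 * Φ1) - 1 / (2 * p) * ((2 * p) ^ 2 * Φ2))) +
      p / 2 * (Φ1 - (N / p) ^ 2 * (L + γ - 3 / 2)) -
      2 * p * (Φ2 - (N / (2 * p)) ^ 2 * (L - Real.log 2 + γ - 3 / 2)) := by
    field_simp
    ring
  rw [e]
  refine (abs_sub _ _).trans ((add_le_add (abs_add_le _ _) le_rfl).trans ?_)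
  have hNs : N ≤ N * √(N / p) := le_mul_of_one_le_right hN.le hsq
  nlinarith

/-- Total length of the intervals `(U, (U² - n q) / k]` over the pairs with `n > U`. -/
lemma abs_sum_length_large_sub_le {U q : ℝ} (hq : 1 ≤ q) (hqU : q ≤ U) :
    |∑ w ∈ coeffPairs ⌊U ^ 2⌋₊, (if U < w.1 then max ((U ^ 2 - w.1 * q) / w.2 - U) 0 else 0) -
      (U ^ 2) ^ 2 / (2 * q) * (1 - q / U) ^ 2 * (Real.log U + γ - 3 / 2)| ≤
      2 * U ^ 2 * √(U ^ 2 / q) + 5 / 2 * U ^ 2 * (U / q) + U ^ 2 * U := by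
  have hU : 1 ≤ U := hq.trans hqU
  have hU0 : 0 < U := by linarith
  have h := abs_sum_length_sub_le (N := U ^ 2) (c := U) (t := U) hq hU0.le
  have hfl : ⌊(U - q) / 1⌋₊ ≤ ⌊U ^ 2⌋₊ := by
    rw [div_one]
    exact Nat.floor_le_floor (by nlinarith)
  have e1 : ∀ k ∈ Icc 1 ⌊U ^ 2⌋₊, max (U ^ 2 - k * U - max (k : ℝ) U * q) 0 =
      U * max ((U - q) - k * 1) 0 := by
    intro k hk
    rw [mul_max_of_nonneg _ _ hU0.le, mul_zero]
    -- For `k ≥ U` both sides vanish.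
    rcases le_total (k : ℝ) U with hkU | hkU
    · rw [max_eq_right hkU]
      congr 1
      ring
    · rw [max_eq_left hkU, max_eq_right, max_eq_right]
      · nlinarith
      · have : 0 ≤ (k : ℝ) * q := by positivity
        nlinarith
  have s1 : ∑ k ∈ Icc 1 ⌊U ^ 2⌋₊, max (U ^ 2 - k * U - max (k : ℝ) U * q) 0 ^ 2 / k =
      U ^ 2 * ∑ k ∈ Icc 1 ⌊U ^ 2⌋₊, max ((U - q) - k * 1) 0 ^ 2 / (k : ℝ) := by
    rw [Finset.mul_sum]
    exact Finset.sum_congr rfl fun k hk => by rw [e1 k hk]; ring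
  have s2 : ∑ k ∈ Icc 1 ⌊U ^ 2⌋₊, max (U ^ 2 - k * U - max (k : ℝ) U * q) 0 / k =
      U * ∑ k ∈ Icc 1 ⌊U ^ 2⌋₊, max ((U - q) - k * 1) 0 / (k : ℝ) := by
    rw [Finset.mul_sum]
    exact Finset.sum_congr rfl fun k hk => by rw [e1 k hk]; ring
  rw [s1, s2, sum_sq_posPart_div one_pos hfl] at h
  have herr := sum_posPart_div_le (N := U - q) (by linarith) one_pos hfl
  rw [div_one] at h herr
  set S := ∑ w ∈ coeffPairs ⌊U ^ 2⌋₊, (if U < w.1 then max ((U ^ 2 - w.1 * q) / w.2 - U) 0 else 0)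
  set E := ∑ k ∈ Icc 1 ⌊U ^ 2⌋₊, max ((U - q) - k * 1) 0 / (k : ℝ)
  set Φ := quadKernel (U - q)
  have herr2 : U * E ≤ 2 * U ^ 2 * √(U ^ 2 / q) := by
    have a1 : U - q ≤ U := by linarith
    have a2 : U - q ≤ U ^ 2 / q := by
      rw [le_div_iff₀ (by linarith)]
      nlinarith
    calc U * E ≤ U * (2 * (U - q) * √(U - q)) := by gcongr
      _ ≤ U * (2 * U * √(U ^ 2 / q)) := by gcongr
      _ = _ := by ring
  have hmain : |U ^ 2 / (2 * q) * (Φ - (U - q) ^ 2 * (Real.log U + γ - 3 / 2))| ≤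
      5 / 2 * U ^ 2 * (U / q) + U ^ 2 * U := by
    have hq0 : 0 < q := by linarith
    -- The kernel at `U - q` involves `log (U - q)`; passing to `log U` costs at most `q U`.
    have hb : |Φ - (U - q) ^ 2 * (Real.log U + γ - 3 / 2)| ≤ 5 * U + q * U := by
      rcases hqU.eq_or_lt with h' | h'
      · have : Φ = 0 := by simp [Φ, quadKernel, h']
        rw [this, h']
        simp only [sub_self, ne_eq, OfNat.ofNat_ne_zero, not_false_eq_true, zero_pow, zero_mul,
          abs_zero]
        positivity
      · have hd : 0 < U - q := by linarith
        have k := abs_quadKernel_sub_le hd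
        have hl : Real.log U - Real.log (U - q) ≤ q / (U - q) := by
          rw [← Real.log_div hU0.ne' hd.ne']
          refine (Real.log_le_sub_one_of_pos (by positivity)).trans (le_of_eq ?_)
          field_simp
          ring
        have hl0 : 0 ≤ Real.log U - Real.log (U - q) :=
          sub_nonneg.2 (Real.log_le_log hd (by linarith))
        have hc : (U - q) ^ 2 * (Real.log U - Real.log (U - q)) ≤ q * U := by
          calc _ ≤ (U - q) ^ 2 * (q / (U - q)) := by gcongr
            _ = q * (U - q) := by field_simp
            _ ≤ _ := by gcongr; linarith
        have hc0 : 0 ≤ (U - q) ^ 2 * (Real.log U - Real.log (U - q)) := by positivity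
        have hk : |quadKernel (U - q) - (U - q) ^ 2 * (Real.log (U - q) + γ - 3 / 2)| ≤
            5 * (U - q) := k
        rw [abs_le] at hk ⊢
        constructor <;> nlinarith
    rw [abs_mul, abs_of_nonneg (by positivity)]
    calc _ ≤ U ^ 2 / (2 * q) * (5 * U + q * U) := by gcongr
      _ = 5 / 2 * U ^ 2 * (U / q) + U ^ 2 * U / 2 := by field_simp
      _ ≤ _ := by
          have : 0 ≤ U ^ 2 * U := by positivity
          linarith
  have e : S - (U ^ 2) ^ 2 / (2 * q) * (1 - q / U) ^ 2 * (Real.log U + γ - 3 / 2) =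
      (S - 1 / (2 * q) * (U ^ 2 * (1 ^ 2 * Φ))) +
      U ^ 2 / (2 * q) * (Φ - (U - q) ^ 2 * (Real.log U + γ - 3 / 2)) := by
    have : q ≠ 0 := by linarith
    field_simp
    ring
  rw [e]
  refine (abs_add_le _ _).trans ?_
  have := h.trans herr2
  linarith

end Geometry

/-! ### Counting along fibres -/

section Counting

lemma isSystemSolution_iff {Q : ℝ} {p q n k : ℕ} :
    IsSystemSolution Q p q n k ↔ 1 ≤ p ∧ 1 ≤ q ∧ LowerInv p q ∧ (n : ℝ) * q + (k : ℝ) * p ≤ Q ∧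
      1 ≤ k ∧ k < n := by
  have hiff : ((modInv p q : ℝ) ≤ (p : ℝ) / 2) ↔ 2 * modInv p q ≤ p := by
    rw [le_div_iff₀ (by norm_num)]
    constructor
    · intro h
      have : ((2 * modInv p q : ℕ) : ℝ) ≤ p := by push_cast; linarith
      exact_mod_cast this
    · intro h
      have : ((2 * modInv p q : ℕ) : ℝ) ≤ p := by exact_mod_cast h
      push_cast at this
      linarith
  constructor
  · rintro ⟨h1, h2, h3, h4, h5, h6, h7, h8⟩
    exact ⟨h2, h3, ⟨h1, hiff.1 h4⟩, h6, h7, h8⟩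
  · rintro ⟨h2, h3, ⟨h1, h4⟩, h6, h7, h8⟩
    refine ⟨h1, h2, h3, hiff.2 h4, ?_, h6, h7, h8⟩
    have := Nat.mul_pos (show 0 < n by omega) h3
    have := Nat.mul_pos h7 h2
    omega

lemma le_floor_of_solution {N : ℝ} {p q n k : ℕ} (hp : 1 ≤ p) (hq : 1 ≤ q) (hk : 1 ≤ k)
    (hkn : k < n) (h : (n : ℝ) * q + (k : ℝ) * p ≤ N) :
    p ≤ ⌊N⌋₊ ∧ q ≤ ⌊N⌋₊ ∧ n ≤ ⌊N⌋₊ ∧ k ≤ ⌊N⌋₊ := by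
  have hQ : n * q + k * p ≤ ⌊N⌋₊ := by
    apply Nat.le_floor
    push_cast
    exact h
  have h1 : n ≤ n * q := Nat.le_mul_of_pos_right n hq
  have h2 : q ≤ n * q := Nat.le_mul_of_pos_left q (by omega)
  have h3 : p ≤ k * p := Nat.le_mul_of_pos_left p hk
  have h4 : k ≤ k * p := Nat.le_mul_of_pos_right k hp
  omega

lemma mem_coeffPairs {K : ℕ} {w : ℕ × ℕ} :
    w ∈ coeffPairs K ↔ 1 ≤ w.2 ∧ w.2 < w.1 ∧ w.1 ≤ K := by
  simp only [coeffPairs, Finset.mem_filter, mem_product, mem_Icc]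
  omega

open Classical in
lemma ncard_solutionSet_eq_sum_fst (U : ℝ) (P : ℕ → ℕ → ℕ → ℕ → Prop) :
    (solutionSet U P).ncard = ∑ p ∈ Icc 1 ⌊U ^ 2⌋₊, ∑ w ∈ coeffPairs ⌊U ^ 2⌋₊,
      #{q ∈ Icc 1 ⌊U ^ 2⌋₊ | LowerInv p q ∧ (w.1 : ℝ) * q + (w.2 : ℝ) * p ≤ U ^ 2 ∧
        P p q w.1 w.2} := by
  set K := ⌊U ^ 2⌋₊
  set T : Finset (ℕ × (ℕ × ℕ) × ℕ) := {y ∈ Icc 1 K ×ˢ coeffPairs K ×ˢ Icc 1 K |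
    LowerInv y.1 y.2.2 ∧ (y.2.1.1 : ℝ) * y.2.2 + (y.2.1.2 : ℝ) * y.1 ≤ U ^ 2 ∧
      P y.1 y.2.2 y.2.1.1 y.2.1.2} with hT
  have himg : solutionSet U P = (fun y : ℕ × (ℕ × ℕ) × ℕ => (y.1, y.2.2, y.2.1.1, y.2.1.2)) ''
      (T : Set (ℕ × (ℕ × ℕ) × ℕ)) := by
    ext ⟨p, q, n, k⟩
    simp only [solutionSet, Set.mem_ofPred_eq, isSystemSolution_iff, Set.mem_image, hT,
      Finset.coe_filter, mem_product, mem_coeffPairs, mem_Icc]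
    constructor
    · rintro ⟨⟨h1, h2, h3, h4, h5, h6⟩, h7⟩
      obtain ⟨b1, b2, b3, b4⟩ := le_floor_of_solution h1 h2 h5 h6 h4
      exact ⟨(p, (n, k), q), ⟨⟨⟨h1, b1⟩, ⟨h5, h6, b3⟩, h2, b2⟩, h3, h4, h7⟩, rfl⟩
    · rintro ⟨⟨p', ⟨n', k'⟩, q'⟩, ⟨⟨a1, a2, a3⟩, a4, a5, a6⟩, h⟩
      simp only [Prod.mk.injEq] at h
      obtain ⟨rfl, rfl, rfl, rfl⟩ := h
      exact ⟨⟨a1.1, a3.1, a4, a5, a2.1, a2.2.1⟩, a6⟩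
  have hinj : Function.Injective
      (fun y : ℕ × (ℕ × ℕ) × ℕ => (y.1, y.2.2, y.2.1.1, y.2.1.2)) := by
    rintro ⟨p, ⟨n, k⟩, q⟩ ⟨p', ⟨n', k'⟩, q'⟩ h
    simp only [Prod.mk.injEq] at h
    obtain ⟨rfl, rfl, rfl, rfl⟩ := h
    rfl
  rw [himg, Set.ncard_image_of_injective _ hinj, Set.ncard_coe_finset, hT, Finset.card_filter,
    Finset.sum_product]
  refine Finset.sum_congr rfl fun p _ => ?_
  rw [Finset.sum_product]
  exact Finset.sum_congr rfl fun w _ => by rw [Finset.card_filter]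

open Classical in
lemma ncard_solutionSet_eq_sum_snd (U : ℝ) (P : ℕ → ℕ → ℕ → ℕ → Prop) :
    (solutionSet U P).ncard = ∑ q ∈ Icc 1 ⌊U ^ 2⌋₊, ∑ w ∈ coeffPairs ⌊U ^ 2⌋₊,
      #{p ∈ Icc 1 ⌊U ^ 2⌋₊ | LowerInv p q ∧ (w.1 : ℝ) * q + (w.2 : ℝ) * p ≤ U ^ 2 ∧
        P p q w.1 w.2} := by
  rw [ncard_solutionSet_eq_sum_fst]
  simp only [Finset.card_filter]
  rw [Finset.sum_comm' (t' := coeffPairs ⌊U ^ 2⌋₊) (s' := fun _ => Icc 1 ⌊U ^ 2⌋₊) (by tauto),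
    Finset.sum_comm' (s := Icc 1 ⌊U ^ 2⌋₊) (t := fun _ => coeffPairs ⌊U ^ 2⌋₊)
      (t' := coeffPairs ⌊U ^ 2⌋₊) (s' := fun _ => Icc 1 ⌊U ^ 2⌋₊) (by tauto)]
  exact Finset.sum_congr rfl fun w _ => Finset.sum_comm

lemma ncard_solutionSet_of_disjoint {U : ℝ} {P Q R : ℕ → ℕ → ℕ → ℕ → Prop}
    (h : ∀ p q n k, R p q n k ↔ P p q n k ∨ Q p q n k)
    (hd : ∀ p q n k, P p q n k → ¬ Q p q n k) :
    (solutionSet U R).ncard = (solutionSet U P).ncard + (solutionSet U Q).ncard := by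
  rw [← Set.ncard_union_eq ?_ (solutionSet_finite U P) (solutionSet_finite U Q)]
  · congr 1
    ext ⟨p, q, n, k⟩
    simp only [solutionSet, Set.mem_ofPred_eq, Set.mem_union, h]
    tauto
  · rw [Set.disjoint_left]
    rintro ⟨p, q, n, k⟩ ⟨-, h1⟩ ⟨-, h2⟩
    exact hd p q n k h1 h2

open Classical in
lemma abs_card_interval_sub_le {R : ℕ → Prop} {δ D : ℝ} (hδ0 : 0 ≤ δ) (hδ1 : δ ≤ 1)
    (h : ∀ X : ℕ, |(#{l ∈ Icc 1 X | R l} : ℝ) - δ * X| ≤ D) {α β : ℝ} (hα : 0 ≤ α) {K : ℕ}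
    (hK : ⌊β⌋₊ ≤ K) :
    |(#(filter (fun l : ℕ => α < (l : ℝ) ∧ (l : ℝ) ≤ β ∧ R l) (Icc 1 K)) : ℝ) -
      δ * max (β - α) 0| ≤ 2 * D + 2 := by
  have hD : 0 ≤ D := (abs_nonneg _).trans (h 0)
  rcases le_or_gt β α with hab | hab
  · have he : (filter (fun l : ℕ => α < (l : ℝ) ∧ (l : ℝ) ≤ β ∧ R l) (Icc 1 K)) = ∅ := by
      rw [Finset.filter_eq_empty_iff]
      rintro l - ⟨h1, h2, -⟩
      linarith
    rw [he, max_eq_right (by linarith)]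
    simp
    positivity
  · have hβ : 0 ≤ β := by linarith
    have hsplit : #{l ∈ Icc 1 ⌊β⌋₊ | R l} = #{l ∈ Icc 1 ⌊α⌋₊ | R l} +
        #(filter (fun l : ℕ => α < (l : ℝ) ∧ (l : ℝ) ≤ β ∧ R l) (Icc 1 K)) := by
      rw [← Finset.card_union_of_disjoint]
      · congr 1
        ext l
        simp only [Finset.mem_filter, mem_union, mem_Icc, Nat.le_floor_iff hα, Nat.le_floor_iff hβ]
        constructor
        · rintro ⟨⟨h1, h2⟩, h3⟩
          rcases le_or_gt (l : ℝ) α with h4 | h4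
          · exact Or.inl ⟨⟨h1, h4⟩, h3⟩
          · exact Or.inr ⟨⟨h1, (Nat.le_floor h2).trans hK⟩, h4, h2, h3⟩
        · rintro (⟨⟨h1, h2⟩, h3⟩ | ⟨⟨h1, -⟩, h2, h3, h4⟩)
          · exact ⟨⟨h1, by linarith⟩, h3⟩
          · exact ⟨⟨h1, h3⟩, h4⟩
      · rw [Finset.disjoint_left]
        intro l h1 h2
        simp only [Finset.mem_filter, mem_Icc, Nat.le_floor_iff hα] at h1 h2
        linarith [h1.1.2, h2.2.1]
    have hb := h ⌊β⌋₊
    have ha := h ⌊α⌋₊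
    rw [hsplit] at hb
    push_cast at hb
    have f1 := Nat.floor_le hα
    have f2 := Nat.lt_floor_add_one α
    have f3 := Nat.floor_le hβ
    have f4 := Nat.lt_floor_add_one β
    have g1 : 0 ≤ δ * (α - ⌊α⌋₊) := mul_nonneg hδ0 (by linarith)
    have g2 : δ * (α - ⌊α⌋₊) ≤ 1 := by nlinarith
    have g3 : 0 ≤ δ * (β - ⌊β⌋₊) := mul_nonneg hδ0 (by linarith)
    have g4 : δ * (β - ⌊β⌋₊) ≤ 1 := by nlinarith
    rw [max_eq_left (by linarith)]
    rw [abs_le] at ha hb ⊢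
    constructor <;> nlinarith

lemma card_coeffPairs_filter_le {N s : ℝ} (hN : 0 ≤ N) (hs : 0 < s) (K : ℕ) :
    (#{w ∈ coeffPairs K | (w.1 : ℝ) * s ≤ N} : ℝ) ≤ (N / s) ^ 2 := by
  have h1 : #{w ∈ coeffPairs K | (w.1 : ℝ) * s ≤ N} ≤ ⌊N / s⌋₊ ^ 2 := by
    calc _ ≤ #(Icc 1 ⌊N / s⌋₊ ×ˢ Icc 1 ⌊N / s⌋₊) := by
          refine Finset.card_le_card fun w hw => ?_
          simp only [Finset.mem_filter, mem_coeffPairs, mem_product, mem_Icc] at hw ⊢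
          obtain ⟨⟨h1, h2, h3⟩, h4⟩ := hw
          have : w.1 ≤ ⌊N / s⌋₊ := Nat.le_floor ((le_div_iff₀ hs).2 h4)
          omega
      _ = _ := by rw [card_product, Nat.card_Icc]; simp [sq]
  calc (#{w ∈ coeffPairs K | (w.1 : ℝ) * s ≤ N} : ℝ) ≤ (⌊N / s⌋₊ : ℝ) ^ 2 := by exact_mod_cast h1
    _ ≤ _ := by
        gcongr
        exact Nat.floor_le (by positivity)

open Classical in
/-- In the fibre over the smaller variable `s` and the coefficients `(n, k)` the larger variable
runs over an interval, which is empty unless `n s ≤ N`. So at most `(N / s)²` fibres over `s`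
matter, and a discrepancy `O(s^(7/8))` in each adds up to `O(N²)`. -/
lemma exists_abs_sum_card_sub_le {R : ℕ → ℕ → Prop} {δ : ℕ → ℝ}
    (hδ : ∀ c, 1 ≤ c → 0 ≤ δ c ∧ δ c ≤ 1)
    (h : ∃ C : ℝ, 0 < C ∧ ∀ c : ℕ, 1 ≤ c → ∀ X : ℕ,
      |(#{x ∈ Icc 1 X | R c x} : ℝ) - δ c * X| ≤ C * (c : ℝ) ^ (7 / 8 : ℝ)) :
    ∃ C : ℝ, 0 ≤ C ∧ ∀ N : ℝ, 0 ≤ N → ∀ A ⊆ Icc 1 ⌊N⌋₊, ∀ (α : ℕ → ℝ) (β : ℕ → ℕ × ℕ → ℝ)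
      (Q : ℕ × ℕ → Prop), (∀ s ∈ A, 0 ≤ α s) →
      (∀ s ∈ A, ∀ w ∈ coeffPairs ⌊N⌋₊, β s w ≤ N) →
      (∀ s ∈ A, ∀ w ∈ coeffPairs ⌊N⌋₊, Q w → α s < β s w → (w.1 : ℝ) * s ≤ N) →
      |∑ s ∈ A, ∑ w ∈ coeffPairs ⌊N⌋₊, (if Q w then
          (#(filter (fun l : ℕ => α s < (l : ℝ) ∧ (l : ℝ) ≤ β s w ∧ R s l)
            (Icc 1 ⌊N⌋₊)) : ℝ) else 0) -
        ∑ s ∈ A, δ s * ∑ w ∈ coeffPairs ⌊N⌋₊, (if Q w then max (β s w - α s) 0 else 0)| ≤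
      C * N ^ 2 := by
  obtain ⟨C, hC, hR⟩ := h
  have hs : Summable (fun n : ℕ => 1 / (n : ℝ) ^ (9 / 8 : ℝ)) :=
    Real.summable_one_div_nat_rpow.2 (by norm_num)
  refine ⟨(2 * C + 2) * ∑' n : ℕ, 1 / (n : ℝ) ^ (9 / 8 : ℝ), by positivity, ?_⟩
  intro N hN A hA α β Q hα hβ hQ
  set K := ⌊N⌋₊
  rw [← Finset.sum_sub_distrib]
  calc _ ≤ ∑ s ∈ A, (2 * C + 2) * N ^ 2 * (1 / (s : ℝ) ^ (9 / 8 : ℝ)) := by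
        refine (Finset.abs_sum_le_sum_abs _ _).trans (Finset.sum_le_sum fun s hsA => ?_)
        have hs1 : 1 ≤ s := (mem_Icc.1 (hA hsA)).1
        have hs1' : (1 : ℝ) ≤ s := by exact_mod_cast hs1
        have hs0 : (0 : ℝ) < s := by linarith
        set y := (s : ℝ) ^ (7 / 8 : ℝ) with hy
        have hy1 : 1 ≤ y := Real.one_le_rpow hs1' (by norm_num)
        rw [Finset.mul_sum, ← Finset.sum_sub_distrib]
        calc _ ≤ ∑ w ∈ coeffPairs K, if (w.1 : ℝ) * s ≤ N then (2 * C + 2) * y else 0 := by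
              refine (Finset.abs_sum_le_sum_abs _ _).trans (Finset.sum_le_sum fun w hw => ?_)
              by_cases hq : Q w
              · rw [if_pos hq, if_pos hq]
                have hfl : ⌊β s w⌋₊ ≤ K := Nat.floor_le_floor (hβ s hsA w hw)
                have hmain := abs_card_interval_sub_le (hδ s hs1).1 (hδ s hs1).2 (hR s hs1)
                  (hα s hsA) hfl
                split_ifs with hc
                · refine hmain.trans ?_
                  nlinarith
                · have hab : β s w ≤ α s := by
                    by_contra hcon
                    exact hc (hQ s hsA w hw hq (not_le.1 hcon))
                  have he : (filter (fun l : ℕ => α s < (l : ℝ) ∧ (l : ℝ) ≤ β s w ∧ R s l)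
                      (Icc 1 K)) = ∅ := by
                    rw [Finset.filter_eq_empty_iff]
                    rintro l - ⟨h1, h2, -⟩
                    linarith
                  rw [he, max_eq_right (by linarith)]
                  simp
              · rw [if_neg hq, if_neg hq, mul_zero, sub_zero, abs_zero]
                split_ifs <;> positivity
          _ = #{w ∈ coeffPairs K | (w.1 : ℝ) * s ≤ N} * ((2 * C + 2) * y) := by
              rw [← Finset.sum_filter, Finset.sum_const, nsmul_eq_mul]
          _ ≤ (N / s) ^ 2 * ((2 * C + 2) * y) := by
              gcongr
              exact card_coeffPairs_filter_le hN hs0 K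
          _ = _ := by
              have e : (s : ℝ) ^ 2 = y * (s : ℝ) ^ (9 / 8 : ℝ) := by
                rw [hy, ← Real.rpow_add hs0, ← Real.rpow_natCast]; norm_num
              rw [div_pow, e]
              field_simp
    _ = (2 * C + 2) * N ^ 2 * ∑ s ∈ A, (1 / (s : ℝ) ^ (9 / 8 : ℝ)) := by rw [Finset.mul_sum]
    _ ≤ (2 * C + 2) * N ^ 2 * ∑' n : ℕ, 1 / (n : ℝ) ^ (9 / 8 : ℝ) := by
        gcongr
        exact hs.sum_le_tsum _ (fun _ _ => by positivity)
    _ = _ := by ring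

lemma sum_one_div_sqrt_le (n : ℕ) : ∑ q ∈ Icc 1 n, 1 / √(q : ℝ) ≤ 2 * √(n : ℝ) := by
  induction n with
  | zero => simp
  | succ n ih =>
    rw [Finset.sum_Icc_succ_top (by omega)]
    have h1 : 1 / √((n + 1 : ℕ) : ℝ) ≤ 2 * √((n + 1 : ℕ) : ℝ) - 2 * √(n : ℝ) := by
      have p1 : 0 < √((n + 1 : ℕ) : ℝ) := Real.sqrt_pos.2 (by positivity)
      have e1 : √((n + 1 : ℕ) : ℝ) ^ 2 = n + 1 := by
        rw [Real.sq_sqrt (by positivity)]; push_cast; ring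
      have e2 : √(n : ℝ) ^ 2 = n := Real.sq_sqrt (by positivity)
      rw [div_le_iff₀ p1]
      nlinarith [sq_nonneg (√((n + 1 : ℕ) : ℝ) - √(n : ℝ))]
    linarith

lemma sum_sqrt_div_le {N : ℝ} (hN : 0 ≤ N) {M : ℕ} (hM : (M : ℝ) ≤ N) :
    ∑ q ∈ Icc 1 M, √(N / q) ≤ 2 * N := by
  calc _ = √N * ∑ q ∈ Icc 1 M, 1 / √(q : ℝ) := by
        rw [Finset.mul_sum]
        refine Finset.sum_congr rfl fun q _ => ?_
        rw [Real.sqrt_div hN, mul_one_div]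
    _ ≤ √N * (2 * √N) := by
        gcongr
        exact (sum_one_div_sqrt_le M).trans (by gcongr)
    _ = 2 * N := by
        have := Real.mul_self_sqrt hN
        linear_combination 2 * this

end Counting

/-! ### Solutions with `p ≤ q` -/

section Cases

local notation "γ" => Real.eulerMascheroniConstant

lemma not_lowerInv_self {p : ℕ} (hp : 1 ≤ p) : ¬ LowerInv p p := by
  rintro ⟨h1, h2⟩
  rw [Nat.gcd_self] at h1
  subst h1
  have := (modInv_spec le_rfl (by norm_num : Nat.gcd 1 1 = 1)).1
  omega

lemma abs_sum_mul_sub_le {A : Finset ℕ} {δ G H E : ℕ → ℝ} (hδ : ∀ q ∈ A, 0 ≤ δ q ∧ δ q ≤ 1)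
    (h : ∀ q ∈ A, |G q - H q| ≤ E q) :
    |∑ q ∈ A, δ q * G q - ∑ q ∈ A, δ q * H q| ≤ ∑ q ∈ A, E q := by
  rw [← Finset.sum_sub_distrib]
  refine (Finset.abs_sum_le_sum_abs _ _).trans (Finset.sum_le_sum fun q hq => ?_)
  obtain ⟨h0, h1⟩ := hδ q hq
  rw [← mul_sub, abs_mul, abs_of_nonneg h0]
  calc _ ≤ 1 * |G q - H q| := by gcongr
    _ ≤ _ := by rw [one_mul]; exact h q hq

lemma one_le_sqrt_div {N : ℝ} {q : ℕ} (hq : 1 ≤ q) (hqN : (q : ℝ) ≤ N) : 1 ≤ √(N / q) :=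
  Real.one_le_sqrt.2 ((one_le_div (by exact_mod_cast hq)).2 hqN)

lemma div_le_sqrt_sq_div {U : ℝ} {q : ℕ} (hq : 1 ≤ q) : U / q ≤ √(U ^ 2 / q) := by
  have hq1 : (1 : ℝ) ≤ q := by exact_mod_cast hq
  refine Real.le_sqrt_of_sq_le ?_
  rw [div_pow]
  gcongr
  nlinarith

open Classical in
/-- Solutions with `p ≤ q`, subject to a condition on `p` only. -/
lemma exists_abs_ncard_le_sub_le :
    ∃ C : ℝ, 0 ≤ C ∧ ∀ U : ℝ, 1 ≤ U → ∀ A : ℕ → Prop,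
      |((solutionSet U (fun p q _ _ => p ≤ q ∧ A p)).ncard : ℝ) -
        (U ^ 2) ^ 2 / 2 * Real.log 2 *
          ∑ p ∈ filter A (Icc 1 ⌊U ^ 2⌋₊), lowerDensity p / p| ≤ C * (U ^ 2) ^ 2 := by
  obtain ⟨C, hC, h⟩ := exists_abs_sum_card_sub_le (R := LowerInv) (δ := lowerDensity)
    (fun c hc => ⟨lowerDensity_nonneg c, lowerDensity_le_one hc⟩)
    (exists_abs_card_lowerInv_sub_le.imp fun C h => ⟨h.1, fun c hc X => (h.2 c hc X).1⟩)
  refine ⟨C + 28, by positivity, fun U hU A => ?_⟩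
  set N := U ^ 2 with hN
  have hN1 : 1 ≤ N := by nlinarith
  set K := ⌊N⌋₊ with hK
  have hKN : (K : ℝ) ≤ N := Nat.floor_le (by linarith)
  have h1 := h N (by linarith) (filter A (Icc 1 K)) (Finset.filter_subset _ _) (fun p => p)
    (fun p w => (N - w.2 * p) / w.1) (fun _ => True) (fun _ _ => by positivity)
    (fun p hp w hw => by
      rw [mem_coeffPairs] at hw
      have : (1 : ℝ) ≤ w.1 := by exact_mod_cast (by omega : 1 ≤ w.1)
      rw [div_le_iff₀ (by linarith)]
      have : 0 ≤ (w.2 : ℝ) * p := by positivity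
      nlinarith)
    (fun p hp w hw _ hlt => by
      rw [mem_coeffPairs] at hw
      have : (1 : ℝ) ≤ w.1 := by exact_mod_cast (by omega : 1 ≤ w.1)
      rw [lt_div_iff₀ (by linarith)] at hlt
      have : 0 ≤ (w.2 : ℝ) * p := by positivity
      nlinarith)
  simp only [if_true] at h1
  have e1 : ((solutionSet U (fun p q _ _ => p ≤ q ∧ A p)).ncard : ℝ) =
      ∑ p ∈ filter A (Icc 1 K), ∑ w ∈ coeffPairs K,
        (#(filter (fun l : ℕ => (p : ℝ) < (l : ℝ) ∧ (l : ℝ) ≤ (N - w.2 * p) / w.1 ∧ LowerInv p l)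
          (Icc 1 K)) : ℝ) := by
    rw [ncard_solutionSet_eq_sum_fst, Finset.sum_filter]
    push_cast
    refine Finset.sum_congr rfl fun p hp => ?_
    rw [mem_Icc] at hp
    split_ifs with hA
    · refine Finset.sum_congr rfl fun w hw => ?_
      rw [mem_coeffPairs] at hw
      have hw1 : (0 : ℝ) < w.1 := by exact_mod_cast (by omega : 0 < w.1)
      congr 2
      ext q
      simp only [Finset.mem_filter, le_div_iff₀ hw1, Nat.cast_lt]
      constructor
      · rintro ⟨a1, a2, a3, a4, -⟩
        have hne : p ≠ q := by
          rintro rfl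
          exact not_lowerInv_self hp.1 a2
        exact ⟨a1, by omega, by linarith, a2⟩
      · rintro ⟨a1, a2, a3, a4⟩
        exact ⟨a1, a4, by linarith, a2.le, hA⟩
    · refine Finset.sum_eq_zero fun w hw => ?_
      rw [Nat.cast_eq_zero]
      refine Finset.card_eq_zero.2 (Finset.eq_empty_of_forall_notMem fun q hq => ?_)
      simp only [Finset.mem_filter] at hq
      exact hA hq.2.2.2.2
  have h2 := abs_sum_mul_sub_le (A := filter A (Icc 1 K)) (δ := lowerDensity)
    (G := fun p => ∑ w ∈ coeffPairs K, max ((N - w.2 * p) / w.1 - p) 0)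
    (H := fun p => N ^ 2 / (2 * p) * Real.log 2) (E := fun p => 14 * N * √(N / p))
    (fun p hp => by
      rw [Finset.mem_filter, mem_Icc] at hp
      exact ⟨lowerDensity_nonneg p, lowerDensity_le_one hp.1.1⟩)
    (fun p hp => by
      rw [Finset.mem_filter, mem_Icc] at hp
      refine abs_sum_length_fst_sub_le (by linarith) (by exact_mod_cast hp.1.1) ?_
      exact le_trans (by exact_mod_cast hp.1.2) hKN)
  have h3 : ∑ p ∈ filter A (Icc 1 K), 14 * N * √(N / p) ≤ 28 * N ^ 2 := by
    calc _ ≤ ∑ p ∈ Icc 1 K, 14 * N * √(N / p) :=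
          Finset.sum_le_sum_of_subset_of_nonneg (Finset.filter_subset _ _)
            (fun _ _ _ => by positivity)
      _ = 14 * N * ∑ p ∈ Icc 1 K, √(N / p) := by rw [Finset.mul_sum]
      _ ≤ 14 * N * (2 * N) := by
          gcongr
          exact sum_sqrt_div_le (by linarith) hKN
      _ = _ := by ring
  have e2 : ∑ p ∈ filter A (Icc 1 K), lowerDensity p * (N ^ 2 / (2 * p) * Real.log 2) =
      N ^ 2 / 2 * Real.log 2 * ∑ p ∈ filter A (Icc 1 K), lowerDensity p / p := by
    rw [Finset.mul_sum]
    exact Finset.sum_congr rfl fun p _ => by ring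
  rw [e2] at h2
  rw [e1]
  refine (abs_sub_le _ _ _).trans ((add_le_add h1 (h2.trans h3)).trans (le_of_eq ?_))
  ring

open Classical in
/-- There are only `O(U⁴)` solutions with `p ≤ U < q`. -/
lemma ncard_fst_le_lt_snd_le {U : ℝ} (hU : 1 ≤ U) :
    ((solutionSet U (fun p q _ _ => (p : ℝ) ≤ U ∧ U < (q : ℝ))).ncard : ℝ) ≤
      2 * (U ^ 2) ^ 2 := by
  set N := U ^ 2 with hN
  have hN1 : 1 ≤ N := by nlinarith
  set K := ⌊N⌋₊ with hK
  have hU0 : 0 < U := by linarith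
  have hfU : 1 ≤ ⌊U⌋₊ := Nat.le_floor (by simpa using hU)
  have hfK : ⌊U⌋₊ ≤ K := Nat.floor_le_floor (by nlinarith)
  rw [ncard_solutionSet_eq_sum_snd]
  push_cast
  calc _ ≤ ∑ q ∈ Icc 1 K, (if U < (q : ℝ) then U * N ^ 2 * ((q : ℝ) ^ 2)⁻¹ else 0) := by
        refine Finset.sum_le_sum fun q hq => ?_
        rw [mem_Icc] at hq
        have hq0 : (0 : ℝ) < q := by exact_mod_cast hq.1
        split_ifs with hUq
        · calc _ ≤ ∑ w ∈ coeffPairs K, if (w.1 : ℝ) * q ≤ N then U else 0 := by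
                refine Finset.sum_le_sum fun w hw => ?_
                split_ifs with hc
                · calc _ ≤ (#(Icc 1 ⌊U⌋₊) : ℝ) := by
                        norm_cast
                        refine Finset.card_le_card fun p hp => ?_
                        rw [Finset.mem_filter, mem_Icc] at hp
                        rw [mem_Icc]
                        exact ⟨hp.1.1, Nat.le_floor hp.2.2.2.1⟩
                    _ ≤ U := by
                        rw [Nat.card_Icc, Nat.add_sub_cancel]
                        exact Nat.floor_le hU0.le
                · rw [Nat.cast_nonpos]
                  refine Finset.card_eq_zero.2 (Finset.eq_empty_of_forall_notMem fun p hp => ?_)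
                  simp only [Finset.mem_filter] at hp
                  have : 0 ≤ (w.2 : ℝ) * p := by positivity
                  exact hc (by linarith [hp.2.2.1])
            _ = #{w ∈ coeffPairs K | (w.1 : ℝ) * q ≤ N} * U := by
                rw [← Finset.sum_filter, Finset.sum_const, nsmul_eq_mul]
            _ ≤ (N / q) ^ 2 * U := by
                gcongr
                exact card_coeffPairs_filter_le (by linarith) hq0 K
            _ = _ := by rw [div_pow, div_eq_mul_inv]; ring
        · refine le_of_eq (Finset.sum_eq_zero fun w _ => ?_)
          rw [Nat.cast_eq_zero]
          refine Finset.card_eq_zero.2 (Finset.eq_empty_of_forall_notMem fun p hp => ?_)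
          simp only [Finset.mem_filter] at hp
          exact hUq hp.2.2.2.2
    _ = U * N ^ 2 * ∑ q ∈ Ioc ⌊U⌋₊ K, ((q : ℝ) ^ 2)⁻¹ := by
        rw [← Finset.sum_filter, Finset.mul_sum]
        refine Finset.sum_congr ?_ fun _ _ => rfl
        ext q
        simp only [Finset.mem_filter, mem_Icc, mem_Ioc, Nat.floor_lt hU0.le]
        constructor
        · rintro ⟨⟨a, b⟩, c⟩; exact ⟨c, b⟩
        · rintro ⟨a, b⟩
          refine ⟨⟨?_, b⟩, a⟩
          have : (1 : ℝ) < q := by linarith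
          exact_mod_cast this.le
    _ ≤ U * N ^ 2 * (2 / U) := by
        gcongr
        refine (sum_Ioc_inv_sq_le_sub (by omega) hfK).trans ?_
        have h1 : U < ⌊U⌋₊ + 1 := Nat.lt_floor_add_one U
        have h2 : (1 : ℝ) ≤ ⌊U⌋₊ := by exact_mod_cast hfU
        have h3 : ((⌊U⌋₊ : ℝ))⁻¹ ≤ 2 / U := by
          rw [inv_eq_one_div, div_le_div_iff₀ (by linarith) hU0]
          linarith
        have h4 : (0 : ℝ) ≤ (K : ℝ)⁻¹ := by positivity
        linarith
    _ = _ := by field_simp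

lemma filter_le_Icc_sq {U : ℝ} (hU : 1 ≤ U) :
    filter (fun p : ℕ => (p : ℝ) ≤ U) (Icc 1 ⌊U ^ 2⌋₊) = Icc 1 ⌊U⌋₊ := by
  ext p
  simp only [Finset.mem_filter, mem_Icc, Nat.le_floor_iff (by linarith : 0 ≤ U)]
  constructor
  · rintro ⟨⟨a, -⟩, b⟩; exact ⟨a, b⟩
  · rintro ⟨a, b⟩
    exact ⟨⟨a, Nat.le_floor (by nlinarith)⟩, b⟩

lemma exists_abs_R₁_R₂_sub_le :
    ∃ C : ℝ, 0 ≤ C ∧ ∀ U : ℝ, 1 ≤ U →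
      |(R₁ U : ℝ) - (U ^ 2) ^ 2 / 2 * Real.log 2 * (densityLead * Real.log U)| ≤
        C * (U ^ 2) ^ 2 ∧
      |(R₂ U : ℝ) - (U ^ 2) ^ 2 / 2 * Real.log 2 * (densityLead * Real.log U)| ≤
        C * (U ^ 2) ^ 2 := by
  obtain ⟨C1, hC1, h1⟩ := exists_abs_ncard_le_sub_le
  obtain ⟨C2, hC2, h2⟩ := exists_abs_sum_lowerDensity_div_sub_le
  refine ⟨C1 + C2 + 2, by positivity, fun U hU => ?_⟩
  set N := U ^ 2 with hN
  have hN1 : 1 ≤ N := by nlinarith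
  have hl2 : 0 < Real.log 2 := Real.log_pos (by norm_num)
  have hl2' : Real.log 2 ≤ 1 := by linarith [Real.log_le_sub_one_of_pos (x := 2) (by norm_num)]
  have hD := ncard_fst_le_lt_snd_le hU
  have hD0 : (0 : ℝ) ≤ (solutionSet U (fun p q _ _ => (p : ℝ) ≤ U ∧ U < (q : ℝ))).ncard := by
    positivity
  have a1 := h1 U hU (fun p => (p : ℝ) ≤ U)
  have a2 := h1 U hU (fun p => ¬ (p : ℝ) ≤ U)
  have b1 := h2 U hU
  have b2 := h2 N hN1
  rw [hN, Real.log_pow] at b2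
  have hsplit := Finset.sum_filter_add_sum_filter_not (Icc 1 ⌊U ^ 2⌋₊)
    (fun p : ℕ => (p : ℝ) ≤ U) (fun p => lowerDensity p / p)
  rw [filter_le_Icc_sq hU] at hsplit
  -- Passing between conditions on `p` and on `q` changes the counts by the solutions with
  -- `p ≤ U < q`.
  have r1 : (solutionSet U (fun p q _ _ => p ≤ q ∧ (p : ℝ) ≤ U)).ncard = R₁ U +
      (solutionSet U (fun p q _ _ => (p : ℝ) ≤ U ∧ U < (q : ℝ))).ncard := by
    refine ncard_solutionSet_of_disjoint (fun p q n k => ?_) (fun p q n k h h' => ?_)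
    · unfold Case1
      constructor
      · rintro ⟨x, y⟩
        rcases le_or_gt (q : ℝ) U with z | z
        · exact Or.inl ⟨x, z⟩
        · exact Or.inr ⟨y, z⟩
      · rintro (⟨x, y⟩ | ⟨x, y⟩)
        · exact ⟨x, le_trans (by exact_mod_cast x) y⟩
        · exact ⟨by exact_mod_cast (x.trans_lt y).le, x⟩
    · exact absurd h.2 (not_le.2 h'.2)
  have r2 : R₂ U = (solutionSet U (fun p q _ _ => p ≤ q ∧ ¬ (p : ℝ) ≤ U)).ncard +
      (solutionSet U (fun p q _ _ => (p : ℝ) ≤ U ∧ U < (q : ℝ))).ncard := by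
    refine ncard_solutionSet_of_disjoint (fun p q n k => ?_) (fun p q n k h h' => ?_)
    · unfold Case2
      constructor
      · rintro ⟨x, y⟩
        rcases le_or_gt (p : ℝ) U with z | z
        · exact Or.inr ⟨z, y⟩
        · exact Or.inl ⟨x, not_le.2 z⟩
      · rintro (⟨x, y⟩ | ⟨x, y⟩)
        · exact ⟨x, lt_of_lt_of_le (not_le.1 y) (by exact_mod_cast x)⟩
        · exact ⟨by exact_mod_cast (x.trans_lt y).le, y⟩
    · exact h.2 h'.1
  rw [filter_le_Icc_sq hU] at a1
  rw [r1] at a1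
  rw [r2]
  push_cast at a1 b2 ⊢
  set D : ℝ := ((solutionSet U (fun p q _ _ => (p : ℝ) ≤ U ∧ U < (q : ℝ))).ncard : ℝ)
  set F : ℝ := ((solutionSet U (fun p q _ _ => p ≤ q ∧ ¬ (p : ℝ) ≤ U)).ncard : ℝ)
  set L := Real.log U
  set S1 := ∑ p ∈ Icc 1 ⌊U⌋₊, lowerDensity p / p
  set S := ∑ p ∈ Icc 1 ⌊U ^ 2⌋₊, lowerDensity p / p
  have hS2 : ∑ p ∈ filter (fun p : ℕ => ¬ (p : ℝ) ≤ U) (Icc 1 ⌊U ^ 2⌋₊),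
      lowerDensity p / p = S - S1 := by linarith
  have c1 : |N ^ 2 / 2 * Real.log 2 * (S1 - densityLead * L)| ≤ C2 * N ^ 2 / 2 := by
    rw [abs_mul, abs_of_nonneg (by positivity)]
    calc _ ≤ N ^ 2 / 2 * 1 * C2 := by gcongr
      _ = _ := by ring
  have c2 : |N ^ 2 / 2 * Real.log 2 * (S - densityLead * (2 * L))| ≤ C2 * N ^ 2 / 2 := by
    rw [abs_mul, abs_of_nonneg (by positivity)]
    calc _ ≤ N ^ 2 / 2 * 1 * C2 := by gcongr
      _ = _ := by ring
  have hcN : 0 ≤ C2 * N ^ 2 := by positivity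
  constructor
  · rw [abs_le] at a1 c1 ⊢
    constructor <;> nlinarith
  · have a2' : |F - N ^ 2 / 2 * Real.log 2 * (S - S1)| ≤ C1 * N ^ 2 := by
      rw [← hS2]
      convert! a2 using 6
    rw [abs_le] at a2' c1 c2 ⊢
    constructor <;> nlinarith

end Cases

/-! ### Solutions with `q < p` -/

section LargerFirst

local notation "γ" => Real.eulerMascheroniConstant

open Classical in
/-- Solutions whose fibre over `q` and the coefficients `w = (n, k)` is an interval of `p`. -/
lemma exists_abs_ncard_sub_sum_upperDensity_le :
    ∃ C : ℝ, 0 ≤ C ∧ ∀ U : ℝ, 1 ≤ U → ∀ A ⊆ Icc 1 ⌊U ^ 2⌋₊,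
      ∀ (α : ℕ → ℝ) (β : ℕ → ℕ × ℕ → ℝ) (Q : ℕ × ℕ → Prop) (P : ℕ → ℕ → ℕ → ℕ → Prop),
      (∀ q ∈ A, 0 ≤ α q) →
      (∀ q ∈ A, ∀ w ∈ coeffPairs ⌊U ^ 2⌋₊, β q w ≤ (U ^ 2 - w.1 * q) / w.2) →
      (∀ q : ℕ, 1 ≤ q → ∀ w ∈ coeffPairs ⌊U ^ 2⌋₊, ∀ p : ℕ,
        (w.1 : ℝ) * q + w.2 * p ≤ U ^ 2 ∧ P p q w.1 w.2 ↔
          q ∈ A ∧ Q w ∧ α q < p ∧ (p : ℝ) ≤ β q w) →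
      |((solutionSet U P).ncard : ℝ) - ∑ q ∈ A, upperDensity q *
        ∑ w ∈ coeffPairs ⌊U ^ 2⌋₊, (if Q w then max (β q w - α q) 0 else 0)| ≤
          C * (U ^ 2) ^ 2 := by
  obtain ⟨C, hC, h⟩ := exists_abs_sum_card_sub_le (R := fun s l => LowerInv l s)
    (δ := upperDensity) (fun c hc => ⟨upperDensity_nonneg hc, upperDensity_le_one c⟩)
    (exists_abs_card_lowerInv_sub_le.imp fun C h => ⟨h.1, fun c hc X => (h.2 c hc X).2⟩)
  refine ⟨C, hC, fun U hU A hA α β Q P hα hβ hP => ?_⟩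
  set N := U ^ 2 with hN
  have hN1 : 1 ≤ N := by nlinarith
  set K := ⌊N⌋₊ with hK
  have h1 := h N (by linarith) A hA α β Q hα
    (fun q hq w hw => by
      refine (hβ q hq w hw).trans ?_
      rw [mem_coeffPairs] at hw
      have : (1 : ℝ) ≤ w.2 := by exact_mod_cast hw.1
      rw [div_le_iff₀ (by linarith)]
      have : 0 ≤ (w.1 : ℝ) * q := by positivity
      nlinarith)
    (fun q hq w hw _ hlt => by
      have hlt2 := ((hα q hq).trans_lt hlt).trans_le (hβ q hq w hw)
      rw [mem_coeffPairs] at hw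
      have : (0 : ℝ) < w.2 := by exact_mod_cast hw.1
      have := (div_pos_iff_of_pos_right this).1 hlt2
      linarith)
  have e1 : ((solutionSet U P).ncard : ℝ) = ∑ q ∈ A, ∑ w ∈ coeffPairs K, (if Q w then
      (#(filter (fun l : ℕ => α q < (l : ℝ) ∧ (l : ℝ) ≤ β q w ∧ LowerInv l q) (Icc 1 K)) : ℝ)
      else 0) := by
    rw [ncard_solutionSet_eq_sum_snd, Nat.cast_sum, ← hN, ← hK]
    symm
    refine Finset.sum_subset_zero_on_sdiff hA (fun q hq => ?_) (fun q hq => ?_)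
    · rw [mem_sdiff, mem_Icc] at hq
      rw [Nat.cast_eq_zero]
      refine Finset.sum_eq_zero fun w hw => ?_
      refine Finset.card_eq_zero.2 (Finset.eq_empty_of_forall_notMem fun p hp => ?_)
      simp only [Finset.mem_filter] at hp
      exact hq.2 ((hP q hq.1.1 w hw p).1 ⟨hp.2.2.1, hp.2.2.2⟩).1
    · rw [Nat.cast_sum]
      refine Finset.sum_congr rfl fun w hw => ?_
      have hi := hP q (mem_Icc.1 (hA hq)).1 w hw
      split_ifs with hQ
      · congr 2
        ext p
        simp only [Finset.mem_filter]
        have := hi p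
        tauto
      · symm
        rw [Nat.cast_eq_zero]
        refine Finset.card_eq_zero.2 (Finset.eq_empty_of_forall_notMem fun p hp => ?_)
        simp only [Finset.mem_filter] at hp
        exact hQ ((hi p).1 ⟨hp.2.2.1, hp.2.2.2⟩).2.1
  rw [e1]
  exact h1

lemma coeff_add_le_iff {N : ℝ} {K : ℕ} {w : ℕ × ℕ} (hw : w ∈ coeffPairs K) (q p : ℕ) :
    (w.1 : ℝ) * q + w.2 * p ≤ N ↔ (p : ℝ) ≤ (N - w.1 * q) / w.2 := by
  rw [mem_coeffPairs] at hw
  have : (0 : ℝ) < w.2 := by exact_mod_cast hw.1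
  rw [le_div_iff₀ this]
  constructor <;> intro h <;> linarith

lemma upperDensity_mem {q : ℕ} (hq : 1 ≤ q) : 0 ≤ upperDensity q ∧ upperDensity q ≤ 1 :=
  ⟨upperDensity_nonneg hq, upperDensity_le_one q⟩

lemma Icc_floor_subset {U : ℝ} (hU : 1 ≤ U) : Icc 1 ⌊U⌋₊ ⊆ Icc 1 ⌊U ^ 2⌋₊ :=
  Finset.Icc_subset_Icc_right (Nat.floor_le_floor (by nlinarith))

/-- The total length of the intervals `(q, (N - n q) / k]`. -/
lemma abs_sum_length_diag_sub_le {N : ℝ} {q : ℕ} (hq : 1 ≤ q) (hqN : (q : ℝ) ≤ N) :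
    |∑ w ∈ coeffPairs ⌊N⌋₊, max ((N - w.1 * q) / w.2 - q) 0 -
      N ^ 2 / (2 * q) * (Real.log (N / q) - Real.log 2 + γ - 3 / 2)| ≤ 7 * N * √(N / q) := by
  have hq1 : (1 : ℝ) ≤ q := by exact_mod_cast hq
  have hN : 0 < N := by linarith
  have h := abs_sum_length_sub_log_le hN hq1 (by linarith : (0 : ℝ) ≤ q)
  have e : Real.log (N / (q + q)) = Real.log (N / q) - Real.log 2 := by
    rw [← Real.log_div (by positivity) (by norm_num), div_div]
    congr 2
    ring
  rw [e] at h
  refine h.trans ?_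
  have h1 := one_le_sqrt_div hq hqN
  have e2 : ((q : ℝ) + q) / q = 2 := by field_simp; norm_num
  rw [e2]
  nlinarith

/-- The total length of the intervals `(q, min U ((U² - n q) / k)]`, as the difference of those of
`(q, (U² - n q) / k]` and `(U, (U² - n q) / k]`. The constants `γ - 3 / 2` cancel. -/
lemma abs_sum_length_min_sub_le {U : ℝ} {q : ℕ} (hq : 1 ≤ q) (hqU : (q : ℝ) ≤ U) :
    |∑ w ∈ coeffPairs ⌊U ^ 2⌋₊, max (min U ((U ^ 2 - w.1 * q) / w.2) - q) 0 -
      (U ^ 2) ^ 2 / (2 * q) * (Real.log (U / q) - Real.log 2)| ≤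
      14 * U ^ 2 * √(U ^ 2 / q) + (U ^ 2) ^ 2 / U := by
  have hq1 : (1 : ℝ) ≤ q := by exact_mod_cast hq
  have hU0 : 0 < U := by linarith
  have h1 := abs_sum_length_diag_sub_le (N := U ^ 2) hq (by nlinarith)
  have h2 := abs_sum_length_sub_log_le (N := U ^ 2) (by positivity) hq1 hU0.le
  have e : ∑ w ∈ coeffPairs ⌊U ^ 2⌋₊, max (min U ((U ^ 2 - w.1 * q) / w.2) - q) 0 =
      ∑ w ∈ coeffPairs ⌊U ^ 2⌋₊, max ((U ^ 2 - w.1 * q) / w.2 - q) 0 -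
      ∑ w ∈ coeffPairs ⌊U ^ 2⌋₊, max ((U ^ 2 - w.1 * q) / w.2 - U) 0 := by
    rw [← Finset.sum_sub_distrib]
    refine Finset.sum_congr rfl fun w _ => ?_
    set B := (U ^ 2 - (w.1 : ℝ) * q) / w.2
    rcases le_total U B with hB | hB
    · rw [min_eq_left hB, max_eq_left (by linarith), max_eq_left (by linarith),
        max_eq_left (by linarith)]
      ring
    · rw [min_eq_right hB, max_eq_right (by linarith : B - U ≤ 0), sub_zero]
  have hs1 := one_le_sqrt_div hq (by nlinarith : (q : ℝ) ≤ U ^ 2)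
  have hs2 := div_le_sqrt_sq_div (U := U) hq
  have e2 : ((q : ℝ) + U) / q = 1 + U / q := by field_simp
  have hl : Real.log (U ^ 2 / (q + U)) = Real.log (U ^ 2 / q) - Real.log (U / q) -
      Real.log (1 + q / U) := by
    rw [← Real.log_div (by positivity) (by positivity), ← Real.log_div (by positivity)
      (by positivity)]
    congr 1
    field_simp
    ring
  have hl0 : 0 ≤ Real.log (1 + q / U) := Real.log_nonneg (by
    have : 0 ≤ (q : ℝ) / U := by positivity
    linarith)
  have hl1 : Real.log (1 + q / U) ≤ q / U := by
    have := Real.log_le_sub_one_of_pos (x := 1 + q / U) (by positivity)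
    linarith
  rw [e]
  rw [hl, e2] at h2
  set S1 := ∑ w ∈ coeffPairs ⌊U ^ 2⌋₊, max ((U ^ 2 - w.1 * q) / w.2 - q) 0
  set S2 := ∑ w ∈ coeffPairs ⌊U ^ 2⌋₊, max ((U ^ 2 - w.1 * q) / w.2 - U) 0
  set M := (U ^ 2) ^ 2 / (2 * (q : ℝ)) with hM
  set lg := Real.log (1 + q / U)
  have hM0 : 0 ≤ M := by positivity
  have h3 : M * lg ≤ (U ^ 2) ^ 2 / U := by
    calc M * lg ≤ M * (q / U) := by gcongr
      _ = (U ^ 2) ^ 2 / U / 2 := by rw [hM]; field_simp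
      _ ≤ _ := half_le_self (by positivity)
  have h4 : 0 ≤ M * lg := by positivity
  have h5 : U ^ 2 * (1 + U / q) ≤ U ^ 2 * (2 * √(U ^ 2 / q)) := by gcongr; linarith
  rw [abs_le] at h1 h2 ⊢
  constructor <;> nlinarith

open Classical in
/-- `p` runs over `(q, min U ((U² - n q) / k)]` in the fibre over `q` and `(n, k)`. -/
lemma exists_abs_R₃_sub_le :
    ∃ C : ℝ, 0 ≤ C ∧ ∀ U : ℝ, 1 ≤ U →
      |(R₃ U : ℝ) - (U ^ 2) ^ 2 / 2 * (densityLead * Real.log U ^ 2 / 2 +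
        densityConst * Real.log U - Real.log 2 * (densityLead * Real.log U))| ≤
        C * (U ^ 2) ^ 2 := by
  obtain ⟨C, hC, h⟩ := exists_abs_ncard_sub_sum_upperDensity_le
  obtain ⟨C1, hC1, h1⟩ := exists_abs_sum_upperDensity_div_mul_log_sub_le
  obtain ⟨C2, hC2, h2⟩ := exists_abs_sum_upperDensity_div_sub_le
  refine ⟨C + 29 + C1 + C2, by positivity, fun U hU => ?_⟩
  have hU0 : 0 < U := by linarith
  have a := h U hU (Icc 1 ⌊U⌋₊) (Icc_floor_subset hU) (fun q => q)
    (fun q w => min U ((U ^ 2 - w.1 * q) / w.2)) (fun _ => True) (Case3 U)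
    (fun _ _ => by positivity) (fun _ _ _ _ => min_le_right _ _)
    (fun q hq w hw p => by
      rw [coeff_add_le_iff hw, le_min_iff, mem_Icc, Nat.le_floor_iff hU0.le, Nat.cast_lt, Case3]
      constructor
      · rintro ⟨x, y, z⟩
        exact ⟨⟨hq, le_trans (by exact_mod_cast y.le) z⟩, trivial, y, z, x⟩
      · rintro ⟨-, -, y, z, x⟩
        exact ⟨x, y, z⟩)
  simp only [if_true] at a
  set N := U ^ 2 with hN
  have hfl : (⌊U⌋₊ : ℝ) ≤ U := Nat.floor_le hU0.le
  have b := abs_sum_mul_sub_le (A := Icc 1 ⌊U⌋₊) (δ := upperDensity)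
    (G := fun q => ∑ w ∈ coeffPairs ⌊N⌋₊, max (min U ((N - w.1 * q) / w.2) - q) 0)
    (H := fun q => N ^ 2 / (2 * q) * (Real.log (U / q) - Real.log 2))
    (E := fun q => 14 * N * √(N / q) + N ^ 2 / U)
    (fun q hq => upperDensity_mem (mem_Icc.1 hq).1)
    (fun q hq => by
      rw [mem_Icc, Nat.le_floor_iff hU0.le] at hq
      exact abs_sum_length_min_sub_le hq.1 hq.2)
  have hE : ∑ q ∈ Icc 1 ⌊U⌋₊, (14 * N * √(N / q) + N ^ 2 / U) ≤ 29 * N ^ 2 := by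
    rw [Finset.sum_add_distrib, ← Finset.mul_sum, Finset.sum_const, Nat.card_Icc,
      Nat.add_sub_cancel, nsmul_eq_mul]
    have s1 := sum_sqrt_div_le (N := N) (by positivity) (M := ⌊U⌋₊) (by nlinarith)
    have s2 : (⌊U⌋₊ : ℝ) * (N ^ 2 / U) ≤ N ^ 2 := by
      calc _ ≤ U * (N ^ 2 / U) := by gcongr
        _ = _ := by field_simp
    have s3 : 14 * N * ∑ q ∈ Icc 1 ⌊U⌋₊, √(N / q) ≤ 14 * N * (2 * N) := by gcongr
    linarith
  have e : ∑ q ∈ Icc 1 ⌊U⌋₊, upperDensity q * (N ^ 2 / (2 * q) *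
      (Real.log (U / q) - Real.log 2)) = N ^ 2 / 2 *
      (∑ q ∈ Icc 1 ⌊U⌋₊, upperDensity q / q * Real.log (U / q) -
        Real.log 2 * ∑ q ∈ Icc 1 ⌊U⌋₊, upperDensity q / q) := by
    rw [Finset.mul_sum, ← Finset.sum_sub_distrib, Finset.mul_sum]
    exact Finset.sum_congr rfl fun q _ => by ring
  rw [e] at b
  have c1 := h1 U hU
  have c2 := h2 U hU
  set S1 := ∑ q ∈ Icc 1 ⌊U⌋₊, upperDensity q / q * Real.log (U / q)
  set S2 := ∑ q ∈ Icc 1 ⌊U⌋₊, upperDensity q / q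
  set L := Real.log U
  have hl2 : 0 < Real.log 2 := Real.log_pos (by norm_num)
  have hl2' : Real.log 2 ≤ 1 := by linarith [Real.log_le_sub_one_of_pos (x := 2) (by norm_num)]
  have d : |N ^ 2 / 2 * (S1 - Real.log 2 * S2) - N ^ 2 / 2 * (densityLead * L ^ 2 / 2 +
      densityConst * L - Real.log 2 * (densityLead * L))| ≤ (C1 + C2) * N ^ 2 := by
    rw [← mul_sub, abs_mul, abs_of_nonneg (by positivity)]
    have : |S1 - Real.log 2 * S2 - (densityLead * L ^ 2 / 2 + densityConst * L -
        Real.log 2 * (densityLead * L))| ≤ C1 + C2 := by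
      calc _ = |(S1 - (densityLead * L ^ 2 / 2 + densityConst * L)) -
            Real.log 2 * (S2 - densityLead * L)| := by congr 1; ring
        _ ≤ C1 + 1 * C2 := by
            refine (abs_sub _ _).trans (add_le_add c1 ?_)
            rw [abs_mul, abs_of_nonneg hl2.le]
            gcongr
        _ = _ := by ring
    calc _ ≤ N ^ 2 / 2 * (C1 + C2) := by gcongr
      _ ≤ N ^ 2 * (C1 + C2) := by gcongr; exact half_le_self (by positivity)
      _ = _ := by ring
  have b' := b.trans hE
  change |(R₃ U : ℝ) - _| ≤ _ at a
  rw [abs_le] at a b' d ⊢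
  constructor <;> linarith

open Classical in
/-- The number of all solutions with `q < p`. -/
lemma exists_abs_ncard_lt_sub_le :
    ∃ C : ℝ, 0 ≤ C ∧ ∀ U : ℝ, 1 ≤ U →
      |((solutionSet U (fun p q _ _ => q < p)).ncard : ℝ) - (U ^ 2) ^ 2 / 2 *
        (2 * densityLead * Real.log U ^ 2 + 2 * densityConst * Real.log U +
        (γ - 3 / 2 - Real.log 2) * (2 * densityLead * Real.log U))| ≤ C * (U ^ 2) ^ 2 := by
  obtain ⟨C, hC, h⟩ := exists_abs_ncard_sub_sum_upperDensity_le
  obtain ⟨C1, hC1, h1⟩ := exists_abs_sum_upperDensity_div_mul_log_sub_le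
  obtain ⟨C2, hC2, h2⟩ := exists_abs_sum_upperDensity_div_sub_le
  refine ⟨C + 14 + C1 + |γ - 3 / 2 - Real.log 2| * C2, by positivity, fun U hU => ?_⟩
  have a := h U hU (Icc 1 ⌊U ^ 2⌋₊) subset_rfl (fun q => q)
    (fun q w => (U ^ 2 - w.1 * q) / w.2) (fun _ => True) (fun p q _ _ => q < p)
    (fun _ _ => by positivity) (fun _ _ _ _ => le_rfl)
    (fun q hq w hw p => by
      rw [← coeff_add_le_iff hw, mem_Icc, Nat.cast_lt]
      constructor
      · rintro ⟨x, y⟩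
        have hw' := mem_coeffPairs.1 hw
        exact ⟨⟨hq, (le_floor_of_solution (by omega) hq hw'.1 hw'.2.1 x).2.1⟩, trivial, y, x⟩
      · rintro ⟨-, -, y, x⟩
        exact ⟨x, y⟩)
  simp only [if_true] at a
  set N := U ^ 2 with hN
  have hN1 : 1 ≤ N := by nlinarith
  have hfl : (⌊N⌋₊ : ℝ) ≤ N := Nat.floor_le (by linarith)
  have b := abs_sum_mul_sub_le (A := Icc 1 ⌊N⌋₊) (δ := upperDensity)
    (G := fun q => ∑ w ∈ coeffPairs ⌊N⌋₊, max ((N - w.1 * q) / w.2 - q) 0)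
    (H := fun q => N ^ 2 / (2 * q) * (Real.log (N / q) - Real.log 2 + γ - 3 / 2))
    (E := fun q => 7 * N * √(N / q))
    (fun q hq => upperDensity_mem (mem_Icc.1 hq).1)
    (fun q hq => by
      rw [mem_Icc, Nat.le_floor_iff (by linarith)] at hq
      exact abs_sum_length_diag_sub_le hq.1 hq.2)
  have hE : ∑ q ∈ Icc 1 ⌊N⌋₊, 7 * N * √(N / q) ≤ 14 * N ^ 2 := by
    rw [← Finset.mul_sum]
    have s1 := sum_sqrt_div_le (N := N) (by positivity) hfl
    calc _ ≤ 7 * N * (2 * N) := by gcongr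
      _ = _ := by ring
  set κ := γ - 3 / 2 - Real.log 2 with hκ
  have e : ∑ q ∈ Icc 1 ⌊N⌋₊, upperDensity q * (N ^ 2 / (2 * q) *
      (Real.log (N / q) - Real.log 2 + γ - 3 / 2)) = N ^ 2 / 2 *
      (∑ q ∈ Icc 1 ⌊N⌋₊, upperDensity q / q * Real.log (N / q) +
        κ * ∑ q ∈ Icc 1 ⌊N⌋₊, upperDensity q / q) := by
    rw [Finset.mul_sum, ← Finset.sum_add_distrib, Finset.mul_sum]
    exact Finset.sum_congr rfl fun q _ => by rw [hκ]; ring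
  rw [e] at b
  have c1 := h1 N hN1
  have c2 := h2 N hN1
  have hlog : Real.log N = 2 * Real.log U := by rw [hN, Real.log_pow]; norm_num
  rw [hlog] at c1 c2
  set S1 := ∑ q ∈ Icc 1 ⌊N⌋₊, upperDensity q / q * Real.log (N / q)
  set S2 := ∑ q ∈ Icc 1 ⌊N⌋₊, upperDensity q / q
  set L := Real.log U
  have d : |N ^ 2 / 2 * (S1 + κ * S2) - N ^ 2 / 2 * (2 * densityLead * L ^ 2 +
      2 * densityConst * L + κ * (2 * densityLead * L))| ≤ (C1 + |κ| * C2) * N ^ 2 := by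
    rw [← mul_sub, abs_mul, abs_of_nonneg (by positivity)]
    have : |S1 + κ * S2 - (2 * densityLead * L ^ 2 + 2 * densityConst * L +
        κ * (2 * densityLead * L))| ≤ C1 + |κ| * C2 := by
      calc _ = |(S1 - (densityLead * (2 * L) ^ 2 / 2 + densityConst * (2 * L))) +
            κ * (S2 - densityLead * (2 * L))| := by congr 1; ring
        _ ≤ _ := by
            refine (abs_add_le _ _).trans (add_le_add c1 ?_)
            rw [abs_mul]
            gcongr
    calc _ ≤ N ^ 2 / 2 * (C1 + |κ| * C2) := by gcongr
      _ ≤ N ^ 2 * (C1 + |κ| * C2) := by gcongr; exact half_le_self (by positivity)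
      _ = _ := by ring
  have b' := b.trans hE
  rw [abs_le] at a b' d ⊢
  constructor <;> linarith

open Classical in
/-- `p` runs over `(U, (U² - n q) / k]` in the fibre over `q` and `(n, k)` with `n > U`. -/
lemma exists_abs_R₅_sub_le :
    ∃ C : ℝ, 0 ≤ C ∧ ∀ U : ℝ, 1 ≤ U →
      |(R₅ U : ℝ) - (U ^ 2) ^ 2 / 2 * ((Real.log U + γ - 3 / 2) *
        (densityLead * (Real.log U - 3 / 2) + densityConst))| ≤ C * (U ^ 2) ^ 2 := by
  obtain ⟨C, hC, h⟩ := exists_abs_ncard_sub_sum_upperDensity_le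
  obtain ⟨C1, hC1, h1⟩ := exists_abs_sum_upperDensity_div_mul_sq_sub_le
  refine ⟨C + 10 + 6 * C1, by positivity, fun U hU => ?_⟩
  have hU0 : 0 < U := by linarith
  have a := h U hU (Icc 1 ⌊U⌋₊) (Icc_floor_subset hU) (fun _ => U)
    (fun q w => (U ^ 2 - w.1 * q) / w.2) (fun w => U < w.1) (Case5 U)
    (fun _ _ => hU0.le) (fun _ _ _ _ => le_rfl)
    (fun q hq w hw p => by
      rw [← coeff_add_le_iff hw, mem_Icc, Nat.le_floor_iff hU0.le, Case5]
      -- As `n q ≤ U²` and `n > U`, the condition `q < p` follows from `U < p`.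
      have key : (w.1 : ℝ) * q + w.2 * p ≤ U ^ 2 → U < w.1 → (q : ℝ) < U := fun x y => by
        by_contra hcon
        have hcon' := not_lt.1 hcon
        have : 0 ≤ (w.2 : ℝ) * p := by positivity
        nlinarith
      constructor
      · rintro ⟨x, -, y, z⟩
        exact ⟨⟨hq, (key x z).le⟩, z, y, x⟩
      · rintro ⟨-, z, y, x⟩
        exact ⟨x, by exact_mod_cast (key x z).trans y, y, z⟩)
  set N := U ^ 2 with hN
  have hfl : (⌊U⌋₊ : ℝ) ≤ U := Nat.floor_le hU0.le
  set M := Real.log U + γ - 3 / 2 with hM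
  have b := abs_sum_mul_sub_le (A := Icc 1 ⌊U⌋₊) (δ := upperDensity)
    (G := fun q => ∑ w ∈ coeffPairs ⌊N⌋₊,
      (if U < w.1 then max ((N - w.1 * q) / w.2 - U) 0 else 0))
    (H := fun q => N ^ 2 / (2 * q) * (1 - q / U) ^ 2 * M)
    (E := fun q => 9 / 2 * N * √(N / q) + N * U)
    (fun q hq => upperDensity_mem (mem_Icc.1 hq).1)
    (fun q hq => by
      rw [mem_Icc, Nat.le_floor_iff hU0.le] at hq
      have g := abs_sum_length_large_sub_le (U := U) (q := q) (by exact_mod_cast hq.1) hq.2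
      have g2 : N * (U / q) ≤ N * √(N / q) := by
        gcongr
        exact div_le_sqrt_sq_div hq.1
      refine (le_of_eq ?_).trans (g.trans (by linarith))
      congr!)
  have hE : ∑ q ∈ Icc 1 ⌊U⌋₊, (9 / 2 * N * √(N / q) + N * U) ≤ 10 * N ^ 2 := by
    rw [Finset.sum_add_distrib, ← Finset.mul_sum, Finset.sum_const, Nat.card_Icc,
      Nat.add_sub_cancel, nsmul_eq_mul]
    have s1 := sum_sqrt_div_le (N := N) (by positivity) (M := ⌊U⌋₊) (by nlinarith)
    have s2 : (⌊U⌋₊ : ℝ) * (N * U) ≤ N ^ 2 := by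
      calc _ ≤ U * (N * U) := by gcongr
        _ = _ := by rw [hN]; ring
    have s3 : 9 / 2 * N * ∑ q ∈ Icc 1 ⌊U⌋₊, √(N / q) ≤ 9 / 2 * N * (2 * N) := by gcongr
    linarith
  have e : ∑ q ∈ Icc 1 ⌊U⌋₊, upperDensity q * (N ^ 2 / (2 * q) * (1 - q / U) ^ 2 * M) =
      N ^ 2 / 2 * (M * ∑ q ∈ Icc 1 ⌊U⌋₊, upperDensity q / q * (1 - q / U) ^ 2) := by
    rw [Finset.mul_sum, Finset.mul_sum]
    exact Finset.sum_congr rfl fun q _ => by ring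
  rw [e] at b
  have c1 := h1 U hU
  set S1 := ∑ q ∈ Icc 1 ⌊U⌋₊, upperDensity q / q * (1 - q / U) ^ 2
  obtain ⟨w1, -, w3, w4⟩ := rpow_quarter_facts hU
  have d : |N ^ 2 / 2 * (M * S1) - N ^ 2 / 2 * (M * (densityLead * (Real.log U - 3 / 2) +
      densityConst))| ≤ 6 * C1 * N ^ 2 := by
    rw [← mul_sub, ← mul_sub, abs_mul, abs_mul, abs_of_nonneg (by positivity)]
    set w := U ^ (1 / 4 : ℝ)
    -- The remainder `O(U^(-1/4))` of the density sum absorbs the factor `log U`.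
    have hMw : |M| ≤ 6 * w := by
      obtain ⟨g1, g2⟩ := gamma_bounds
      rw [hM, abs_le]
      constructor <;> linarith
    calc _ ≤ N ^ 2 / 2 * (6 * w * (C1 / w)) := by gcongr
      _ = 6 * C1 * N ^ 2 / 2 := by field_simp
      _ ≤ _ := half_le_self (by positivity)
  have b' := b.trans hE
  change |(R₅ U : ℝ) - _| ≤ _ at a
  rw [abs_le] at a b' d ⊢
  constructor <;> linarith

lemma ncard_lt_eq_add (U : ℝ) :
    (solutionSet U (fun p q _ _ => q < p)).ncard = R₃ U + (R₄ U + R₅ U) := by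
  have h1 : (solutionSet U (fun p q _ _ => q < p ∧ U < (p : ℝ))).ncard = R₄ U + R₅ U := by
    refine ncard_solutionSet_of_disjoint (fun p q n k => ?_) (fun p q n k h h' => ?_)
    · rw [Case4, Case5]
      have := le_or_gt (n : ℝ) U
      tauto
    · exact absurd h.2.2 (not_le.2 h'.2.2)
  rw [← h1]
  refine ncard_solutionSet_of_disjoint (fun p q n k => ?_) (fun p q n k h h' => ?_)
  · rw [Case3]
    have := le_or_gt (p : ℝ) U
    tauto
  · exact absurd h.2 (not_le.2 h'.2)

end LargerFirst

end

theorem mainTheorem5 :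
    (∃ C : ℝ, 0 < C ∧ ∀ U : ℝ, 1 ≤ U →
      |(R₁ U : ℝ) - Real.log 2 / (4 * zetaTwo) * U ^ 4 * Real.log U| ≤ C * U ^ 4) ∧
    (∃ C : ℝ, 0 < C ∧ ∀ U : ℝ, 1 ≤ U →
      |(R₂ U : ℝ) - Real.log 2 / (4 * zetaTwo) * U ^ 4 * Real.log U| ≤ C * U ^ 4) ∧
    (∃ C : ℝ, 0 < C ∧ ∀ U : ℝ, 1 ≤ U →
      |(R₃ U : ℝ) - (U ^ 4 * Real.log U ^ 2 / (8 * zetaTwo)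
          + U ^ 4 * Real.log U / (4 * zetaTwo)
            * (Real.eulerMascheroniConstant - zetaDerivTwo / zetaTwo
                + 3 * zetaTwo / 4 - Real.log 2))| ≤ C * U ^ 4) ∧
    (∃ C : ℝ, 0 < C ∧ ∀ U : ℝ, 1 ≤ U →
      |(R₄ U : ℝ) - (U ^ 4 * Real.log U ^ 2 / (8 * zetaTwo)
          + U ^ 4 * Real.log U / (4 * zetaTwo)
            * (Real.eulerMascheroniConstant - Real.log 2))| ≤ C * U ^ 4) ∧
    (∃ C : ℝ, 0 < C ∧ ∀ U : ℝ, 1 ≤ U →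
      |(R₅ U : ℝ) - (U ^ 4 / (4 * zetaTwo) * Real.log U ^ 2
          + U ^ 4 / (2 * zetaTwo)
            * (Real.eulerMascheroniConstant - zetaDerivTwo / (2 * zetaTwo)
                - 3 / 2 + 3 * zetaTwo / 8) * Real.log U)| ≤ C * U ^ 4) := by
  obtain ⟨C12, h12, H12⟩ := exists_abs_R₁_R₂_sub_le
  obtain ⟨C3, h3, H3⟩ := exists_abs_R₃_sub_le
  obtain ⟨C5, h5, H5⟩ := exists_abs_R₅_sub_le
  obtain ⟨Ct, ht, Ht⟩ := exists_abs_ncard_lt_sub_le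
  have hz := zetaTwo_pos.ne'
  -- The constant term of the product of two linear polynomials in `log U` that describes `R₅`.
  set c := (Real.eulerMascheroniConstant - 3 / 2) * (densityConst - 3 / 2 * densityLead) with hc
  have e12 : ∀ U : ℝ, Real.log 2 / (4 * zetaTwo) * U ^ 4 * Real.log U =
      (U ^ 2) ^ 2 / 2 * Real.log 2 * (densityLead * Real.log U) := fun U => by
    rw [densityLead]
    field_simp
    ring
  have e3 : ∀ U : ℝ, U ^ 4 * Real.log U ^ 2 / (8 * zetaTwo) + U ^ 4 * Real.log U / (4 * zetaTwo)
      * (Real.eulerMascheroniConstant - zetaDerivTwo / zetaTwo + 3 * zetaTwo / 4 - Real.log 2) =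
      (U ^ 2) ^ 2 / 2 * (densityLead * Real.log U ^ 2 / 2 +
        densityConst * Real.log U - Real.log 2 * (densityLead * Real.log U)) := fun U => by
    rw [densityLead, densityConst]
    field_simp
    ring
  have e4 : ∀ U : ℝ, U ^ 4 * Real.log U ^ 2 / (8 * zetaTwo) + U ^ 4 * Real.log U / (4 * zetaTwo)
      * (Real.eulerMascheroniConstant - Real.log 2) =
      (U ^ 2) ^ 2 / 2 * (densityLead * Real.log U ^ 2 / 2 +
        densityLead * Real.log U * (Real.eulerMascheroniConstant - Real.log 2)) := fun U => by
    rw [densityLead]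
    field_simp
    ring
  have e5 : ∀ U : ℝ, U ^ 4 / (4 * zetaTwo) * Real.log U ^ 2 + U ^ 4 / (2 * zetaTwo)
      * (Real.eulerMascheroniConstant - zetaDerivTwo / (2 * zetaTwo)
        - 3 / 2 + 3 * zetaTwo / 8) * Real.log U =
      (U ^ 2) ^ 2 / 2 * ((Real.log U + Real.eulerMascheroniConstant - 3 / 2) *
        (densityLead * (Real.log U - 3 / 2) + densityConst)) - c / 2 * (U ^ 2) ^ 2 := fun U => by
    rw [hc, densityLead, densityConst]
    field_simp
    ring
  have e : ∀ U : ℝ, U ^ 4 = (U ^ 2) ^ 2 := fun U => by ring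
  have hcU : ∀ U : ℝ, |c / 2 * (U ^ 2) ^ 2| ≤ |c| * (U ^ 2) ^ 2 := fun U => by
    rw [abs_mul, abs_of_nonneg (by positivity : 0 ≤ (U ^ 2) ^ 2), abs_div, abs_two]
    gcongr
    exact half_le_self (abs_nonneg c)
  refine ⟨⟨C12 + 1, by positivity, fun U hU => ?_⟩, ⟨C12 + 1, by positivity, fun U hU => ?_⟩,
    ⟨C3 + 1, by positivity, fun U hU => ?_⟩,
    ⟨Ct + C3 + C5 + |c| + 1, by positivity, fun U hU => ?_⟩,
    ⟨C5 + |c| + 1, by positivity, fun U hU => ?_⟩⟩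
  · rw [e12, e]
    exact (H12 U hU).1.trans (by gcongr; linarith)
  · rw [e12, e]
    exact (H12 U hU).2.trans (by gcongr; linarith)
  · rw [e3, e]
    exact (H3 U hU).trans (by gcongr; linarith)
  · rw [e4, e]
    have t := Ht U hU
    have t3 := H3 U hU
    have t5 := H5 U hU
    have tc := hcU U
    have : 0 ≤ (U ^ 2) ^ 2 := by positivity
    rw [ncard_lt_eq_add] at t
    push_cast at t
    set L := Real.log U
    set N := (U ^ 2) ^ 2
    have key : (R₄ U : ℝ) - N / 2 * (densityLead * L ^ 2 / 2 +
        densityLead * L * (Real.eulerMascheroniConstant - Real.log 2)) =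
        (R₃ U + (R₄ U + R₅ U) - N / 2 * (2 * densityLead * L ^ 2 + 2 * densityConst * L +
          (Real.eulerMascheroniConstant - 3 / 2 - Real.log 2) * (2 * densityLead * L))) -
        (R₃ U - N / 2 * (densityLead * L ^ 2 / 2 + densityConst * L -
          Real.log 2 * (densityLead * L))) -
        (R₅ U - N / 2 * ((L + Real.eulerMascheroniConstant - 3 / 2) *
          (densityLead * (L - 3 / 2) + densityConst))) - c / 2 * N := by
      rw [hc]
      ring
    rw [key]
    rw [abs_le] at t t3 t5 tc ⊢
    constructor <;> linarith
  · rw [e5, e]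
    have t5 := H5 U hU
    have tc := hcU U
    have : 0 ≤ (U ^ 2) ^ 2 := by positivity
    rw [abs_le] at t5 tc ⊢
    constructor <;> linarith
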